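/- Let $q$ be a prime power, $\lambda\in(0,1-1/q)$, $\rho\in(0,1)$ and $\epsilon\in(0,1-H_q(\lambda))$, where $H_q(x)=-x\log_q x-(1-x)\log_q(1-x)+x\log_q(q-1)$. Constants below are positive and depend only on $q,\lambda,\epsilon,\rho$. "Operations" are additions, subtractions, multiplications, divisions, comparisons, selections and loadings of constants, in $\mathbb F_q$ and in $\mathbb R$, performed by a straight-line program that may depend on all parameters and on the matrices, but not on the received vector. The noise model is the $q$-ary symmetric channel with crossover probability $\lambda$: the noise symbols are independent, equal to $0$ with probability $1-\lambda$ and to each non-zero $a\in\mathbb F_q$ with probability $\lambda/(q-1)$. For $t\in\mathbb N$ put $k=\lfloor\epsilon t\rfloor$, $N(t)=t\,q^{k}$ and $K(t)=k\lceil\rho q^{k}\rceil$. There is a family of linear codes $\mathcal C_{con}(t,\epsilon,\rho)$ over $\mathbb F_q$ such that for all sufficiently large $t$ the code $\mathcal C_{con}(t,\epsilon,\rho)$ is a concatenated code of length $N(t)$ and dimension $K(t)$ (inner code: a linear code over $\mathbb F_q$ of length $t$ and dimension $k$; outer code: a Reed–Solomon code over $\mathbb F_{q^{k}}$ of length $q^{k}$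 and dimension $\lceil\rho q^{k}\rceil$) that has a decoder with $O(N(t)^2\log N(t))$ operations and with error probability at most $q^{-a N(t)}$ over this channel for every codeword sent, for a constant $a>0$; and there are a constant $c>0$ and a threshold $B$, depending only on $q,\lambda,\epsilon,\rho$, such that the following holds for all integers $b,n\ge B$ with $n>2b$ and all integers $s\ge\lceil\log_q n\rceil$. Let $t^*$ be the real solution of $\epsilon\rho\,x\,q^{\epsilon x}=4qbs$, let $m=N(\lceil t^*\rceil)$ and $m'=K(\lceil t^*\rceil)$, and let $\alpha$ be a primitive element of $\mathbb F_{q^s}$. For a matrix $M=[\mu_{jl}]$ over $\mathbb F_q$ with $n$ columns and $2bs$ rows, let $\phi_s(M)$ be the $2b\times n$ matrix over $\mathbb F_{q^s}$ with $(r,l)$ entry $\sum_{i=0}^{s-1}\mu_{(r-1)s+i+1,\,l}\,\alpha^i$. Then: (1) $\lceil t^*\rceil$ is large enough for the stated properties of $\mathcal C_{con}(\lceil t^*\rceil,\epsilon,\rho)$; the number $m$ of measurements is $\Theta(bs)$, and in particular $m=\Theta(b\log_q n)$ if $s=\lceil\log_q n\rceil$. (2) There are matrices $A'\in\mathbb F_q^{m'\times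 n}$ with the property (*): some $2bs$ rows of $A'$, in some order, form a matrix $A''$ such that $\phi_s(A'')$ is a parity-check matrix of an $[n,n-2b,2b+1]_{q^s}$ Reed–Solomon code (distinct locators, arbitrary non-zero column multipliers). (3) Let $G\in\mathbb F_q^{m\times m'}$ be any generator matrix of $\mathcal C_{con}(\lceil t^*\rceil,\epsilon,\rho)$ (its columns form a basis of the code), let $A'$ be any matrix with property (*), and let $A=GA'$. Then there is a program with $O\big((n+b\log(bs))\,b\,s^2\big)$ operations in $\mathbb F_q$ and $\mathbb R$ that recovers every $x\in\mathcal S_q$ from $y=Ax+e$ with probability at least $1-q^{-cbs}$, where $e\in\mathbb F_q^m$ is the noise of the channel. Here $\mathcal S_q\subset\mathbb F_q^n$ is the set of images, under a bijection $\mathcal A\to\mathbb F_q$ with $0\mapsto0$, of the vectors with entries in a finite alphabet $\mathcal A\subset\mathbb R$ with $0\in\mathcal A$, $|\mathcal A|=q$, that have at most $b$ non-zero entries. -/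

import Mathlib

open scoped Matrix

noncomputable section

namespace SparseRecovery

/-! ### Signals, entropy, noise -/

/-- The signals over the real alphabet `𝒜` with at most `b` non-zero entries. -/
def alphabetSignals (𝒜 : Finset ℝ) (n b : ℕ) : Set (Fin n → 𝒜) :=
  {z | {i | (z i : ℝ) ≠ 0}.ncard ≤ b}

/-- The set `S_q`: the images of the sparse alphabet signals under the identification
`φ` of the alphabet with the finite field. -/
def fieldSignals {F : Type*} {𝒜 : Finset ℝ} (φ : 𝒜 ≃ F) (n b : ℕ) : Set (Fin n → F) :=
  (fun z i => φ (z i)) '' alphabetSignals 𝒜 n b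

/-- The `q`-ary entropy function `H_q` (logarithms to base `q`). -/
def qEntropy (q : ℕ) (x : ℝ) : ℝ :=
  -x * Real.logb q x - (1 - x) * Real.logb q (1 - x) + x * Real.logb q ((q : ℝ) - 1)

open Classical in
/-- The law of one noise symbol of the `q`-ary symmetric channel with crossover
probability `lam`. -/
def symbolProb {F : Type*} [Field F] [Fintype F] (lam : ℝ) (a : F) : ℝ :=
  if a = 0 then 1 - lam else lam / ((Fintype.card F : ℝ) - 1)

open Classical in
/-- The probability that a noise vector of `m` independent symbols lies in `S`. -/
def noiseProb {F : Type*} [Field F] [Fintype F] (lam : ℝ) {m : ℕ}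
    (S : Set (Fin m → F)) : ℝ :=
  ∑ e : Fin m → F, if e ∈ S then ∏ i, symbolProb lam (e i) else 0

/-! ### Programs over `F` and `ℝ`, with a count of operations

A program is a straight-line list of instructions on two banks of registers, one with
entries in `F` and one with entries in `ℝ`.  Addresses are fixed in advance, there are no
jumps; decisions are made only by the test and selection instructions. Each instruction
(also loading a constant, a test, a selection) counts as one operation. -/

/-- Instructions; the first argument is the address of the register that is written. -/
inductive Instr (F : Type*) where
  | fconst (d : ℕ) (a : F)
  | fadd (d i j : ℕ)
  | fsub (d i j : ℕ)
  | fmul (d i j : ℕ)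
  | fdiv (d i j : ℕ)
  | rconst (d : ℕ) (a : ℝ)
  | radd (d i j : ℕ)
  | rsub (d i j : ℕ)
  | rmul (d i j : ℕ)
  | rdiv (d i j : ℕ)
  /-- real register `d` becomes `1` if the field registers `i`, `j` agree, else `0` -/
  | feq (d i j : ℕ)
  /-- real register `d` becomes `1` if real register `i` is at most `j`, else `0` -/
  | rle (d i j : ℕ)
  /-- field register `d` becomes field register `i` if real register `k` is non-zero,
  else field register `j` -/
  | fsel (d k i j : ℕ)
  /-- the same for real registers -/
  | rsel (d k i j : ℕ)

/-- Contents of the two register banks. -/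
structure Memory (F : Type*) where
  fld : ℕ → F
  rea : ℕ → ℝ

open Classical in
/-- Execution of one instruction. -/
def Instr.step {F : Type*} [Field F] (M : Memory F) : Instr F → Memory F
  | .fconst d a => { M with fld := Function.update M.fld d a }
  | .fadd d i j => { M with fld := Function.update M.fld d (M.fld i + M.fld j) }
  | .fsub d i j => { M with fld := Function.update M.fld d (M.fld i - M.fld j) }
  | .fmul d i j => { M with fld := Function.update M.fld d (M.fld i * M.fld j) }
  | .fdiv d i j => { M with fld := Function.update M.fld d (M.fld i / M.fld j) }
  | .rconst d a => { M with rea := Function.update M.rea d a }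
  | .radd d i j => { M with rea := Function.update M.rea d (M.rea i + M.rea j) }
  | .rsub d i j => { M with rea := Function.update M.rea d (M.rea i - M.rea j) }
  | .rmul d i j => { M with rea := Function.update M.rea d (M.rea i * M.rea j) }
  | .rdiv d i j => { M with rea := Function.update M.rea d (M.rea i / M.rea j) }
  | .feq d i j => { M with rea := Function.update M.rea d (if M.fld i = M.fld j then 1 else 0) }
  | .rle d i j => { M with rea := Function.update M.rea d (if M.rea i ≤ M.rea j then 1 else 0) }
  | .fsel d k i j =>
      { M with fld := Function.update M.fld d (if M.rea k ≠ 0 then M.fld i else M.fld j) }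
  | .rsel d k i j =>
      { M with rea := Function.update M.rea d (if M.rea k ≠ 0 then M.rea i else M.rea j) }

/-- A program; its number of operations is the length of the list. -/
abbrev Program (F : Type*) := List (Instr F)

/-- Execution of a program. -/
def Program.exec {F : Type*} [Field F] (P : Program F) (M : Memory F) : Memory F :=
  P.foldl Instr.step M

/-- The memory with the input `y` in the first `m` field registers, and zeros elsewhere. -/
def inputMemory {F : Type*} [Field F] {m : ℕ} (y : Fin m → F) : Memory F where
  fld := fun i => if h : i < m then y ⟨i, h⟩ else 0
  rea := fun _ => 0

/-- The result: the first `n` field registers after execution on the input `y`. -/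
def Program.output {F : Type*} [Field F] (P : Program F) {m : ℕ} (y : Fin m → F) (n : ℕ) :
    Fin n → F :=
  fun i => (P.exec (inputMemory y)).fld i

/-! ### Linear codes -/

/-- The code of all vectors `(v_j f(a_j))_j`, where `f` is a polynomial of degree `< k`. -/
def evalCode {E : Type*} [Field E] {n : ℕ} (a v : Fin n → E) (k : ℕ) :
    Submodule E (Fin n → E) :=
  (Polynomial.degreeLT E k).map (LinearMap.pi fun j => v j • Polynomial.leval (a j))

/-- Reed--Solomon codes of length `n` and dimension `k ≤ n` (minimum distance `n - k + 1`):
distinct locators, and arbitrary non-zero column multipliers (all equal to `1` in the plain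
case). -/
def IsReedSolomon {E : Type*} [Field E] {n : ℕ} (k : ℕ) (C : Submodule E (Fin n → E)) : Prop :=
  k ≤ n ∧ ∃ a v : Fin n → E, Function.Injective a ∧ (∀ j, v j ≠ 0) ∧ C = evalCode a v k

/-- `G` is a generator matrix of `C` (message `u` is encoded as `G u`, so that the columns
of `G` form a basis of `C`). -/
def IsGeneratorMatrix {F : Type*} [Field F] {N K : ℕ} (G : Matrix (Fin N) (Fin K) F)
    (C : Submodule F (Fin N → F)) : Prop :=
  Function.Injective G.mulVec ∧ ∀ c, c ∈ C ↔ ∃ u, G *ᵥ u = c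

/-- `H` (with `r` rows) is a parity check matrix of an `[n, n - r, r + 1]` Reed--Solomon code. -/
def IsRSParityCheck {E : Type*} [Field E] {r n : ℕ} (H : Matrix (Fin r) (Fin n) E) : Prop :=
  r ≤ n ∧ ∃ C : Submodule E (Fin n → E), IsReedSolomon (n - r) C ∧ ∀ c, c ∈ C ↔ H *ᵥ c = 0

/-- The concatenated code: every symbol of an outer codeword is encoded by `inner`. -/
def concatCode {F E : Type*} [Field F] [Field E] [Algebra F E] {M t : ℕ}
    (outer : Submodule E (Fin M → E)) (inner : E →ₗ[F] (Fin t → F)) :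
    Submodule F (Fin (M * t) → F) :=
  (outer.restrictScalars F).map (LinearMap.pi fun i =>
    LinearMap.proj (finProdFinEquiv.symm i).2 ∘ₗ inner ∘ₗ
      LinearMap.proj (finProdFinEquiv.symm i).1)

/-- The length `N = t q^⌊ε t⌋`. -/
def conLength (q : ℕ) (ε : ℝ) (t : ℕ) : ℕ := q ^ ⌊ε * t⌋₊ * t

/-- The dimension `K = ⌊ε t⌋ ⌈ρ q^⌊ε t⌋⌉`. -/
def conDim (q : ℕ) (ε ρ : ℝ) (t : ℕ) : ℕ := ⌊ε * t⌋₊ * ⌈ρ * (q : ℝ) ^ ⌊ε * t⌋₊⌉₊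

/-- `C` is a concatenated code with parameters `t, ε, ρ`: the inner code is a linear
`[t, ⌊ε t⌋]` code over `F`, the outer code a Reed--Solomon code of length `q^⌊ε t⌋` and
dimension `⌈ρ q^⌊ε t⌋⌉` over the extension of `F` of degree `⌊ε t⌋`. -/
def IsConcatenated.{u} {F : Type u} [Field F] [Fintype F] (ε ρ : ℝ) (t : ℕ)
    (C : Submodule F (Fin (conLength (Fintype.card F) ε t) → F)) : Prop :=
  ∃ (E : Type u) (_ : Field E) (_ : Algebra F E)
    (outer : Submodule E (Fin (Fintype.card F ^ ⌊ε * t⌋₊) → E)) (inner : E →ₗ[F] (Fin t → F)),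
    Nat.card E = Fintype.card F ^ ⌊ε * t⌋₊ ∧ Module.finrank F E = ⌊ε * t⌋₊ ∧
    IsReedSolomon ⌈ρ * (Fintype.card F : ℝ) ^ ⌊ε * t⌋₊⌉₊ outer ∧
    Function.Injective inner ∧ C = concatCode outer inner

/-- `C` can serve as the code `C_con(t, ε, ρ)`, for the symmetric channel with crossover
probability `lam`: it is a concatenated `[N, K]` code that has a decoder with at most
`A N² log N` operations and with error probability at most `q^(-a N)`, for every codeword
that is sent. -/
def IsConCode.{u} {F : Type u} [Field F] [Fintype F] (lam ε ρ a A : ℝ) (t : ℕ)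
    (C : Submodule F (Fin (conLength (Fintype.card F) ε t) → F)) : Prop :=
  IsConcatenated ε ρ t C ∧
  Module.finrank F C = conDim (Fintype.card F) ε ρ t ∧
  ∃ D : Program F,
    (D.length : ℝ) ≤ A * ((conLength (Fintype.card F) ε t : ℝ) ^ 2 *
      Real.log (conLength (Fintype.card F) ε t)) ∧
    ∀ c ∈ C, 1 - (Fintype.card F : ℝ) ^ (-(a * conLength (Fintype.card F) ε t)) ≤
      noiseProb lam {e | D.output (c + e) (conLength (Fintype.card F) ε t) = c}

/-! ### Field lifting -/

/-- The map `φ_s`: blocks of `s` consecutive rows over `F` are combined to one row over the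
extension field, with coefficients `1, α, …, α^(s-1)`. -/
def fieldLift {F L : Type*} [Field F] [Field L] [Algebra F L] (α : L) {r s n : ℕ}
    (A : Matrix (Fin (r * s)) (Fin n) F) : Matrix (Fin r) (Fin n) L :=
  Matrix.of fun k l => ∑ t : Fin s, algebraMap F L (A (finProdFinEquiv (k, t)) l) * α ^ (t : ℕ)

/-- Some `2bs` rows of `A'` form a matrix `A''` such that `φ_s(A'')` is a parity check matrix
of an `[n, n - 2b, 2b + 1]` Reed--Solomon code over the extension field `L`. -/
def HasRSRows {F L : Type*} [Field F] [Field L] [Algebra F L] (α : L) (b s : ℕ) {K n : ℕ}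
    (A' : Matrix (Fin K) (Fin n) F) : Prop :=
  ∃ r : Fin (2 * b * s) ↪ Fin K, IsRSParityCheck (fieldLift α (A'.submatrix r id))

end SparseRecovery

end

noncomputable section

namespace SparseRecovery

/-! ### Straight-line computations on abstract values -/

/-! The vector `A'x` is encoded by the concatenated code, so `y` is a noisy codeword. The channel
decoder recovers `GA'x` except with probability `q^(-aN)`, where `N = m` has order `bs`. If `GA'x =
0`, then `A'x = 0` because `G` is injective, hence the lifted parity check annihilates `x` and `x`
lies in a Reed–Solomon code over the extension field. Therefore the `2b` weighted power sums of `x`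
that define this code factor linearly through `GA'x` (`exists_syndrome_map`). A vector with at most
`b` non-zero entries is determined by `2b` such power sums, and a syndrome decoder finds it
(`sparseDecode_eq`).

The syndrome decoder solves the key equation by a division-free iteration on a pair of approximate
solutions. Their determinant stays a non-zero multiple of a power of `X`, which forces the solution
of smaller degree to vanish at exactly the inverses of the non-zero locators in error
(`KeyState.Inv.locate`). Error values are found by trial among finitely many candidates: the base
field when `x` is recovered, the whole outer field inside the channel decoder. Thus the extension
field is never asked for an inverse of a computed value, and each of its operations costs a number
of base field operations quadratic in the degree.

The good codes come from averaging. At rate `ε` below capacity a random linear inner code, decoded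
within a fixed radius, fails with exponentially small probability (`exists_innerCode`). The outer
code tolerates a fraction of about `(1-ρ)/2` of failed blocks, and more failures have probability
exponentially small in `N` (`noiseProb_bad_blocks_le`, `exists_isConCode_of_inner`). Inner decoding
tries all `q^k` messages for each of the `q^k` blocks, which already fits into `O(N²)`.

Costs are counted for values regarded as functions of the input (`Computes`), where nothing is ever
overwritten. `Program.computes` and `Computes.exists_program` translate between this calculus and
programs. -/

/-- A value computed from an input in `X`: an element of `F` or a real number. -/
abbrev Val (X F : Type*) := (X → F) ⊕ (X → ℝ)

open Classical in
/-- The indicator of a predicate, as a real valued function. -/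
def ind {X : Type*} (p : X → Prop) : X → ℝ := fun x => if p x then 1 else 0

open Classical in
/-- The values obtained by one operation from the values in `Φ`. -/
inductive OneOp {X F : Type*} [Field F] (Φ : Set (Val X F)) : Val X F → Prop
  | fconst (a : F) : OneOp Φ (.inl fun _ => a)
  | fadd (f g : X → F) : .inl f ∈ Φ → .inl g ∈ Φ → OneOp Φ (.inl fun x => f x + g x)
  | fsub (f g : X → F) : .inl f ∈ Φ → .inl g ∈ Φ → OneOp Φ (.inl fun x => f x - g x)
  | fmul (f g : X → F) : .inl f ∈ Φ → .inl g ∈ Φ → OneOp Φ (.inl fun x => f x * g x)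
  | fdiv (f g : X → F) : .inl f ∈ Φ → .inl g ∈ Φ → OneOp Φ (.inl fun x => f x / g x)
  | rconst (a : ℝ) : OneOp Φ (.inr fun _ => a)
  | radd (f g : X → ℝ) : .inr f ∈ Φ → .inr g ∈ Φ → OneOp Φ (.inr fun x => f x + g x)
  | rsub (f g : X → ℝ) : .inr f ∈ Φ → .inr g ∈ Φ → OneOp Φ (.inr fun x => f x - g x)
  | rmul (f g : X → ℝ) : .inr f ∈ Φ → .inr g ∈ Φ → OneOp Φ (.inr fun x => f x * g x)
  | rdiv (f g : X → ℝ) : .inr f ∈ Φ → .inr g ∈ Φ → OneOp Φ (.inr fun x => f x / g x)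
  | feq (f g : X → F) : .inl f ∈ Φ → .inl g ∈ Φ → OneOp Φ (.inr (ind fun x => f x = g x))
  | rle (f g : X → ℝ) : .inr f ∈ Φ → .inr g ∈ Φ → OneOp Φ (.inr (ind fun x => f x ≤ g x))
  | fsel (r : X → ℝ) (f g : X → F) : .inr r ∈ Φ → .inl f ∈ Φ → .inl g ∈ Φ →
      OneOp Φ (.inl fun x => if r x ≠ 0 then f x else g x)
  | rsel (r : X → ℝ) (f g : X → ℝ) : .inr r ∈ Φ → .inr f ∈ Φ → .inr g ∈ Φ →
      OneOp Φ (.inr fun x => if r x ≠ 0 then f x else g x)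

/-- The values in `Ψ` can be computed from the values in `Φ` with at most `c` operations. -/
inductive Computes {X F : Type*} [Field F] : Set (Val X F) → ℕ → Set (Val X F) → Prop
  | sub (Φ : Set (Val X F)) (c : ℕ) (Ψ : Set (Val X F)) : Ψ ⊆ Φ → Computes Φ c Ψ
  | op (Φ : Set (Val X F)) (c : ℕ) (Ψ : Set (Val X F)) (v : Val X F) :
      OneOp Φ v → Computes (insert v Φ) c Ψ → Computes Φ (c + 1) Ψ

section framework

variable {X F : Type*} [Field F] {Φ Φ' Ψ Ψ' Θ : Set (Val X F)} {c c' : ℕ}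

theorem OneOp.mono (h : Φ ⊆ Φ') {v : Val X F} (hv : OneOp Φ v) : OneOp Φ' v := by
  cases hv with
  | fconst a => exact .fconst a
  | rconst a => exact .rconst a
  | fadd f g h1 h2 => exact .fadd f g (h h1) (h h2)
  | fsub f g h1 h2 => exact .fsub f g (h h1) (h h2)
  | fmul f g h1 h2 => exact .fmul f g (h h1) (h h2)
  | fdiv f g h1 h2 => exact .fdiv f g (h h1) (h h2)
  | radd f g h1 h2 => exact .radd f g (h h1) (h h2)
  | rsub f g h1 h2 => exact .rsub f g (h h1) (h h2)
  | rmul f g h1 h2 => exact .rmul f g (h h1) (h h2)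
  | rdiv f g h1 h2 => exact .rdiv f g (h h1) (h h2)
  | feq f g h1 h2 => exact .feq f g (h h1) (h h2)
  | rle f g h1 h2 => exact .rle f g (h h1) (h h2)
  | fsel r f g h0 h1 h2 => exact .fsel r f g (h h0) (h h1) (h h2)
  | rsel r f g h0 h1 h2 => exact .rsel r f g (h h0) (h h1) (h h2)

theorem Computes.mono_left (h : Computes Φ c Ψ) : ∀ {Φ' : Set (Val X F)}, Φ ⊆ Φ' →
    Computes Φ' c Ψ := by
  induction h with
  | sub Φ c Ψ h => exact fun h' => .sub _ _ _ (h.trans h')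
  | op Φ c Ψ v hv _ ih => exact fun h' => .op _ _ _ v (hv.mono h') (ih (Set.insert_subset_insert h'))

theorem Computes.mono_cost (h : Computes Φ c Ψ) : ∀ {c' : ℕ}, c ≤ c' → Computes Φ c' Ψ := by
  induction h with
  | sub Φ c Ψ h => exact fun _ => .sub _ _ _ h
  | op Φ c Ψ v hv _ ih =>
    intro c' h'
    obtain ⟨k, rfl⟩ : ∃ k, c' = k + 1 := ⟨c' - 1, by omega⟩
    exact .op _ _ _ v hv (ih (by omega))

/-- Sequential composition; everything computed before remains available. -/
theorem Computes.bind (h : Computes Φ c Ψ) :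
    (∀ Φ', Φ ⊆ Φ' → Ψ ⊆ Φ' → Computes Φ' c' Θ) → Computes Φ (c + c') Θ := by
  induction h with
  | sub Φ c Ψ h => exact fun h' => (h' _ subset_rfl h).mono_cost (by omega)
  | op Φ c Ψ v hv _ ih =>
    intro h'
    have := ih fun Φ' h1 h2 => h' Φ' ((Set.subset_insert _ _).trans h1) h2
    rw [Nat.add_right_comm]
    exact .op _ _ _ v hv this

theorem Computes.mono_right (h : Computes Φ c Ψ) (h' : Ψ' ⊆ Ψ) : Computes Φ c Ψ' :=
  h.bind (c' := 0) fun _ _ h2 => .sub _ _ _ (h'.trans h2)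

theorem Computes.union (h : Computes Φ c Ψ) (h' : Computes Φ c' Ψ') :
    Computes Φ (c + c') (Ψ ∪ Ψ') :=
  h.bind fun _ h1 h2 => (h'.mono_left h1).bind (c' := 0) fun _ h3 h4 =>
    Computes.sub _ _ _ (Set.union_subset (h2.trans h3) h4)

theorem Computes.biUnion {ι : Type*} (s : Finset ι) {Ψ : ι → Set (Val X F)}
    (h : ∀ i ∈ s, Computes Φ c (Ψ i)) : Computes Φ (s.card * c) (⋃ i ∈ s, Ψ i) := by
  classical
  induction s using Finset.induction_on with
  | empty => exact .sub _ _ _ (by simp)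
  | insert a s ha ih =>
    rw [Finset.card_insert_of_notMem ha, add_mul, one_mul, add_comm, Finset.set_biUnion_insert]
    exact (h a (by simp)).union (ih fun i hi => h i (by simp [hi]))

theorem Computes.iUnion {ι : Type*} [Fintype ι] {Ψ : ι → Set (Val X F)}
    (h : ∀ i, Computes Φ c (Ψ i)) : Computes Φ (Fintype.card ι * c) (⋃ i, Ψ i) := by
  simpa using Computes.biUnion Finset.univ (fun i _ => h i)

/-- One more operation on values that are computed by `h`. -/
theorem Computes.oneOp (h : Computes Φ c Ψ) {v : Val X F} (hv : OneOp Ψ v) :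
    Computes Φ (c + 1) {v} :=
  h.bind fun _ _ h2 => .op _ _ _ v (hv.mono h2) (.sub _ _ _ (by simp))

/-- The field value `f` can be computed from `Φ` with at most `c` operations. -/
abbrev CompF (Φ : Set (Val X F)) (c : ℕ) (f : X → F) : Prop := Computes Φ c {.inl f}

/-- The real value `r` can be computed from `Φ` with at most `c` operations. -/
abbrev CompR (Φ : Set (Val X F)) (c : ℕ) (r : X → ℝ) : Prop := Computes Φ c {.inr r}

theorem Computes.of_mem {v : Val X F} (h : v ∈ Φ) : Computes Φ 0 {v} :=
  .sub _ _ _ (by simpa using h)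

theorem CompF.const (a : F) : CompF Φ 1 (fun _ => a) :=
  (Computes.sub Φ 0 Φ subset_rfl).oneOp (.fconst a)

theorem CompR.const (a : ℝ) : CompR Φ 1 (fun _ => a) :=
  (Computes.sub Φ 0 Φ subset_rfl).oneOp (.rconst a)

theorem CompF.add {f g : X → F} (hf : CompF Φ c f) (hg : CompF Φ c' g) :
    CompF Φ (c + c' + 1) (fun x => f x + g x) :=
  (hf.union hg).oneOp (.fadd f g (by simp) (by simp))

theorem CompF.sub {f g : X → F} (hf : CompF Φ c f) (hg : CompF Φ c' g) :
    CompF Φ (c + c' + 1) (fun x => f x - g x) :=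
  (hf.union hg).oneOp (.fsub f g (by simp) (by simp))

theorem CompF.mul {f g : X → F} (hf : CompF Φ c f) (hg : CompF Φ c' g) :
    CompF Φ (c + c' + 1) (fun x => f x * g x) :=
  (hf.union hg).oneOp (.fmul f g (by simp) (by simp))

theorem CompR.add {f g : X → ℝ} (hf : CompR Φ c f) (hg : CompR Φ c' g) :
    CompR Φ (c + c' + 1) (fun x => f x + g x) :=
  (hf.union hg).oneOp (.radd f g (by simp) (by simp))

theorem CompR.sub {f g : X → ℝ} (hf : CompR Φ c f) (hg : CompR Φ c' g) :
    CompR Φ (c + c' + 1) (fun x => f x - g x) :=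
  (hf.union hg).oneOp (.rsub f g (by simp) (by simp))

theorem CompR.mul {f g : X → ℝ} (hf : CompR Φ c f) (hg : CompR Φ c' g) :
    CompR Φ (c + c' + 1) (fun x => f x * g x) :=
  (hf.union hg).oneOp (.rmul f g (by simp) (by simp))

theorem CompR.eq {f g : X → F} (hf : CompF Φ c f) (hg : CompF Φ c' g) :
    CompR Φ (c + c' + 1) (ind fun x => f x = g x) :=
  (hf.union hg).oneOp (.feq f g (by simp) (by simp))

theorem CompR.le {f g : X → ℝ} (hf : CompR Φ c f) (hg : CompR Φ c' g) :
    CompR Φ (c + c' + 1) (ind fun x => f x ≤ g x) :=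
  (hf.union hg).oneOp (.rle f g (by simp) (by simp))

theorem ind_ne_zero {p : X → Prop} {x : X} : ind p x ≠ 0 ↔ p x := by
  unfold ind; split_ifs <;> simp_all

open Classical in
theorem CompF.ite {p : X → Prop} {f g : X → F} {c'' : ℕ} (hp : CompR Φ c (ind p))
    (hf : CompF Φ c' f) (hg : CompF Φ c'' g) :
    CompF Φ (c + c' + c'' + 1) (fun x => if p x then f x else g x) := by
  have := ((hp.union hf).union hg).oneOp (.fsel (ind p) f g (by simp) (by simp) (by simp))
  simpa only [ind_ne_zero] using this

open Classical in
theorem CompR.ite {p : X → Prop} {f g : X → ℝ} {c'' : ℕ} (hp : CompR Φ c (ind p))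
    (hf : CompR Φ c' f) (hg : CompR Φ c'' g) :
    CompR Φ (c + c' + c'' + 1) (fun x => if p x then f x else g x) := by
  have := ((hp.union hf).union hg).oneOp (.rsel (ind p) f g (by simp) (by simp) (by simp))
  simpa only [ind_ne_zero] using this

theorem CompR.not {p : X → Prop} (hp : CompR Φ c (ind p)) :
    CompR Φ (c + 2) (ind fun x => ¬ p x) := by
  convert ((CompR.const 1).sub hp).mono_cost (c' := c + 2) (by omega) using 3 with x
  unfold ind; split_ifs <;> simp_all

theorem CompR.and {p p' : X → Prop} (hp : CompR Φ c (ind p)) (hp' : CompR Φ c' (ind p')) :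
    CompR Φ (c + c' + 1) (ind fun x => p x ∧ p' x) := by
  convert hp.mul hp' using 3 with x
  unfold ind; split_ifs <;> simp_all

theorem CompR.or {p p' : X → Prop} (hp : CompR Φ c (ind p)) (hp' : CompR Φ c' (ind p')) :
    CompR Φ (c + c' + 7) (ind fun x => p x ∨ p' x) := by
  refine ((hp.not.and hp'.not).not.mono_cost (by omega)).mono_right (le_of_eq ?_)
  simp only [not_and_or, not_not]

theorem CompF.sum {ι : Type*} (s : Finset ι) {f : ι → X → F} (h : ∀ i ∈ s, CompF Φ c (f i)) :
    CompF Φ (s.card * (c + 1) + 1) (fun x => ∑ i ∈ s, f i x) := by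
  classical
  induction s using Finset.induction_on with
  | empty => simpa using CompF.const 0
  | insert a s ha ih =>
    simp only [Finset.sum_insert ha, Finset.card_insert_of_notMem ha]
    exact ((h a (by simp)).add (ih fun i hi => h i (by simp [hi]))).mono_cost
      (by rw [add_mul]; omega)

theorem CompR.sum {ι : Type*} (s : Finset ι) {f : ι → X → ℝ} (h : ∀ i ∈ s, CompR Φ c (f i)) :
    CompR Φ (s.card * (c + 1) + 1) (fun x => ∑ i ∈ s, f i x) := by
  classical
  induction s using Finset.induction_on with
  | empty => simpa using CompR.const 0
  | insert a s ha ih =>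
    simp only [Finset.sum_insert ha, Finset.card_insert_of_notMem ha]
    exact ((h a (by simp)).add (ih fun i hi => h i (by simp [hi]))).mono_cost
      (by rw [add_mul]; omega)

theorem CompR.forall {ι : Type*} (s : Finset ι) {p : ι → X → Prop}
    (h : ∀ i ∈ s, CompR Φ c (ind (p i))) :
    CompR Φ (s.card * (c + 1) + 1) (ind fun x => ∀ i ∈ s, p i x) := by
  classical
  induction s using Finset.induction_on with
  | empty =>
    convert CompR.const (Φ := Φ) 1 using 3 with x
    · simp
    · simp [ind]
  | insert a s ha ih =>
    simp only [Finset.forall_mem_insert, Finset.card_insert_of_notMem ha]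
    exact ((h a (by simp)).and (ih fun i hi => h i (by simp [hi]))).mono_cost
      (by rw [add_mul]; omega)

/-- A fixed linear combination. -/
theorem CompF.linear {ι : Type*} (s : Finset ι) (w : ι → F) {f : ι → X → F}
    (h : ∀ i ∈ s, .inl (f i) ∈ Φ) :
    CompF Φ (s.card * 3 + 1) (fun x => ∑ i ∈ s, w i * f i x) :=
  CompF.sum s fun i hi => (CompF.const (w i)).mul (.of_mem (h i hi))

end framework

/-! ### Computations and programs -/

section programs

variable {X F : Type*} [Field F]

/-- All register contents, as functions of the input. -/
def registerVals (mem : X → Memory F) : Set (Val X F) :=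
  Set.range (fun i => .inl fun x => (mem x).fld i) ∪
    Set.range (fun i => .inr fun x => (mem x).rea i)

/-- An instruction changes one register, so at most one new value appears. A value that is
overwritten in memory merely stays in the larger set. -/
theorem registerVals_step (mem : X → Memory F) (I : Instr F) :
    ∃ v, OneOp (registerVals mem) v ∧
      registerVals (fun x => I.step (mem x)) ⊆ insert v (registerVals mem) := by
  have hF : ∀ i, (.inl fun x => (mem x).fld i : Val X F) ∈ registerVals mem :=
    fun i => .inl ⟨i, rfl⟩
  have hR : ∀ i, (.inr fun x => (mem x).rea i : Val X F) ∈ registerVals mem :=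
    fun i => .inr ⟨i, rfl⟩
  have updF : ∀ (d : ℕ) (g : X → F), OneOp (registerVals mem) (.inl g) →
      (∀ x, I.step (mem x) = { mem x with fld := Function.update (mem x).fld d (g x) }) →
      ∃ v, OneOp (registerVals mem) v ∧
      registerVals (fun x => I.step (mem x)) ⊆ insert v (registerVals mem) := by
    intro d g hg hs
    refine ⟨_, hg, ?_⟩
    rintro _ (⟨i, rfl⟩ | ⟨i, rfl⟩)
    · by_cases hi : i = d
      · subst hi; left; simp [hs]
      · right; simpa [hs, Function.update_of_ne hi] using hF i
    · right; simpa [hs] using hR i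
  have updR : ∀ (d : ℕ) (g : X → ℝ), OneOp (registerVals mem) (.inr g) →
      (∀ x, I.step (mem x) = { mem x with rea := Function.update (mem x).rea d (g x) }) →
      ∃ v, OneOp (registerVals mem) v ∧
      registerVals (fun x => I.step (mem x)) ⊆ insert v (registerVals mem) := by
    intro d g hg hs
    refine ⟨_, hg, ?_⟩
    rintro _ (⟨i, rfl⟩ | ⟨i, rfl⟩)
    · right; simpa [hs] using hF i
    · by_cases hi : i = d
      · subst hi; left; simp [hs]
      · right; simpa [hs, Function.update_of_ne hi] using hR i
  cases I with
  | fconst d a => exact updF d _ (.fconst a) fun _ => rfl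
  | fadd d i j => exact updF d _ (.fadd _ _ (hF i) (hF j)) fun _ => rfl
  | fsub d i j => exact updF d _ (.fsub _ _ (hF i) (hF j)) fun _ => rfl
  | fmul d i j => exact updF d _ (.fmul _ _ (hF i) (hF j)) fun _ => rfl
  | fdiv d i j => exact updF d _ (.fdiv _ _ (hF i) (hF j)) fun _ => rfl
  | rconst d a => exact updR d _ (.rconst a) fun _ => rfl
  | radd d i j => exact updR d _ (.radd _ _ (hR i) (hR j)) fun _ => rfl
  | rsub d i j => exact updR d _ (.rsub _ _ (hR i) (hR j)) fun _ => rfl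
  | rmul d i j => exact updR d _ (.rmul _ _ (hR i) (hR j)) fun _ => rfl
  | rdiv d i j => exact updR d _ (.rdiv _ _ (hR i) (hR j)) fun _ => rfl
  | feq d i j => exact updR d _ (.feq _ _ (hF i) (hF j)) fun _ => rfl
  | rle d i j => exact updR d _ (.rle _ _ (hR i) (hR j)) fun _ => rfl
  | fsel d k i j => exact updF d _ (.fsel _ _ _ (hR k) (hF i) (hF j)) fun _ => rfl
  | rsel d k i j => exact updR d _ (.rsel _ _ _ (hR k) (hR i) (hR j)) fun _ => rfl

/-- A program computes the contents of its registers. -/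
theorem Program.computes (P : Program F) : ∀ mem : X → Memory F,
    Computes (registerVals mem) P.length (registerVals fun x => P.exec (mem x)) := by
  induction P with
  | nil => exact fun mem => .sub _ _ _ subset_rfl
  | cons I P ih =>
    intro mem
    obtain ⟨v, hv, hsub⟩ := registerVals_step mem I
    exact .op _ _ _ v hv ((ih fun x => I.step (mem x)).mono_left hsub)

/-- Each value in `Φ` is the content of a register with address below `R` after `P`. -/
def Holds (mem : X → Memory F) (P : Program F) (R : ℕ) (Φ : Set (Val X F)) : Prop :=
  (∀ f, .inl f ∈ Φ → ∃ i < R, ∀ x, (P.exec (mem x)).fld i = f x) ∧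
    (∀ f, .inr f ∈ Φ → ∃ i < R, ∀ x, (P.exec (mem x)).rea i = f x)

theorem Program.exec_append (P Q : Program F) (M : Memory F) :
    (P ++ Q : Program F).exec M = Q.exec (P.exec M) := List.foldl_append

/-- The result goes into register `R`, which lies beyond all registers in use, so no earlier value
is lost. -/
theorem Holds.oneOp {mem : X → Memory F} {P : Program F} {R : ℕ} {Φ : Set (Val X F)}
    (h : Holds mem P R Φ) {v : Val X F} (hv : OneOp Φ v) :
    ∃ I, Holds mem (P ++ [I]) (R + 1) (insert v Φ) := by
  have updF : ∀ (I : Instr F) (g : X → F), v = .inl g →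
      (∀ x, I.step (P.exec (mem x)) = { P.exec (mem x) with
        fld := Function.update (P.exec (mem x)).fld R (g x) }) →
      ∃ I, Holds mem (P ++ [I]) (R + 1) (insert v Φ) := by
    rintro I g rfl hs
    have hs' : ∀ x, (P ++ [I] : Program F).exec (mem x) = { P.exec (mem x) with
        fld := Function.update (P.exec (mem x)).fld R (g x) } := fun x => by
      rw [Program.exec_append, ← hs]; rfl
    refine ⟨I, fun f hf => ?_, fun f hf => ?_⟩
    · rcases hf with hf | hf
      · exact ⟨R, by omega, fun x => by simp [hs', Sum.inl_injective hf]⟩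
      · obtain ⟨i, hi, h1⟩ := h.1 f hf
        exact ⟨i, by omega, fun x => by simp [hs', Function.update_of_ne hi.ne, h1]⟩
    · obtain ⟨i, hi, h1⟩ := h.2 f (by simpa using hf)
      exact ⟨i, by omega, fun x => by simp [hs', h1]⟩
  have updR : ∀ (I : Instr F) (g : X → ℝ), v = .inr g →
      (∀ x, I.step (P.exec (mem x)) = { P.exec (mem x) with
        rea := Function.update (P.exec (mem x)).rea R (g x) }) →
      ∃ I, Holds mem (P ++ [I]) (R + 1) (insert v Φ) := by
    rintro I g rfl hs
    have hs' : ∀ x, (P ++ [I] : Program F).exec (mem x) = { P.exec (mem x) with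
        rea := Function.update (P.exec (mem x)).rea R (g x) } := fun x => by
      rw [Program.exec_append, ← hs]; rfl
    refine ⟨I, fun f hf => ?_, fun f hf => ?_⟩
    · obtain ⟨i, hi, h1⟩ := h.1 f (by simpa using hf)
      exact ⟨i, by omega, fun x => by simp [hs', h1]⟩
    · rcases hf with hf | hf
      · exact ⟨R, by omega, fun x => by simp [hs', Sum.inr_injective hf]⟩
      · obtain ⟨i, hi, h1⟩ := h.2 f hf
        exact ⟨i, by omega, fun x => by simp [hs', Function.update_of_ne hi.ne, h1]⟩
  cases hv with
  | fconst a => exact updF (.fconst R a) _ rfl fun _ => rfl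
  | rconst a => exact updR (.rconst R a) _ rfl fun _ => rfl
  | fadd f g hf hg =>
    obtain ⟨i, -, hi⟩ := h.1 f hf
    obtain ⟨j, -, hj⟩ := h.1 g hg
    exact updF (.fadd R i j) _ rfl fun _ => by simp only [Instr.step, hi, hj]
  | fsub f g hf hg =>
    obtain ⟨i, -, hi⟩ := h.1 f hf
    obtain ⟨j, -, hj⟩ := h.1 g hg
    exact updF (.fsub R i j) _ rfl fun _ => by simp only [Instr.step, hi, hj]
  | fmul f g hf hg =>
    obtain ⟨i, -, hi⟩ := h.1 f hf
    obtain ⟨j, -, hj⟩ := h.1 g hg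
    exact updF (.fmul R i j) _ rfl fun _ => by simp only [Instr.step, hi, hj]
  | fdiv f g hf hg =>
    obtain ⟨i, -, hi⟩ := h.1 f hf
    obtain ⟨j, -, hj⟩ := h.1 g hg
    exact updF (.fdiv R i j) _ rfl fun _ => by simp only [Instr.step, hi, hj]
  | radd f g hf hg =>
    obtain ⟨i, -, hi⟩ := h.2 f hf
    obtain ⟨j, -, hj⟩ := h.2 g hg
    exact updR (.radd R i j) _ rfl fun _ => by simp only [Instr.step, hi, hj]
  | rsub f g hf hg =>
    obtain ⟨i, -, hi⟩ := h.2 f hf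
    obtain ⟨j, -, hj⟩ := h.2 g hg
    exact updR (.rsub R i j) _ rfl fun _ => by simp only [Instr.step, hi, hj]
  | rmul f g hf hg =>
    obtain ⟨i, -, hi⟩ := h.2 f hf
    obtain ⟨j, -, hj⟩ := h.2 g hg
    exact updR (.rmul R i j) _ rfl fun _ => by simp only [Instr.step, hi, hj]
  | rdiv f g hf hg =>
    obtain ⟨i, -, hi⟩ := h.2 f hf
    obtain ⟨j, -, hj⟩ := h.2 g hg
    exact updR (.rdiv R i j) _ rfl fun _ => by simp only [Instr.step, hi, hj]
  | feq f g hf hg =>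
    obtain ⟨i, -, hi⟩ := h.1 f hf
    obtain ⟨j, -, hj⟩ := h.1 g hg
    obtain rfl := funext hi
    obtain rfl := funext hj
    exact updR (.feq R i j) _ rfl fun _ => rfl
  | rle f g hf hg =>
    obtain ⟨i, -, hi⟩ := h.2 f hf
    obtain ⟨j, -, hj⟩ := h.2 g hg
    exact updR (.rle R i j) _ rfl fun _ => by simp only [Instr.step, hi, hj, ind]
  | fsel r f g hr hf hg =>
    obtain ⟨k, -, hk⟩ := h.2 r hr
    obtain ⟨i, -, hi⟩ := h.1 f hf
    obtain ⟨j, -, hj⟩ := h.1 g hg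
    exact updF (.fsel R k i j) _ rfl fun _ => by simp only [Instr.step, hi, hj, hk]
  | rsel r f g hr hf hg =>
    obtain ⟨k, -, hk⟩ := h.2 r hr
    obtain ⟨i, -, hi⟩ := h.2 f hf
    obtain ⟨j, -, hj⟩ := h.2 g hg
    exact updR (.rsel R k i j) _ rfl fun _ => by simp only [Instr.step, hi, hj, hk]

theorem Computes.exists_holds {Φ Ψ : Set (Val X F)} {c : ℕ} (h : Computes Φ c Ψ)
    (mem : X → Memory F) : ∀ (P : Program F) (R : ℕ), Holds mem P R Φ →
    ∃ (P' : Program F) (R' : ℕ), P'.length ≤ P.length + c ∧ Holds mem P' R' Ψ := by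
  induction h with
  | sub Φ c Ψ h =>
    exact fun P R hP => ⟨P, R, by omega, fun f hf => hP.1 f (h hf), fun f hf => hP.2 f (h hf)⟩
  | op Φ c Ψ v hv _ ih =>
    intro P R hP
    obtain ⟨I, hI⟩ := hP.oneOp hv
    obtain ⟨P', R', h1, h2⟩ := ih _ _ hI
    exact ⟨P', R', by simp at h1; omega, h2⟩

/-- The program that copies the registers `src 0, …, src (n-1)` to `dst, …, dst + n - 1`. -/
def copyProgram (F : Type*) (dst : ℕ) (src : ℕ → ℕ) (n : ℕ) : Program F :=
  -- A selection between two equal registers is a move, whatever the real register 0 contains.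
  (List.range n).map fun i => .fsel (dst + i) 0 (src i) (src i)

theorem copyProgram_exec (dst : ℕ) (src : ℕ → ℕ) (n : ℕ) (M : Memory F)
    (h : ∀ i < n, src i < dst ∨ dst + n ≤ src i) :
    (∀ i < n, ((copyProgram F dst src n).exec M).fld (dst + i) = M.fld (src i)) ∧
      (∀ j, (j < dst ∨ dst + n ≤ j) → ((copyProgram F dst src n).exec M).fld j = M.fld j) := by
  induction n with
  | zero => simp [copyProgram, Program.exec]
  | succ n ih =>
    obtain ⟨h1, h2⟩ := ih fun i hi => by have := h i (by omega); omega
    have hs : copyProgram F dst src (n + 1) =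
        (copyProgram F dst src n ++ [.fsel (dst + n) 0 (src n) (src n)] : Program F) := by
      simp [copyProgram, List.range_succ]
    have key : ∀ j, ((copyProgram F dst src (n + 1)).exec M).fld j =
        Function.update ((copyProgram F dst src n).exec M).fld (dst + n)
          (((copyProgram F dst src n).exec M).fld (src n)) j := fun j => by
      rw [hs, Program.exec_append]
      simp [Program.exec, Instr.step]
    refine ⟨fun i hi => ?_, fun j hj => ?_⟩
    · rw [key]
      rcases Nat.lt_succ_iff_lt_or_eq.mp hi with hi | rfl
      · rw [Function.update_of_ne (by omega), h1 i hi]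
      · rw [Function.update_self, h2 _ (by have := h i (by omega); omega)]
    · rw [key, Function.update_of_ne (by omega), h2 _ (by omega)]

/-- The infinitely many registers beyond the input all contain zero. Register `m` represents them,
so finitely many addresses suffice. -/
theorem registerVals_inputMemory_holds (m : ℕ) :
    Holds (inputMemory (F := F) (m := m)) [] (m + 1) (registerVals inputMemory) := by
  refine ⟨?_, ?_⟩
  · rintro f (⟨i, hi⟩ | ⟨i, hi⟩)
    · obtain rfl := Sum.inl_injective hi
      by_cases him : i < m
      · exact ⟨i, by omega, fun x => rfl⟩
      · exact ⟨m, by omega, fun x => by simp [Program.exec, inputMemory, him]⟩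
    · simp at hi
  · rintro f (⟨i, hi⟩ | ⟨i, hi⟩)
    · simp at hi
    · obtain rfl := Sum.inr_injective hi
      exact ⟨0, by omega, fun x => by simp [Program.exec, inputMemory]⟩

/-- A computation of `n` field values gives a program that returns these values. -/
theorem Computes.exists_program {m n c : ℕ} {Ψ : Set (Val (Fin m → F) F)}
    (h : Computes (registerVals inputMemory) c Ψ) (f : Fin n → (Fin m → F) → F)
    (hf : ∀ i, .inl (f i) ∈ Ψ) :
    ∃ P : Program F, P.length ≤ c + 2 * n ∧ ∀ y, P.output y n = fun i => f i y := by
  obtain ⟨P, R, hP, hR, -⟩ := h.exists_holds _ [] _ (registerVals_inputMemory_holds m)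
  choose r hr hr' using fun i => hR (f i) (hf i)
  let src : ℕ → ℕ := fun i => if hi : i < n then r ⟨i, hi⟩ else 0
  have hsrc : ∀ i (hi : i < n), src i = r ⟨i, hi⟩ := fun i hi => dif_pos hi
  -- The results may lie among the first `n` registers in the wrong order. They are copied to fresh
  -- registers first and then to their places, which costs `2 * n`.
  let Q₁ := copyProgram F (R + n) src n
  let Q₂ := copyProgram F 0 (fun i => R + n + i) n
  refine ⟨P ++ Q₁ ++ Q₂, ?_, fun y => ?_⟩
  · simp only [List.length_append, Q₁, Q₂, copyProgram, List.length_map, List.length_range]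
    simp at hP
    omega
  · funext i
    have h₁ := (copyProgram_exec (R + n) src n (P.exec (inputMemory y)) fun i hi => by
      left; rw [hsrc i hi]; have := hr ⟨i, hi⟩; omega).1 i i.2
    have h₂ := (copyProgram_exec 0 (fun i => R + n + i) n (Q₁.exec (P.exec (inputMemory y)))
      fun i hi => by right; omega).1 i i.2
    rw [zero_add] at h₂
    simp only [Program.output, Program.exec_append]
    rw [h₂, h₁, hsrc i i.2, hr']

theorem inputMemory_mem_registerVals {m : ℕ} (i : Fin m) :
    (.inl fun y : Fin m → F => y i) ∈ registerVals (inputMemory (F := F) (m := m)) := by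
  refine .inl ⟨i, ?_⟩
  simp [inputMemory]

theorem Program.output_computes (P : Program F) {m n : ℕ} :
    Computes (registerVals (inputMemory (F := F) (m := m))) P.length
      (Set.range fun i : Fin n => .inl fun y => P.output y n i) :=
  (P.computes _).mono_right (by rintro _ ⟨i, rfl⟩; exact .inl ⟨i, rfl⟩)

end programs

/-! ### Arithmetic of an extension field, in coordinates -/

section extension

variable {X F K : Type*} [Field F] [Field K] [Algebra F K] (pb : PowerBasis F K)
  {Φ Φ' : Set (Val X F)} {c c' c'' : ℕ}

/-- The coordinates of a value in the extension field. -/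
def coords (f : X → K) : Set (Val X F) :=
  Set.range fun j : Fin pb.dim => .inl fun x => pb.basis.repr (f x) j

/-- The value `f` in the extension field (that is, all its coordinates) can be computed from
`Φ` with at most `c` operations. -/
abbrev CompK (Φ : Set (Val X F)) (c : ℕ) (f : X → K) : Prop := Computes Φ c (coords pb f)

/-- A bound for the number of operations for one operation of the extension field. -/
def opCost : ℕ := 10 * pb.dim ^ 2

variable {pb}

theorem CompK.of_coord {f : X → K}
    (h : ∀ j, CompF Φ c fun x => pb.basis.repr (f x) j) : CompK pb Φ (pb.dim * c) f := by
  have := Computes.iUnion h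
  rw [Fintype.card_fin, Set.iUnion_singleton_eq_range] at this
  exact this

theorem CompK.of_subset {f : X → K} (hf : coords pb f ⊆ Φ) : CompK pb Φ 0 f := .sub _ _ _ hf

theorem dim_le_opCost : pb.dim ≤ opCost pb := by
  unfold opCost; nlinarith [Nat.le_self_pow two_ne_zero pb.dim]

theorem CompK.const (a : K) : CompK pb Φ (opCost pb) (fun _ => a) :=
  (CompK.of_coord fun _ => CompF.const _).mono_cost (by simpa using dim_le_opCost)

theorem CompK.add {f g : X → K} (hf : CompK pb Φ c f) (hg : CompK pb Φ c' g) :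
    CompK pb Φ (c + c' + opCost pb) (fun x => f x + g x) :=
  (hf.union hg).bind fun Φ' _ h => by
    refine (CompK.of_coord (c := 1) fun j => ?_).mono_cost (by simpa using dim_le_opCost)
    simpa using CompF.add (.of_mem (h (.inl ⟨j, rfl⟩))) (.of_mem (h (.inr ⟨j, rfl⟩)))

theorem CompK.sub {f g : X → K} (hf : CompK pb Φ c f) (hg : CompK pb Φ c' g) :
    CompK pb Φ (c + c' + opCost pb) (fun x => f x - g x) :=
  (hf.union hg).bind fun Φ' _ h => by
    refine (CompK.of_coord (c := 1) fun j => ?_).mono_cost (by simpa using dim_le_opCost)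
    simpa using CompF.sub (.of_mem (h (.inl ⟨j, rfl⟩))) (.of_mem (h (.inr ⟨j, rfl⟩)))

open Classical in
theorem CompK.ite {p : X → Prop} {f g : X → K} (hp : CompR Φ c (ind p)) (hf : CompK pb Φ c' f)
    (hg : CompK pb Φ c'' g) :
    CompK pb Φ (c + c' + c'' + opCost pb) (fun x => if p x then f x else g x) :=
  ((hp.union hf).union hg).bind fun Φ' _ h => by
    refine (CompK.of_coord (c := 1) fun j => ?_).mono_cost (by simpa using dim_le_opCost)
    have := CompF.ite (.of_mem (h (.inl (.inl rfl)))) (.of_mem (h (.inl (.inr ⟨j, rfl⟩))))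
      (.of_mem (h (.inr ⟨j, rfl⟩)))
    convert this using 4 with x
    split_ifs <;> rfl

theorem CompR.eq_zero {f : X → K} (hf : CompK pb Φ c f) :
    CompR Φ (c + opCost pb) (ind fun x => f x = 0) :=
  hf.bind fun Φ' _ h => by
    have h1 := CompR.forall (Φ := Φ') (c := 2) Finset.univ
      (p := fun (j : Fin pb.dim) x => pb.basis.repr (f x) j = 0)
      fun j _ => CompR.eq (.of_mem (h ⟨j, rfl⟩)) (CompF.const 0)
    refine (h1.mono_cost ?_).mono_right (le_of_eq ?_)
    · have := pb.dim_pos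
      simp only [Finset.card_univ, Fintype.card_fin, opCost]
      nlinarith
    · congr 3
      funext x
      rw [← map_eq_zero_iff _ pb.basis.repr.injective, Finsupp.ext_iff]
      simp

/-- Multiplication by the generator is the companion matrix: a shift of the coordinates, plus the
top coordinate times the coordinates of `gen ^ dim`. It needs only linearly many operations. -/
theorem repr_gen_mul (h : K) (l : Fin pb.dim) :
    pb.basis.repr (pb.gen * h) l =
      (if hl : 0 < (l : ℕ) then pb.basis.repr h ⟨(l : ℕ) - 1, by omega⟩ else 0) +
        pb.basis.repr (pb.gen ^ pb.dim) l * pb.basis.repr h ⟨pb.dim - 1, Nat.sub_lt pb.dim_pos one_pos⟩ := by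
  have hd := pb.dim_pos
  have hpow : ∀ i : ℕ, ∀ hi : i < pb.dim, pb.basis.repr (pb.gen ^ i) =
      Finsupp.single ⟨i, hi⟩ 1 := fun i hi => by
    rw [← pb.basis.repr_self, pb.basis_eq_pow]
  have expand : pb.gen * h = ∑ i : Fin pb.dim, pb.basis.repr h i • pb.gen ^ (i + 1 : ℕ) := by
    conv_lhs => rw [← pb.basis.sum_repr h, Finset.mul_sum]
    refine Finset.sum_congr rfl fun i _ => ?_
    rw [pb.basis_eq_pow, mul_smul_comm, pow_succ']
  rw [expand, map_sum, Finsupp.finsetSum_apply]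
  simp only [map_smul, Finsupp.smul_apply, smul_eq_mul]
  rw [← Finset.sum_erase_add _ _ (Finset.mem_univ (⟨pb.dim - 1, Nat.sub_lt pb.dim_pos one_pos⟩ : Fin pb.dim))]
  congr 1
  · have hterm : ∀ i ∈ Finset.univ.erase (⟨pb.dim - 1, Nat.sub_lt pb.dim_pos one_pos⟩ : Fin pb.dim),
        pb.basis.repr h i * pb.basis.repr (pb.gen ^ (i + 1 : ℕ)) l =
        if (i : ℕ) + 1 = l then pb.basis.repr h i else 0 := by
      intro i hi
      have hi' : (i : ℕ) + 1 < pb.dim := by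
        have h1 := Finset.ne_of_mem_erase hi
        have h2 : (i : ℕ) ≠ pb.dim - 1 := fun h => h1 (Fin.ext h)
        have := i.2
        omega
      rw [hpow _ hi', Finsupp.single_apply]
      simp [Fin.ext_iff]
    rw [Finset.sum_congr rfl hterm]
    split_ifs with hl
    · rw [Finset.sum_eq_single_of_mem (⟨(l : ℕ) - 1, by omega⟩ : Fin pb.dim)]
      · rw [if_pos (by simp; omega)]
      · refine Finset.mem_erase.mpr ⟨?_, Finset.mem_univ _⟩
        have := l.2
        rw [Ne, Fin.ext_iff]
        simp
        omega
      · intro i _ hi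
        rw [if_neg]
        rw [Ne, Fin.ext_iff] at hi
        simp at hi
        omega
    · exact Finset.sum_eq_zero fun i _ => if_neg (by omega)
  · rw [mul_comm, show pb.dim - 1 + 1 = pb.dim by omega]

theorem CompK.gen_mul {f : X → K} (hf : coords pb f ⊆ Φ) :
    CompK pb Φ (pb.dim * 3) (fun x => pb.gen * f x) := by
  refine .of_coord fun l => ?_
  simp only [repr_gen_mul]
  split_ifs with hl
  · exact CompF.add (.of_mem (hf ⟨_, rfl⟩)) ((CompF.const _).mul (.of_mem (hf ⟨_, rfl⟩)))
  · simpa using ((CompF.const _).mul (.of_mem (hf ⟨_, rfl⟩))).mono_cost (by omega)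

/-- Each multiple is obtained from the preceding one by a cheap multiplication with the generator,
so all of them together cost `O(dim²)`. -/
theorem computes_gen_pow_mul {f : X → K} (hf : coords pb f ⊆ Φ) (n : ℕ) :
    Computes Φ (n * (pb.dim * 3)) (⋃ i ∈ Finset.range (n + 1),
      coords pb fun x => pb.gen ^ i * f x) := by
  induction n with
  | zero => exact .sub _ _ _ (by simpa using hf)
  | succ n ih =>
    rw [add_mul, one_mul]
    refine ih.bind fun Φ' _ h => ?_
    have h1 := CompK.gen_mul (pb := pb) (f := fun x => pb.gen ^ n * f x) (Φ := Φ')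
      ((Set.subset_biUnion_of_mem (u := fun i => coords pb fun x => pb.gen ^ i * f x)
        (Finset.mem_coe.mpr (Finset.self_mem_range_succ n))).trans h)
    refine (h1.union (Computes.sub Φ' 0 _ h)).mono_right ?_
    rw [Finset.range_add_one, Finset.set_biUnion_insert]
    refine Set.union_subset_union_left _ (le_of_eq ?_)
    simp only [pow_succ', mul_assoc]

/-- With the multiples `gen ^ i * g` available, the product is their combination with the
coordinates of `f`. This keeps the cost quadratic in the degree, whereas a general multiplication
table would make it cubic. -/
theorem CompK.mul {f g : X → K} (hf : CompK pb Φ c f) (hg : CompK pb Φ c' g) :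
    CompK pb Φ (c + c' + opCost pb) (fun x => f x * g x) :=
  (hf.union hg).bind fun Φ₁ _ h => by
    have hd := pb.dim_pos
    refine (Computes.bind (c' := pb.dim * (pb.dim * 2 + 1))
      (computes_gen_pow_mul (Set.subset_union_right.trans h) pb.dim)
      fun Φ₂ h2 h3 => ?_).mono_cost (by unfold opCost; nlinarith)
    refine CompK.of_coord fun l => ?_
    have expand : ∀ x, pb.basis.repr (f x * g x) l =
        ∑ i : Fin pb.dim, pb.basis.repr (f x) i *
          pb.basis.repr (pb.gen ^ (i : ℕ) * g x) l := fun x => by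
      conv_lhs => rw [← pb.basis.sum_repr (f x), Finset.sum_mul, map_sum, Finsupp.finsetSum_apply]
      refine Finset.sum_congr rfl fun i _ => ?_
      rw [pb.basis_eq_pow, smul_mul_assoc, map_smul, Finsupp.smul_apply, smul_eq_mul]
    simp only [expand]
    refine (CompF.sum (c := 1) Finset.univ fun i _ => ?_).mono_cost (by simp)
    refine CompF.mul (c := 0) (c' := 0) (.of_mem (h2 (h (.inl ⟨i, rfl⟩))))
      (.of_mem (h3 ?_))
    simp only [Set.mem_iUnion]
    exact ⟨i, by simp, l, rfl⟩

theorem CompK.sum {ι : Type*} (s : Finset ι) {f : ι → X → K}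
    (h : ∀ i ∈ s, CompK pb Φ c (f i)) :
    CompK pb Φ (s.card * (c + opCost pb) + opCost pb) (fun x => ∑ i ∈ s, f i x) := by
  classical
  induction s using Finset.induction_on with
  | empty => simpa using CompK.const 0
  | insert a s ha ih =>
    simp only [Finset.sum_insert ha, Finset.card_insert_of_notMem ha]
    exact ((h a (by simp)).add (ih fun i hi => h i (by simp [hi]))).mono_cost
      (by rw [add_mul]; omega)

/-- A fixed linear combination over the extension field. -/
theorem CompK.linear {ι : Type*} (s : Finset ι) (w : ι → K) {f : ι → X → K}
    (h : ∀ i ∈ s, coords pb (f i) ⊆ Φ) :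
    CompK pb Φ (s.card * (3 * opCost pb) + opCost pb) (fun x => ∑ i ∈ s, w i * f i x) :=
  (CompK.sum s fun i hi => (CompK.const (w i)).mul (.of_subset (h i hi))).mono_cost
    (le_of_eq (by ring))

/-- A combination of fixed elements of the extension field with coefficients in `F`. -/
theorem CompK.smul_sum {ι : Type*} (s : Finset ι) (w : ι → K) {f : ι → X → F}
    (h : ∀ i ∈ s, .inl (f i) ∈ Φ) :
    CompK pb Φ (pb.dim * (s.card * 3 + 1)) (fun x => ∑ i ∈ s, f i x • w i) := by
  refine .of_coord fun l => ?_
  simpa [map_sum, Finsupp.finsetSum_apply, mul_comm] using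
    CompF.linear s (fun i => pb.basis.repr (w i) l) h

/-- A fixed `F`-linear functional. -/
theorem CompF.functional (π : K →ₗ[F] F) {f : X → K} (hf : CompK pb Φ c f) :
    CompF Φ (c + (pb.dim * 3 + 1)) (fun x => π (f x)) :=
  hf.bind fun Φ' _ h => by
    have := CompF.linear (Φ := Φ') Finset.univ (fun j => π (pb.basis j))
      (f := fun (j : Fin pb.dim) x => pb.basis.repr (f x) j) fun j _ => h ⟨j, rfl⟩
    rw [Finset.card_univ, Fintype.card_fin] at this
    convert this using 4 with x
    conv_lhs => rw [← pb.basis.sum_repr (f x), map_sum]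
    simp [mul_comm]

end extension

/-! ### The key equation, without divisions -/

section keyEquation

open Polynomial

variable {K : Type*} [Field K]

/-- Two approximate solutions `(Λ, Ω)`, `(Λ', Ω')` of the key equation, with degree bounds. -/
structure KeyState (K : Type*) [Field K] where
  Λ : K[X]
  Ω : K[X]
  Λ' : K[X]
  Ω' : K[X]
  d : ℕ
  d' : ℕ

namespace KeyState

/-- The state that starts the iteration. -/
def init : KeyState K := ⟨1, 0, 0, 1, 0, 1⟩

/-- The state with the two solutions exchanged. -/
def swap (σ : KeyState K) : KeyState K := ⟨σ.Λ', σ.Ω', σ.Λ, σ.Ω, σ.d', σ.d⟩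

/-- The discrepancy of the first solution. -/
def disc (S : K[X]) (i : ℕ) (σ : KeyState K) : K := (σ.Λ * S - σ.Ω).coeff i

/-- The step in which the first solution is multiplied by `X`. -/
def advance (S : K[X]) (i : ℕ) (σ : KeyState K) : KeyState K where
  Λ := X * σ.Λ
  Ω := X * σ.Ω
  Λ' := C (σ.disc S i) * σ.Λ' - C (σ.swap.disc S i) * σ.Λ
  Ω' := C (σ.disc S i) * σ.Ω' - C (σ.swap.disc S i) * σ.Ω
  d := σ.d + 1
  d' := σ.d'

/-- The condition under which the first solution serves as the pivot. -/
def Pivot (S : K[X]) (i : ℕ) (σ : KeyState K) : Prop :=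
  σ.disc S i ≠ 0 ∧ (σ.swap.disc S i = 0 ∨ σ.d ≤ σ.d')

open Classical in
/-- One step of the iteration. -/
def step (S : K[X]) (i : ℕ) (σ : KeyState K) : KeyState K :=
  (if σ.Pivot S i then σ else σ.swap).advance S i

/-- The state after `i` steps. -/
def iter (S : K[X]) : ℕ → KeyState K
  | 0 => init
  | i + 1 => (iter S i).step S i

open Classical in
/-- The state after `i` steps, with the solution of smaller degree in front. -/
def result (S : K[X]) (i : ℕ) : KeyState K :=
  if (iter S i).d ≤ (iter S i).d' then iter S i else (iter S i).swap

/-- The invariants of the iteration. -/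
structure Inv (S : K[X]) (i : ℕ) (σ : KeyState K) : Prop where
  det : ∃ c : K, c ≠ 0 ∧ σ.Λ * σ.Ω' - σ.Λ' * σ.Ω = C c * X ^ i
  deg : σ.d + σ.d' = i + 1
  coeffΛ : ∀ j > σ.d, σ.Λ.coeff j = 0
  coeffΩ : ∀ j ≥ σ.d, σ.Ω.coeff j = 0
  coeffΛ' : ∀ j > σ.d', σ.Λ'.coeff j = 0
  coeffΩ' : ∀ j ≥ σ.d', σ.Ω'.coeff j = 0
  dvd : X ^ i ∣ σ.Λ * S - σ.Ω
  dvd' : X ^ i ∣ σ.Λ' * S - σ.Ω'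

variable {S : K[X]} {i : ℕ} {σ : KeyState K}

theorem Inv.swap (h : Inv S i σ) : Inv S i σ.swap where
  det := by
    obtain ⟨c, hc, h1⟩ := h.det
    refine ⟨-c, neg_ne_zero.mpr hc, ?_⟩
    simp only [KeyState.swap, map_neg, neg_mul, ← h1]
    ring
  deg := by simpa [KeyState.swap, add_comm] using h.deg
  coeffΛ := h.coeffΛ'
  coeffΩ := h.coeffΩ'
  coeffΛ' := h.coeffΛ
  coeffΩ' := h.coeffΩ
  dvd := h.dvd'
  dvd' := h.dvd

theorem inv_init : Inv S 0 init where
  det := ⟨1, one_ne_zero, by simp [init]⟩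
  deg := rfl
  coeffΛ := fun j hj => by
    simp only [init] at hj ⊢
    rw [coeff_one, if_neg (by omega)]
  coeffΩ := by simp [init]
  coeffΛ' := by simp [init]
  coeffΩ' := fun j hj => by
    simp only [init] at hj ⊢
    rw [coeff_one, if_neg (by omega)]
  dvd := by simp
  dvd' := by simp

theorem X_pow_succ_dvd {p : K[X]} (h : X ^ i ∣ p) (h' : p.coeff i = 0) : X ^ (i + 1) ∣ p := by
  rw [X_pow_dvd_iff] at h ⊢
  intro j hj
  rcases Nat.lt_succ_iff_lt_or_eq.mp hj with hj | rfl
  · exact h j hj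
  · exact h'

/-- If both discrepancies vanished, `X ^ (i + 1)` would divide the determinant, which is a non-zero
multiple of `X ^ i`. -/
theorem Inv.disc_ne_zero (h : Inv S i σ) (h0 : σ.disc S i = 0) : σ.swap.disc S i ≠ 0 := by
  intro h1
  obtain ⟨c, hc, h2⟩ := h.det
  have h3 := X_pow_succ_dvd h.dvd h0
  have h4 := X_pow_succ_dvd h.dvd' h1
  have h5 : X ^ (i + 1) ∣ C c * X ^ i := by
    have : C c * X ^ i = σ.Λ' * (σ.Λ * S - σ.Ω) - σ.Λ * (σ.Λ' * S - σ.Ω') := by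
      rw [← h2]; ring
    rw [this]
    exact dvd_sub (h3.mul_left _) (h4.mul_left _)
  have := X_pow_dvd_iff.mp h5 i (by omega)
  simp [hc] at this

theorem Inv.advance (h : Inv S i σ) (hp : σ.Pivot S i) : Inv S (i + 1) (σ.advance S i) where
  det := by
    obtain ⟨c, hc, h1⟩ := h.det
    refine ⟨c * σ.disc S i, mul_ne_zero hc hp.1, ?_⟩
    have : C c * X ^ i * (X * C (σ.disc S i)) = C (c * σ.disc S i) * X ^ (i + 1) := by
      rw [C_mul]; ring
    rw [← this, ← h1]
    simp only [KeyState.advance]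
    ring
  deg := by have := h.deg; simp only [KeyState.advance]; omega
  coeffΛ := fun j hj => by
    simp only [KeyState.advance] at hj ⊢
    obtain ⟨k, rfl⟩ : ∃ k, j = k + 1 := ⟨j - 1, by omega⟩
    rw [coeff_X_mul]
    exact h.coeffΛ k (by omega)
  coeffΩ := fun j hj => by
    simp only [KeyState.advance] at hj ⊢
    obtain ⟨k, rfl⟩ : ∃ k, j = k + 1 := ⟨j - 1, by omega⟩
    rw [coeff_X_mul]
    exact h.coeffΩ k (by omega)
  coeffΛ' := fun j hj => by
    simp only [KeyState.advance] at hj ⊢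
    rw [coeff_sub, coeff_C_mul, coeff_C_mul, h.coeffΛ' j hj]
    -- The pivot condition ensures that the elimination does not raise the degree: either nothing is
    -- subtracted, or the pivot has the smaller degree bound.
    rcases hp.2 with h0 | h0
    · simp [h0]
    · simp [h.coeffΛ j (by omega)]
  coeffΩ' := fun j hj => by
    simp only [KeyState.advance] at hj ⊢
    rw [coeff_sub, coeff_C_mul, coeff_C_mul, h.coeffΩ' j hj]
    rcases hp.2 with h0 | h0
    · simp [h0]
    · simp [h.coeffΩ j (by omega)]
  dvd := by
    simp only [KeyState.advance]
    rw [mul_assoc, ← mul_sub, pow_succ']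
    exact mul_dvd_mul_left _ h.dvd
  dvd' := by
    have : (σ.advance S i).Λ' * S - (σ.advance S i).Ω' =
        C (σ.disc S i) * (σ.Λ' * S - σ.Ω') - C (σ.swap.disc S i) * (σ.Λ * S - σ.Ω) := by
      simp only [KeyState.advance]; ring
    rw [this]
    refine X_pow_succ_dvd (dvd_sub (h.dvd'.mul_left _) (h.dvd.mul_left _)) ?_
    rw [coeff_sub, coeff_C_mul, coeff_C_mul]
    simp only [disc, KeyState.swap]
    ring

theorem Inv.step (h : Inv S i σ) : Inv S (i + 1) (σ.step S i) := by
  unfold KeyState.step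
  split_ifs with hp
  · exact h.advance hp
  -- When the first solution cannot be the pivot, the second one can: its discrepancy is non-zero,
  -- and if the first discrepancy is non-zero too, its degree bound is smaller.
  · refine h.swap.advance ?_
    by_cases h0 : σ.disc S i = 0
    · exact ⟨h.disc_ne_zero h0, .inl h0⟩
    · simp only [Pivot, h0, ne_eq, not_false_eq_true, true_and, not_or, not_le] at hp
      exact ⟨hp.1, .inr hp.2.le⟩

theorem inv_iter (S : K[X]) (i : ℕ) : Inv S i (iter S i) := by
  induction i with
  | zero => exact inv_init
  | succ i ih => exact ih.step

theorem inv_result (S : K[X]) (i : ℕ) : Inv S i (result S i) := by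
  unfold result
  split_ifs
  · exact inv_iter S i
  · exact (inv_iter S i).swap

/-- The two bounds add up to `2 * b + 1`, so the smaller one is at most `b`. -/
theorem result_d_le (S : K[X]) (b : ℕ) : (result S (2 * b)).d ≤ b := by
  have h := (inv_result S (2 * b)).deg
  have : (result S (2 * b)).d ≤ (result S (2 * b)).d' := by
    unfold result
    split_ifs with h1
    · exact h1
    · simp only [swap]; omega
  omega

end KeyState

theorem coeff_mul_eq_zero_of_bounds {p r : K[X]} {d e : ℕ} (hp : ∀ j > d, p.coeff j = 0)
    (hr : ∀ j ≥ e, r.coeff j = 0) : ∀ j ≥ d + e, (p * r).coeff j = 0 := by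
  intro j hj
  rw [coeff_mul]
  refine Finset.sum_eq_zero fun x hx => ?_
  rw [Finset.HasAntidiagonal.mem_antidiagonal] at hx
  by_cases h : d < x.1
  · rw [hp _ h, zero_mul]
  · rw [hr _ (by omega), mul_zero]

/-- The locator polynomial of the positions in `T`. -/
def locatorPoly {ι : Type*} (T : Finset ι) (a : ι → K) : K[X] := ∏ i ∈ T, (1 - C (a i) * X)

theorem locatorPoly_eval_ne_zero {ι : Type*} (T : Finset ι) (a : ι → K) {z : K} (h0 : z ≠ 0)
    (hinj : ∀ j ∈ T, a j ≠ z) : (locatorPoly T a).eval z⁻¹ ≠ 0 := by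
  rw [locatorPoly, eval_prod, Finset.prod_ne_zero_iff]
  intro j hj h
  simp only [eval_sub, eval_one, eval_mul, eval_C, eval_X, sub_eq_zero] at h
  exact hinj j hj (by field_simp at h; exact h.symm)

theorem locatorPoly_coeff {ι : Type*} (T : Finset ι) (a : ι → K) (j : ℕ) (hj : T.card < j) :
    (locatorPoly T a).coeff j = 0 := by
  refine coeff_eq_zero_of_natDegree_lt (lt_of_le_of_lt ?_ hj)
  refine (natDegree_prod_le _ _).trans ((Finset.sum_le_card_nsmul _ _ 1 fun i _ => ?_).trans
    (by simp))
  refine (natDegree_sub_le _ _).trans ?_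
  simpa using (natDegree_C_mul_le (a i) X).trans natDegree_X_le

section locator

variable {ι : Type*} [DecidableEq ι] (T : Finset ι) (a w : ι → K)

/-- The evaluator polynomial of the positions in `T`, with values `w`. -/
def evaluatorPoly : K[X] := ∑ i ∈ T, C (w i) * locatorPoly (T.erase i) a

theorem evaluatorPoly_coeff (j : ℕ) (hj : T.card ≤ j) : (evaluatorPoly T a w).coeff j = 0 := by
  rw [evaluatorPoly, finsetSum_coeff]
  refine Finset.sum_eq_zero fun i hi => ?_
  rw [coeff_C_mul, locatorPoly_coeff, mul_zero]
  rw [Finset.card_erase_of_mem hi]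
  have := Finset.card_pos.mpr ⟨i, hi⟩
  omega

theorem locatorPoly_eq_mul {i : ι} (hi : i ∈ T) :
    locatorPoly T a = (1 - C (a i) * X) * locatorPoly (T.erase i) a :=
  (Finset.mul_prod_erase T (fun i => 1 - C (a i) * X) hi).symm

/-- Evaluator divided by locator is the sum of the fractions `w i / (1 - a i * X)`. Their geometric
series, cut off at `X ^ r`, has the syndromes as coefficients. -/
theorem locatorPoly_key {S : K[X]} {r : ℕ}
    (hS : ∀ j < r, S.coeff j = ∑ i ∈ T, w i * a i ^ j) :
    X ^ r ∣ locatorPoly T a * S - evaluatorPoly T a w := by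
  have h1 : X ^ r ∣ S - ∑ i ∈ T, C (w i) * ∑ j ∈ Finset.range r, (C (a i) * X) ^ j := by
    rw [X_pow_dvd_iff]
    intro j hj
    rw [coeff_sub, hS j hj, finsetSum_coeff, sub_eq_zero]
    refine Finset.sum_congr rfl fun i _ => ?_
    rw [coeff_C_mul, finsetSum_coeff]
    simp only [mul_pow, ← C_pow, coeff_C_mul, coeff_X_pow]
    simp [hj]
  have h2 : locatorPoly T a * ∑ i ∈ T, C (w i) * ∑ j ∈ Finset.range r, (C (a i) * X) ^ j -
      evaluatorPoly T a w =
      X ^ r * -∑ i ∈ T, C (w i) * locatorPoly (T.erase i) a * C (a i) ^ r := by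
    rw [evaluatorPoly, Finset.mul_sum, ← Finset.sum_sub_distrib, ← Finset.sum_neg_distrib,
      Finset.mul_sum]
    refine Finset.sum_congr rfl fun i hi => ?_
    have := mul_neg_geom_sum (C (a i) * X) r
    rw [locatorPoly_eq_mul T a hi]
    linear_combination (C (w i) * locatorPoly (T.erase i) a) * this
  have h3 := dvd_add (h1.mul_left (locatorPoly T a)) (h2 ▸ dvd_mul_right (X ^ r) _)
  convert h3 using 1
  ring

end locator

/-- The solution of smaller degree determines the error positions and values. -/
theorem KeyState.Inv.locate {n b : ℕ} {S : K[X]} {σ : KeyState K} (h : σ.Inv S (2 * b))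
    (hd : σ.d ≤ b) {a v e : Fin n → K} (ha : Function.Injective a) (hv : ∀ i, v i ≠ 0)
    (he : {i | e i ≠ 0}.ncard ≤ b) (hS : ∀ j < 2 * b, S.coeff j = ∑ i, v i * e i * a i ^ j)
    {i : Fin n} (hi : a i ≠ 0) :
    (e i = 0 → σ.Λ.eval (a i)⁻¹ ≠ 0) ∧
    (e i ≠ 0 → σ.Λ.eval (a i)⁻¹ = 0 ∧ (derivative σ.Λ).eval (a i)⁻¹ ≠ 0 ∧
      v i * e i * (derivative σ.Λ).eval (a i)⁻¹ + a i * σ.Ω.eval (a i)⁻¹ = 0) := by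
  classical
  let T : Finset (Fin n) := {i | e i ≠ 0}
  have hT : T.card ≤ b := by
    rw [← Set.ncard_coe_finset]; simpa [T] using he
  have memT : ∀ j, j ∈ T ↔ e j ≠ 0 := fun j => by simp [T]
  let w : Fin n → K := fun i => v i * e i
  have hS' : ∀ j < 2 * b, S.coeff j = ∑ i ∈ T, w i * a i ^ j := fun j hj => by
    rw [hS j hj]
    refine (Finset.sum_subset (Finset.subset_univ T) fun i _ hi => ?_).symm
    rw [memT, not_not] at hi
    simp [hi]
  set Lm := locatorPoly T a
  set Om := evaluatorPoly T a w
  -- Both sides are congruent to `σ.Λ * Lm * S` modulo `X ^ (2 * b)`, and both have degree below `2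
  -- * b`, so they are equal.
  have heq : σ.Λ * Om = Lm * σ.Ω := by
    have h1 : X ^ (2 * b) ∣ σ.Λ * Om - Lm * σ.Ω := by
      have := dvd_sub (h.dvd.mul_left Lm) ((locatorPoly_key T a w hS').mul_left σ.Λ)
      convert this using 1
      ring
    rw [X_pow_dvd_iff] at h1
    rw [← sub_eq_zero]
    ext j
    by_cases hj : j < 2 * b
    · simpa using h1 j hj
    · rw [coeff_sub, coeff_zero, coeff_mul_eq_zero_of_bounds h.coeffΛ (evaluatorPoly_coeff T a w) j
        (by omega), coeff_mul_eq_zero_of_bounds (locatorPoly_coeff T a) h.coeffΩ j (by omega),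
        sub_zero]
  have hz : (a i)⁻¹ ≠ 0 := inv_ne_zero hi
  -- A common zero of `Λ` and `Ω` would be a zero of the determinant `c * X ^ (2 * b)`, which has no
  -- zero besides the origin.
  have hdet : ¬ (σ.Λ.eval (a i)⁻¹ = 0 ∧ σ.Ω.eval (a i)⁻¹ = 0) := by
    rintro ⟨h1, h2⟩
    obtain ⟨c, hc, h3⟩ := h.det
    have := congrArg (eval (a i)⁻¹) h3
    simp [h1, h2, hc, hi] at this
  have heval := congrArg (eval (a i)⁻¹) heq
  rw [eval_mul, eval_mul] at heval
  refine ⟨fun h0 hΛ => ?_, fun h0 => ?_⟩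
  · have hne := locatorPoly_eval_ne_zero T a hi
      fun j hj hji => by rw [ha hji, memT] at hj; exact hj h0
    rw [hΛ, zero_mul] at heval
    exact hdet ⟨hΛ, (mul_eq_zero.mp heval.symm).resolve_left hne⟩
  · have hiT : i ∈ T := (memT i).mpr h0
    set Q := (locatorPoly (T.erase i) a).eval (a i)⁻¹ with hQ
    have hQ0 : Q ≠ 0 := locatorPoly_eval_ne_zero _ a hi
      fun j hj hji => (Finset.ne_of_mem_erase hj) (ha hji)
    have hLm : Lm.eval (a i)⁻¹ = 0 := by
      simp only [Lm]
      rw [locatorPoly_eq_mul T a hiT]; simp [hi]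
    have hLm' : (derivative Lm).eval (a i)⁻¹ = - a i * Q := by
      simp only [Lm]
      rw [locatorPoly_eq_mul T a hiT]
      simp [hi, hQ]
    have hOm : Om.eval (a i)⁻¹ = v i * e i * Q := by
      simp only [Om, evaluatorPoly, eval_finsetSum, eval_mul, eval_C]
      refine Finset.sum_eq_single_of_mem i hiT fun j hj hji => ?_
      rw [locatorPoly_eq_mul (T.erase j) a (i := i) (by simp [hiT, hji.symm])]
      simp [hi]
    have hOm0 : Om.eval (a i)⁻¹ ≠ 0 := by
      rw [hOm]; exact mul_ne_zero (mul_ne_zero (hv i) h0) hQ0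
    have hΛ : σ.Λ.eval (a i)⁻¹ = 0 := by
      rw [hLm, zero_mul] at heval
      exact (mul_eq_zero.mp heval).resolve_right hOm0
    have hΩ : σ.Ω.eval (a i)⁻¹ ≠ 0 := fun h1 => hdet ⟨hΛ, h1⟩
    -- Forney's formula: the identity `heq` is differentiated at a common zero of `Λ` and of the
    -- locator polynomial, and the common factor `Q` is cancelled.
    have hder := congrArg (fun p => eval (a i)⁻¹ (derivative p)) heq
    simp only [derivative_mul, eval_add, eval_mul, hΛ, hLm, hLm', hOm] at hder
    have hmain : v i * e i * (derivative σ.Λ).eval (a i)⁻¹ + a i * σ.Ω.eval (a i)⁻¹ = 0 := by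
      refine (mul_eq_zero.mp (?_ : Q * _ = 0)).resolve_left hQ0
      linear_combination hder
    refine ⟨hΛ, fun h1 => ?_, hmain⟩
    rw [h1, mul_zero, zero_add] at hmain
    exact (mul_ne_zero hi hΩ) hmain

end keyEquation

/-! ### Decoding of sparse vectors from their syndromes -/

section sparseDecoder

open Polynomial

variable {K : Type*} [Field K]

open Classical in
/-- The value of the error at the non-zero locator `a` with multiplier `v`, found among the
candidates in `V`. -/
def forneyValue (V : Finset K) (a v : K) (σ : KeyState K) : K :=
  -- The sum is a search. At a true error position the condition is a linear equation in `y` with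
  -- non-zero slope, so only one candidate contributes.
  ∑ y ∈ V, if σ.Λ.eval a⁻¹ = 0 ∧
    v * y * (derivative σ.Λ).eval a⁻¹ + a * σ.Ω.eval a⁻¹ = 0 then y else 0

open Classical in
/-- The decoder restricted to the positions with a non-zero locator. -/
def sparseDecodeUnits {n : ℕ} (V : Finset K) (a v : Fin n → K) (b : ℕ) (S : K[X])
    (i : Fin n) : K :=
  if a i = 0 then 0 else forneyValue V (a i) (v i) (KeyState.result S (2 * b))

open Classical in
/-- The vector with entries in `V` and at most `b` non-zero entries that has the syndromes
`S.coeff j = ∑ i, v i * e i * a i ^ j`, `j < 2 * b`. -/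
def sparseDecode {n : ℕ} (V : Finset K) (a v : Fin n → K) (b : ℕ) (S : K[X]) (i : Fin n) : K :=
  if a i = 0 then
    ∑ y ∈ V, if v i * y - (S.coeff 0 - ∑ l, v l * sparseDecodeUnits V a v b S l) = 0
      then y else 0
  else sparseDecodeUnits V a v b S i

/-- Zeros of `Λ` at inverse locators see every position except the one, if any, whose locator is 0.
That entry contributes only to the syndrome of index 0, and is found there after the other entries
are subtracted. -/
theorem sparseDecode_eq {n b : ℕ} (hb : 1 ≤ b) {V : Finset K} {a v e : Fin n → K}
    (ha : Function.Injective a) (hv : ∀ i, v i ≠ 0) (heV : ∀ i, e i ∈ V)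
    (he : {i | e i ≠ 0}.ncard ≤ b) {S : K[X]}
    (hS : ∀ j < 2 * b, S.coeff j = ∑ i, v i * e i * a i ^ j) (i : Fin n) :
    sparseDecode V a v b S i = e i := by
  classical
  have unit : ∀ l, a l ≠ 0 → sparseDecodeUnits V a v b S l = e l := by
    intro l hl
    have key := (KeyState.inv_result S (2 * b)).locate (KeyState.result_d_le S b) ha hv he hS hl
    rw [sparseDecodeUnits, if_neg hl, forneyValue]
    by_cases h0 : e l = 0
    · rw [h0]
      exact Finset.sum_eq_zero fun y _ => if_neg fun h => key.1 h0 h.1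
    · obtain ⟨h1, h2, h3⟩ := key.2 h0
      rw [Finset.sum_eq_single_of_mem (e l) (heV l), if_pos ⟨h1, h3⟩]
      intro y _ hy
      refine if_neg fun h => hy ?_
      have h4 := sub_eq_zero.mpr (h.2.trans h3.symm)
      have h5 : v l * (derivative (KeyState.result S (2 * b)).Λ).eval (a l)⁻¹ * (y - e l) = 0 := by
        linear_combination h4
      exact sub_eq_zero.mp ((mul_eq_zero.mp h5).resolve_left (mul_ne_zero (hv l) h2))
  rw [sparseDecode]
  split_ifs with hi
  · have h0 := hS 0 (by omega)
    simp only [pow_zero, mul_one] at h0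
    have h1 : S.coeff 0 - ∑ l, v l * sparseDecodeUnits V a v b S l = v i * e i := by
      rw [h0, ← Finset.sum_sub_distrib, Finset.sum_eq_single_of_mem i (Finset.mem_univ i)]
      · simp [sparseDecodeUnits, hi]
      · intro l _ hl
        rw [unit l fun h => hl (ha (h.trans hi.symm)), sub_self]
    rw [h1, Finset.sum_eq_single_of_mem (e i) (heV i), if_pos (sub_self _)]
    intro y _ hy
    refine if_neg fun h => hy ?_
    rw [← mul_sub] at h
    exact sub_eq_zero.mp ((mul_eq_zero.mp h).resolve_left (hv i))
  · exact unit i hi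

/-! ### Operation count of the key equation solver and of the sparse decoder. -/

variable {Y F : Type*} [Field F] [Algebra F K] (pb : PowerBasis F K) {Φ Φ' : Set (Val Y F)}

/-- The coordinates of the first `D` coefficients of a polynomial. -/
def polyVals (D : ℕ) (p : Y → K[X]) : Set (Val Y F) :=
  ⋃ j ∈ Finset.range D, coords pb fun x => (p x).coeff j

/-- The values that represent a state of the key equation solver. -/
def stateVals (D : ℕ) (σ : Y → KeyState K) : Set (Val Y F) :=
  ((((polyVals pb D fun x => (σ x).Λ) ∪ (polyVals pb D fun x => (σ x).Ω)) ∪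
    (polyVals pb D fun x => (σ x).Λ')) ∪ (polyVals pb D fun x => (σ x).Ω')) ∪
    {.inr fun x => ((σ x).d : ℝ)} ∪ {.inr fun x => ((σ x).d' : ℝ)}

variable {pb}

theorem coords_subset_of_polyVals {D : ℕ} {p : Y → K[X]} (h : polyVals pb D p ⊆ Φ) {j : ℕ}
    (hj : j < D) : coords pb (fun x => (p x).coeff j) ⊆ Φ :=
  (Set.subset_biUnion_of_mem (u := fun j => coords pb fun x => (p x).coeff j)
    (Finset.mem_coe.mpr (Finset.mem_range.mpr hj))).trans h

theorem computes_polyVals {D c : ℕ} {p : Y → K[X]}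
    (h : ∀ j < D, CompK pb Φ c fun x => (p x).coeff j) : Computes Φ (D * c) (polyVals pb D p) := by
  have := Computes.biUnion (Finset.range D) fun j hj => h j (Finset.mem_range.mp hj)
  rwa [Finset.card_range] at this

theorem computes_X_mul {D : ℕ} {p : Y → K[X]} (h : polyVals pb D p ⊆ Φ) :
    Computes Φ (D * opCost pb) (polyVals pb D fun x => X * p x) := by
  refine computes_polyVals fun j hj => ?_
  cases j with
  | zero => simpa using CompK.const 0
  | succ j =>
    simp only [coeff_X_mul]
    exact (CompK.of_subset (coords_subset_of_polyVals h (by omega))).mono_cost (by omega)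

theorem computes_eliminate {D : ℕ} {p r : Y → K[X]} {u w : Y → K} (hp : polyVals pb D p ⊆ Φ)
    (hr : polyVals pb D r ⊆ Φ) (hu : coords pb u ⊆ Φ) (hw : coords pb w ⊆ Φ) :
    Computes Φ (D * (3 * opCost pb)) (polyVals pb D fun x => C (u x) * p x - C (w x) * r x) := by
  refine computes_polyVals fun j hj => ?_
  simp only [coeff_sub, coeff_C_mul]
  exact (((CompK.of_subset hu).mul (.of_subset (coords_subset_of_polyVals hp hj))).sub
    ((CompK.of_subset hw).mul (.of_subset (coords_subset_of_polyVals hr hj)))).mono_cost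
    (le_of_eq (by ring))

open Classical in
theorem computes_ite_poly {D : ℕ} {P : Y → Prop} {p r : Y → K[X]} (hP : .inr (ind P) ∈ Φ)
    (hp : polyVals pb D p ⊆ Φ) (hr : polyVals pb D r ⊆ Φ) :
    Computes Φ (D * opCost pb) (polyVals pb D fun x => if P x then p x else r x) := by
  refine computes_polyVals fun j hj => ?_
  convert CompK.ite (.of_mem hP) (.of_subset (coords_subset_of_polyVals hp hj))
    (.of_subset (coords_subset_of_polyVals hr hj)) using 3 with x
  · omega
  · split_ifs <;> rfl

theorem stateVals_subset_iff {D : ℕ} {σ : Y → KeyState K} :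
    stateVals pb D σ ⊆ Φ ↔ ((polyVals pb D fun x => (σ x).Λ) ⊆ Φ ∧
      (polyVals pb D fun x => (σ x).Ω) ⊆ Φ ∧ (polyVals pb D fun x => (σ x).Λ') ⊆ Φ ∧
      (polyVals pb D fun x => (σ x).Ω') ⊆ Φ ∧ (.inr fun x => ((σ x).d : ℝ)) ∈ Φ ∧
      (.inr fun x => ((σ x).d' : ℝ)) ∈ Φ) := by
  simp only [stateVals, Set.union_subset_iff, Set.singleton_subset_iff, and_assoc]

theorem stateVals_swap {D : ℕ} {σ : Y → KeyState K} (h : stateVals pb D σ ⊆ Φ) :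
    (stateVals pb D fun x => (σ x).swap) ⊆ Φ := by
  rw [stateVals_subset_iff] at h ⊢
  obtain ⟨h1, h2, h3, h4, h5, h6⟩ := h
  exact ⟨h3, h4, h1, h2, h6, h5⟩

open Classical in
theorem computes_ite_state {D : ℕ} {P : Y → Prop} {σ τ : Y → KeyState K} (hP : .inr (ind P) ∈ Φ)
    (hσ : stateVals pb D σ ⊆ Φ) (hτ : stateVals pb D τ ⊆ Φ) :
    Computes Φ (4 * (D * opCost pb) + 2) (stateVals pb D fun x => if P x then σ x else τ x) := by
  rw [stateVals_subset_iff] at hσ hτ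
  obtain ⟨h1, h2, h3, h4, h5, h6⟩ := hσ
  obtain ⟨k1, k2, k3, k4, k5, k6⟩ := hτ
  have := ((((computes_ite_poly hP h1 k1).union (computes_ite_poly hP h2 k2)).union
    (computes_ite_poly hP h3 k3)).union (computes_ite_poly hP h4 k4)).union
    (CompR.ite (.of_mem hP) (.of_mem h5) (.of_mem k5)) |>.union
    (CompR.ite (.of_mem hP) (.of_mem h6) (.of_mem k6))
  refine (this.mono_cost (by omega)).mono_right (le_of_eq ?_)
  simp only [stateVals, apply_ite KeyState.Λ, apply_ite KeyState.Ω, apply_ite KeyState.Λ',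
    apply_ite KeyState.Ω', apply_ite KeyState.d, apply_ite KeyState.d', Nat.cast_ite]

theorem computes_disc {D r i : ℕ} {S : Y → K[X]} {σ : Y → KeyState K} (hi : i < r) (hr : r ≤ D)
    (hS : polyVals pb r S ⊆ Φ) (hσ : stateVals pb D σ ⊆ Φ) :
    CompK pb Φ (D * (2 * opCost pb) + 2 * opCost pb) fun x => (σ x).disc (S x) i := by
  rw [stateVals_subset_iff] at hσ
  simp only [KeyState.disc, coeff_sub, coeff_mul]
  refine (CompK.sub (CompK.sum (c := opCost pb) _ fun x hx => ?_)
    (.of_subset (coords_subset_of_polyVals hσ.2.1 (by omega)))).mono_cost ?_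
  · rw [Finset.HasAntidiagonal.mem_antidiagonal] at hx
    exact ((CompK.of_subset (coords_subset_of_polyVals hσ.1 (by omega))).mul
      (.of_subset (coords_subset_of_polyVals hS (by omega)))).mono_cost (by omega)
  · rw [Finset.Nat.card_antidiagonal]
    have : (i + 1) * (opCost pb + opCost pb) ≤ D * (2 * opCost pb) := by
      rw [← two_mul]; exact Nat.mul_le_mul_right _ (by omega)
    omega

theorem ten_le_opCost : 10 ≤ opCost pb := by
  have := pb.dim_pos
  unfold opCost; nlinarith

theorem computes_advance {D r i : ℕ} {S : Y → K[X]} {σ : Y → KeyState K} (hi : i < r) (hr : r ≤ D)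
    (hS : polyVals pb r S ⊆ Φ) (hσ : stateVals pb D σ ⊆ Φ) :
    Computes Φ (17 * (D * opCost pb)) (stateVals pb D fun x => (σ x).advance (S x) i) := by
  have hκ := ten_le_opCost (pb := pb)
  refine (((computes_disc hi hr hS hσ).union (computes_disc hi hr hS (stateVals_swap hσ))).bind
    (c' := 8 * (D * opCost pb) + 2) fun Φ' h h' => ?_).mono_cost ?_
  · rw [Set.union_subset_iff] at h'
    have hσ' := stateVals_subset_iff.mp (hσ.trans h)
    obtain ⟨h1, h2, h3, h4, h5, h6⟩ := hσ'
    have := ((((computes_X_mul h1).union (computes_X_mul h2)).union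
      (computes_eliminate h3 h1 h'.1 h'.2)).union (computes_eliminate h4 h2 h'.1 h'.2)).union
      (CompR.add (.of_mem h5) (CompR.const 1)) |>.union (.of_mem h6)
    refine (this.mono_cost (by ring_nf; omega)).mono_right (le_of_eq ?_)
    simp only [stateVals, KeyState.advance, Nat.cast_add, Nat.cast_one]
  · have h1 : opCost pb ≤ D * opCost pb := Nat.le_mul_of_pos_left _ (by omega)
    have h2 : D * (2 * opCost pb) = 2 * (D * opCost pb) := by ring
    omega

theorem computes_step {D r i : ℕ} {S : Y → K[X]} {σ : Y → KeyState K} (hi : i < r) (hr : r ≤ D)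
    (hS : polyVals pb r S ⊆ Φ) (hσ : stateVals pb D σ ⊆ Φ) :
    Computes Φ (40 * (D * opCost pb)) (stateVals pb D fun x => (σ x).step (S x) i) := by
  classical
  have hκ := ten_le_opCost (pb := pb)
  have h1 : opCost pb ≤ D * opCost pb := Nat.le_mul_of_pos_left _ (by omega)
  have h2 : D * (2 * opCost pb) = 2 * (D * opCost pb) := by ring
  have hd := computes_disc hi hr hS hσ
  have hd' := computes_disc hi hr hS (stateVals_swap hσ)
  obtain ⟨-, -, -, -, h5, h6⟩ := stateVals_subset_iff.mp hσ
  have hle : CompR Φ 1 (ind fun x => (σ x).d ≤ (σ x).d') := by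
    simpa using CompR.le (.of_mem h5) (.of_mem h6)
  have hpivot : CompR Φ (10 * (D * opCost pb) + 11) (ind fun x => (σ x).Pivot (S x) i) :=
    ((CompR.eq_zero hd).not.and ((CompR.eq_zero hd').or hle)).mono_cost (by omega)
  refine Computes.mono_cost (hpivot.bind (c' := 22 * (D * opCost pb)) fun Φ₁ hΦ₁ hp => ?_)
    (by omega)
  refine Computes.mono_cost ((computes_ite_state (hp rfl) (hσ.trans hΦ₁)
    (stateVals_swap (hσ.trans hΦ₁))).bind (c' := 17 * (D * opCost pb)) fun Φ₂ hΦ₂ hσ₂ => ?_)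
    (by omega)
  convert computes_advance hi hr ((hS.trans hΦ₁).trans hΦ₂) hσ₂ using 3 with x
  unfold KeyState.step
  congr

theorem computes_init {D : ℕ} :
    Computes Φ (4 * (D * opCost pb) + 2) (stateVals pb D fun _ : Y => KeyState.init) := by
  have key : ∀ p : K[X], Computes Φ (D * opCost pb) (polyVals pb D fun _ : Y => p) :=
    fun p => computes_polyVals fun j _ => CompK.const (p.coeff j)
  exact ((((((key _).union (key _)).union (key _)).union (key _)).union (CompR.const _)).union
    (CompR.const _)).mono_cost (by omega)

/-- All polynomials are truncated to `D` coefficients. A step determines these from the same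
coefficients of the previous state, so no degree bound is needed until polynomials are evaluated. -/
theorem computes_iter {D r : ℕ} {S : Y → K[X]} (hr : r ≤ D) (hS : polyVals pb r S ⊆ Φ) (i : ℕ)
    (hi : i ≤ r) : Computes Φ (i * (40 * (D * opCost pb)) + (4 * (D * opCost pb) + 2))
      (stateVals pb D fun x => KeyState.iter (S x) i) := by
  induction i with
  | zero =>
    rw [zero_mul, zero_add]
    exact computes_init
  | succ i ih =>
    exact ((ih (by omega)).bind fun Φ' h h' =>
      computes_step (by omega) hr (hS.trans h) h').mono_cost (by rw [add_mul]; omega)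

theorem computes_result {D r : ℕ} {S : Y → K[X]} (hr : r ≤ D) (hD : 0 < D)
    (hS : polyVals pb r S ⊆ Φ) :
    Computes Φ ((r + 1) * (40 * (D * opCost pb)))
      (stateVals pb D fun x => KeyState.result (S x) r) := by
  classical
  have hκ := ten_le_opCost (pb := pb)
  have h1 : opCost pb ≤ D * opCost pb := Nat.le_mul_of_pos_left _ (by omega)
  refine Computes.mono_cost ((computes_iter hr hS r le_rfl).bind
    (c' := 4 * (D * opCost pb) + 3) fun Φ' h hσ => ?_) (by rw [add_mul]; omega)
  obtain ⟨-, -, -, -, h5, h6⟩ := stateVals_subset_iff.mp hσ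
  have hle : CompR Φ' 1 (ind fun x => (KeyState.iter (S x) r).d ≤ (KeyState.iter (S x) r).d') := by
    simpa using CompR.le (.of_mem h5) (.of_mem h6)
  refine Computes.mono_cost (hle.bind (c' := 4 * (D * opCost pb) + 2) fun Φ₁ hΦ₁ hp => ?_)
    (by omega)
  refine (computes_ite_state (hp rfl) (hσ.trans hΦ₁) (stateVals_swap (hσ.trans hΦ₁))).mono_right
    (le_of_eq ?_)
  congr 1
  funext x
  unfold KeyState.result
  congr

theorem natDegree_lt_of_coeff {D : ℕ} (hD : 0 < D) {p : K[X]} (h : ∀ j ≥ D, p.coeff j = 0) :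
    p.natDegree < D := by
  by_contra! h1
  have := leadingCoeff_eq_zero.mp (h _ h1)
  simp [this] at h1
  omega

/-- The point `z` does not depend on the input. Its powers, and the inverse locators to which this
is applied, are loaded constants. -/
theorem computes_eval {D : ℕ} (hD : 0 < D) {p : Y → K[X]} (hp : polyVals pb D p ⊆ Φ)
    (hd : ∀ x, ∀ j ≥ D, (p x).coeff j = 0) (z : K) :
    CompK pb Φ (D * (3 * opCost pb) + opCost pb) fun x => (p x).eval z := by
  have := CompK.linear (Φ := Φ) (Finset.range D) (fun j => z ^ j)
    fun j hj => coords_subset_of_polyVals hp (Finset.mem_range.mp hj)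
  rw [Finset.card_range] at this
  refine this.mono_right (le_of_eq ?_)
  congr 1
  funext x
  rw [eval_eq_sum, Polynomial.sum_over_range' _ (by simp) D]
  · simp [mul_comm]
  · exact natDegree_lt_of_coeff hD (hd x)

theorem computes_derivative_eval {D : ℕ} (hD : 0 < D) {p : Y → K[X]} (hp : polyVals pb D p ⊆ Φ)
    (hd : ∀ x, ∀ j ≥ D, (p x).coeff j = 0) (z : K) :
    CompK pb Φ (D * (3 * opCost pb) + opCost pb) fun x => (derivative (p x)).eval z := by
  have := CompK.linear (Φ := Φ) (Finset.range D) (fun j => j * z ^ (j - 1))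
    fun j hj => coords_subset_of_polyVals hp (Finset.mem_range.mp hj)
  rw [Finset.card_range] at this
  refine this.mono_right (le_of_eq ?_)
  congr 1
  funext x
  rw [derivative_eval, Polynomial.sum_over_range' _ (by simp) D]
  · exact Finset.sum_congr rfl fun j _ => by ring
  · exact natDegree_lt_of_coeff hD (hd x)

theorem computes_forneyValue {D : ℕ} (hD : 0 < D) (V : Finset K) (a v : K) {σ : Y → KeyState K}
    (hσ : stateVals pb D σ ⊆ Φ) (hΛ : ∀ x, ∀ j ≥ D, (σ x).Λ.coeff j = 0)
    (hΩ : ∀ x, ∀ j ≥ D, (σ x).Ω.coeff j = 0) :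
    CompK pb Φ ((13 * D + 12 * V.card) * opCost pb) fun x => forneyValue V a v (σ x) := by
  classical
  have hκ := ten_le_opCost (pb := pb)
  obtain ⟨h1, h2, -, -, -, -⟩ := stateVals_subset_iff.mp hσ
  have hDκ : opCost pb ≤ D * opCost pb := Nat.le_mul_of_pos_left _ hD
  have kA := computes_eval (pb := pb) hD h1 hΛ a⁻¹
  have kB := computes_derivative_eval (pb := pb) hD h1 hΛ a⁻¹
  have kC := computes_eval (pb := pb) hD h2 hΩ a⁻¹
  refine Computes.mono_cost (((kA.union kB).union kC).bind
    (c' := V.card * (11 * opCost pb + opCost pb) + opCost pb) fun Φ' _ h => ?_) (by nlinarith)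
  obtain ⟨⟨hA, hB⟩, hC⟩ := by simpa only [Set.union_subset_iff] using h
  refine CompK.sum V fun y _ => ?_
  have hcond := CompR.and (CompR.eq_zero (CompK.of_subset (pb := pb) hA))
    (CompR.eq_zero (((CompK.const (pb := pb) (v * y)).mul (.of_subset hB)).add
      ((CompK.const a).mul (.of_subset hC))))
  have hite := CompK.ite (pb := pb) hcond (CompK.const y) (CompK.const 0)
  convert hite.mono_cost (c' := 11 * opCost pb) (by omega)

theorem computes_sparseDecodeUnits {n b : ℕ} (V : Finset K) (a v : Fin n → K)
    {S : Y → K[X]} (hS : polyVals pb (2 * b) S ⊆ Φ) :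
    Computes Φ ((2 * b + 1) * (40 * ((2 * b + 2) * opCost pb)) +
        n * ((13 * (2 * b + 2) + 12 * V.card) * opCost pb))
      (⋃ i, coords pb fun x => sparseDecodeUnits V a v b (S x) i) := by
  refine (computes_result (D := 2 * b + 2) (by omega) (by omega) hS).bind fun Φ' _ hσ => ?_
  have hΛ : ∀ x, ∀ j ≥ 2 * b + 2, (KeyState.result (S x) (2 * b)).Λ.coeff j = 0 := fun x j hj =>
    (KeyState.inv_result (S x) (2 * b)).coeffΛ j
      (by have := KeyState.result_d_le (S x) b; omega)
  have hΩ : ∀ x, ∀ j ≥ 2 * b + 2, (KeyState.result (S x) (2 * b)).Ω.coeff j = 0 := fun x j hj =>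
    (KeyState.inv_result (S x) (2 * b)).coeffΩ j
      (by have := KeyState.result_d_le (S x) b; omega)
  have := Computes.iUnion (ι := Fin n) (Φ := Φ')
    (c := (13 * (2 * b + 2) + 12 * V.card) * opCost pb)
    (Ψ := fun i => coords pb fun x => sparseDecodeUnits V a v b (S x) i) fun i => by
      unfold sparseDecodeUnits
      split_ifs with hi
      · exact (CompK.const 0).mono_cost (Nat.le_mul_of_pos_left _ (by omega))
      · exact computes_forneyValue (by omega) V (a i) (v i) hσ hΛ hΩ
  rwa [Fintype.card_fin] at this

/-- The sparse decoder needs `O(b² + n b + n |V|)` operations of the extension field. -/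
theorem computes_sparseDecode {n b : ℕ} (hb : 1 ≤ b) (V : Finset K) (a v : Fin n → K)
    {S : Y → K[X]} (hS : polyVals pb (2 * b) S ⊆ Φ) :
    Computes Φ (500 * ((b ^ 2 + n * b + n * V.card) * opCost pb))
      (⋃ i, coords pb fun x => sparseDecode V a v b (S x) i) := by
  classical
  set κ := opCost pb with hκ
  refine Computes.mono_cost ((computes_sparseDecodeUnits V a v hS).bind
    (c' := (n * (3 * κ) + 2 * κ) + n * (V.card * (6 * κ + κ) + κ)) fun Φ₁ h₁ hu => ?_) ?_
  · rw [Set.iUnion_subset_iff] at hu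
    have hW : CompK pb Φ₁ (n * (3 * κ) + 2 * κ)
        (fun x => (S x).coeff 0 - ∑ l, v l * sparseDecodeUnits V a v b (S x) l) := by
      have := CompK.linear (Φ := Φ₁) Finset.univ v fun l _ => hu l
      rw [Finset.card_univ, Fintype.card_fin, ← hκ] at this
      exact ((CompK.of_subset ((coords_subset_of_polyVals hS (by omega)).trans h₁)).sub
        this).mono_cost (by omega)
    refine hW.bind fun Φ₂ h₂ hw => ?_
    have := Computes.iUnion (ι := Fin n) (Φ := Φ₂) (c := V.card * (6 * κ + κ) + κ)
      (Ψ := fun i => coords pb fun x => sparseDecode V a v b (S x) i) fun i => by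
        unfold sparseDecode
        split_ifs with hi
        · refine CompK.sum V fun y _ => ?_
          exact (CompK.ite (CompR.eq_zero ((CompK.const (v i * y)).sub (.of_subset hw)))
            (CompK.const y) (CompK.const 0)).mono_cost (by omega)
        · exact (CompK.of_subset ((hu i).trans h₂)).mono_cost (by omega)
    rwa [Fintype.card_fin] at this
  · have e1 : (2 * b + 1) * (40 * ((2 * b + 2) * κ)) + n * ((13 * (2 * b + 2) + 12 * V.card) * κ) +
        ((n * (3 * κ) + 2 * κ) + n * (V.card * (6 * κ + κ) + κ)) =
        ((2 * b + 1) * (80 * (b + 1)) + n * (26 * (b + 1)) + 12 * (n * V.card) + 4 * n + 2 +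
          7 * (n * V.card)) * κ := by ring
    rw [e1, ← mul_assoc 500]
    refine Nat.mul_le_mul_right _ ?_
    have h1 : n ≤ n * b := Nat.le_mul_of_pos_right _ hb
    nlinarith

end sparseDecoder

/-! ### Noise probabilities -/

section noise

variable {F : Type*} [Field F] [Fintype F] {lam : ℝ}

theorem one_lt_card_real (F : Type*) [Field F] [Fintype F] : (1 : ℝ) < Fintype.card F := by
  exact_mod_cast Fintype.one_lt_card

theorem two_le_card_real (F : Type*) [Field F] [Fintype F] : (2 : ℝ) ≤ Fintype.card F := by
  exact_mod_cast Fintype.one_lt_card (α := F)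

theorem symbolProb_pos (h0 : 0 < lam) (h1 : lam < 1) (a : F) : 0 < symbolProb lam a := by
  have := one_lt_card_real F
  unfold symbolProb
  split_ifs
  · linarith
  · exact div_pos h0 (by linarith)

open Classical in
-- This is the generating function of the weight of one noise symbol, the base in the exponential
-- Markov inequality.
theorem sum_symbolProb_mul (lam z : ℝ) :
    ∑ a : F, symbolProb lam a * (if a ≠ 0 then z else 1) = 1 - lam + lam * z := by
  have hq := one_lt_card_real F
  rw [← Finset.add_sum_erase _ _ (Finset.mem_univ (0 : F))]
  congr 1
  · simp [symbolProb]
  · rw [Finset.sum_congr rfl (g := fun _ => lam / ((Fintype.card F : ℝ) - 1) * z)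
      fun a ha => by simp [symbolProb, Finset.ne_of_mem_erase ha]]
    rw [Finset.sum_const, Finset.card_erase_of_mem (Finset.mem_univ _), Finset.card_univ,
      nsmul_eq_mul, Nat.cast_sub Fintype.card_pos]
    have : (Fintype.card F : ℝ) - 1 ≠ 0 := by linarith
    push_cast
    field_simp

theorem sum_symbolProb (lam : ℝ) : ∑ a : F, symbolProb lam a = 1 := by
  simpa using sum_symbolProb_mul (F := F) lam 1

/-- The probability of a noise vector. -/
def vectorProb (lam : ℝ) {m : ℕ} (e : Fin m → F) : ℝ := ∏ i, symbolProb lam (e i)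

theorem vectorProb_pos (h0 : 0 < lam) (h1 : lam < 1) {m : ℕ} (e : Fin m → F) :
    0 < vectorProb lam e := Finset.prod_pos fun _ _ => symbolProb_pos h0 h1 _

theorem sum_vectorProb (lam : ℝ) (m : ℕ) : ∑ e : Fin m → F, vectorProb lam e = 1 := by
  unfold vectorProb
  rw [← Fintype.sum_pow, sum_symbolProb, one_pow]

open Classical in
theorem noiseProb_eq {m : ℕ} (S : Set (Fin m → F)) :
    noiseProb lam S = ∑ e, if e ∈ S then vectorProb lam e else 0 := rfl

theorem noiseProb_mono (h0 : 0 < lam) (h1 : lam < 1) {m : ℕ} {S S' : Set (Fin m → F)}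
    (h : S ⊆ S') : noiseProb lam S ≤ noiseProb lam S' := by
  classical
  rw [noiseProb_eq, noiseProb_eq]
  refine Finset.sum_le_sum fun e _ => ?_
  have := (vectorProb_pos h0 h1 e).le
  by_cases h2 : e ∈ S
  · simp [h2, h h2]
  · rw [if_neg h2]; split_ifs <;> simp [this]

theorem noiseProb_add_compl {m : ℕ} (S : Set (Fin m → F)) :
    noiseProb lam S + noiseProb lam Sᶜ = 1 := by
  classical
  rw [noiseProb_eq, noiseProb_eq, ← Finset.sum_add_distrib, ← sum_vectorProb (F := F) lam m]
  refine Finset.sum_congr rfl fun e _ => ?_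
  by_cases h : e ∈ S <;> simp [h]

theorem noiseProb_union_le (h0 : 0 < lam) (h1 : lam < 1) {m : ℕ} (S S' : Set (Fin m → F)) :
    noiseProb lam (S ∪ S') ≤ noiseProb lam S + noiseProb lam S' := by
  classical
  rw [noiseProb_eq, noiseProb_eq, noiseProb_eq, ← Finset.sum_add_distrib]
  refine Finset.sum_le_sum fun e _ => ?_
  have := (vectorProb_pos h0 h1 e).le
  by_cases h2 : e ∈ S <;> by_cases h3 : e ∈ S' <;> simp [h2, h3, this]

theorem noiseProb_iUnion_le (h0 : 0 < lam) (h1 : lam < 1) {m : ℕ} {ι : Type*} (s : Finset ι)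
    (S : ι → Set (Fin m → F)) :
    noiseProb lam (⋃ i ∈ s, S i) ≤ ∑ i ∈ s, noiseProb lam (S i) := by
  classical
  induction s using Finset.induction_on with
  | empty => simp [noiseProb]
  | insert a s ha ih =>
    rw [Finset.set_biUnion_insert, Finset.sum_insert ha]
    exact (noiseProb_union_le h0 h1 _ _).trans (by linarith)

open Classical in
/-- The exponential Markov inequality for the number of bad components of a vector with
independent components. -/
theorem sum_prod_bad_le {A ι : Type*} [Fintype A] [Fintype ι] [DecidableEq ι] {w : A → ℝ} (hw : ∀ a, 0 ≤ w a)
    (bad : A → Prop) {z : ℝ} (hz : 1 ≤ z) (j : ℕ) :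
    (∑ f : ι → A, if j ≤ {i | bad (f i)}.ncard then ∏ i, w (f i) else 0) ≤
      (z ^ j)⁻¹ * (∑ a, w a * if bad a then z else 1) ^ Fintype.card ι := by
  have hz0 : 0 < z := by linarith
  have : (∑ a, w a * if bad a then z else 1) ^ Fintype.card ι =
      ∑ f : ι → A, ∏ i, (w (f i) * if bad (f i) then z else 1) := by
    rw [← Finset.card_univ, ← Finset.prod_const, Finset.prod_univ_sum, Fintype.piFinset_univ]
  rw [this, Finset.mul_sum]
  refine Finset.sum_le_sum fun f _ => ?_
  have hp : 0 ≤ ∏ i, w (f i) := Finset.prod_nonneg fun i _ => hw _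
  have hq : ∏ i, (if bad (f i) then z else 1) = z ^ {i | bad (f i)}.ncard := by
    rw [Finset.prod_ite, Finset.prod_const, Finset.prod_const_one, mul_one]
    congr 1
    rw [← Set.ncard_coe_finset]
    simp
  rw [Finset.prod_mul_distrib, hq]
  split_ifs with h
  · have : z ^ j ≤ z ^ {i | bad (f i)}.ncard := pow_le_pow_right₀ hz h
    rw [← mul_assoc, mul_comm (z ^ j)⁻¹, mul_assoc]
    refine le_mul_of_one_le_right hp ?_
    rw [inv_mul_eq_div, le_div_iff₀ (by positivity), one_mul]
    exact this
  · positivity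

theorem noiseProb_weight_le (h0 : 0 < lam) (h1 : lam < 1) {z : ℝ} (hz : 1 ≤ z) (t j : ℕ) :
    noiseProb lam {e : Fin t → F | j ≤ {i | e i ≠ 0}.ncard} ≤
      (z ^ j)⁻¹ * (1 - lam + lam * z) ^ t := by
  classical
  have := sum_prod_bad_le (ι := Fin t) (fun a : F => (symbolProb_pos h0 h1 a).le)
    (fun a => a ≠ 0) hz j
  rw [Fintype.card_fin] at this
  rw [← sum_symbolProb_mul (F := F), noiseProb_eq]
  convert this using 3
  · exact Iff.rfl
  · rfl
  · congr!

/-! ### Random linear inner codes -/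

/-- The number of vectors of weight at most `W`. -/
def ballCard (F : Type*) [Field F] (t W : ℕ) : ℕ :=
  {e : Fin t → F | {i | e i ≠ 0}.ncard ≤ W}.ncard

/-- The noise vectors for which the decoder with threshold `W` succeeds. -/
def goodNoise {V : Type*} [AddCommGroup V] [Module F V] {t : ℕ} (φ : V →ₗ[F] (Fin t → F))
    (W : ℕ) : Set (Fin t → F) :=
  {e | {i | e i ≠ 0}.ncard ≤ W ∧ ∀ u ≠ 0, W < {i | (φ u + e) i ≠ 0}.ncard}

theorem vectorProb_eq (h1 : lam < 1) {t : ℕ} (e : Fin t → F) :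
    vectorProb lam e = (1 - lam) ^ t *
      (lam / ((Fintype.card F : ℝ) - 1) / (1 - lam)) ^ {i | e i ≠ 0}.ncard := by
  classical
  have h2 : 1 - lam ≠ 0 := by linarith
  have : ∀ a : F, symbolProb lam a = (1 - lam) *
      if a ≠ 0 then (lam / ((Fintype.card F : ℝ) - 1) / (1 - lam)) else 1 := by
    intro a
    by_cases ha : a = 0
    · simp [symbolProb, ha]
    · simp only [symbolProb, ha, if_false, ne_eq, not_false_eq_true, if_true]
      field_simp
  simp only [vectorProb, this]
  rw [Finset.prod_mul_distrib, Finset.prod_const, Finset.card_univ, Fintype.card_fin,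
    Finset.prod_ite, Finset.prod_const, Finset.prod_const_one, mul_one]
  congr 2
  rw [← Set.ncard_coe_finset]
  simp

/-- Since the likelihood ratio is at most 1, each vector of the ball is at least as probable as one
of weight `W`, and the total probability is 1. This bounds the volume of the ball without binomial
coefficients. -/
theorem ballCard_mul_le (h0 : 0 < lam) (h1 : lam < 1)
    (hr : lam / ((Fintype.card F : ℝ) - 1) / (1 - lam) ≤ 1) (t W : ℕ) :
    ballCard F t W * ((1 - lam) ^ t * (lam / ((Fintype.card F : ℝ) - 1) / (1 - lam)) ^ W) ≤ 1 := by
  classical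
  have hq := one_lt_card_real F
  have hr0 : 0 ≤ lam / ((Fintype.card F : ℝ) - 1) / (1 - lam) :=
    div_nonneg (div_nonneg h0.le (by linarith)) (by linarith)
  refine le_of_le_of_eq ?_ (sum_vectorProb (F := F) lam t)
  rw [ballCard, Set.ncard_eq_toFinset_card', ← nsmul_eq_mul]
  refine (Finset.card_nsmul_le_sum _ (fun e => vectorProb lam e) _ fun e he => ?_).trans
    (Finset.sum_le_sum_of_subset_of_nonneg (Finset.subset_univ _)
      fun e _ _ => (vectorProb_pos h0 h1 e).le)
  rw [vectorProb_eq h1]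
  have he' : {i | e i ≠ 0}.ncard ≤ W := by simpa using he
  have h2 : 0 ≤ (1 - lam) ^ t := pow_nonneg (by linarith) _
  refine mul_le_mul_of_nonneg_left ?_ h2
  exact pow_le_pow_of_le_one hr0 hr he'

open Classical in
-- For `u ≠ 0`, evaluation at `u` is a surjective homomorphism, so its fibres have equal size: the
-- codeword of `u` under a random linear map is uniform.
theorem card_linearMap_apply_mem {V : Type*} [AddCommGroup V] [Module F V] [Finite V] {t : ℕ}
    [Fintype (V →ₗ[F] (Fin t → F))] {u : V} (hu : u ≠ 0) (B : Finset (Fin t → F)) :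
    (Finset.univ.filter fun φ : V →ₗ[F] (Fin t → F) => φ u ∈ B).card * Fintype.card F ^ t =
      B.card * Fintype.card (V →ₗ[F] (Fin t → F)) := by
  let ev : (V →ₗ[F] (Fin t → F)) →+ (Fin t → F) :=
    { toFun := fun φ => φ u, map_zero' := rfl, map_add' := fun _ _ => rfl }
  have hsurj : Function.Surjective ev := by
    intro c
    obtain ⟨f, hf⟩ := Module.Projective.exists_dual_ne_zero F hu
    refine ⟨(f.smulRight ((f u)⁻¹ • c)), ?_⟩
    simp [ev, smul_smul, hf]
  have hfib : ∀ c, (Finset.univ.filter fun φ : V →ₗ[F] (Fin t → F) => φ u = c).card =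
      (Finset.univ.filter fun φ : V →ₗ[F] (Fin t → F) => φ u = 0).card := fun c =>
    AddMonoidHom.card_fiber_eq_of_mem_range ev (hsurj c) (hsurj 0)
  have key : ∀ B : Finset (Fin t → F),
      (Finset.univ.filter fun φ : V →ₗ[F] (Fin t → F) => φ u ∈ B).card =
      B.card * (Finset.univ.filter fun φ : V →ₗ[F] (Fin t → F) => φ u = 0).card := by
    intro B
    rw [Finset.card_eq_sum_card_fiberwise (f := fun φ : V →ₗ[F] (Fin t → F) => φ u) (t := B)
      (fun φ hφ => by simpa using hφ), ← smul_eq_mul, ← Finset.sum_const]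
    refine Finset.sum_congr rfl fun c hc => ?_
    rw [← hfib c, Finset.filter_filter]
    congr 1
    ext φ
    simp only [Finset.mem_filter, Finset.mem_univ, true_and, and_iff_right_iff_imp]
    rintro rfl; exact hc
  have h1 := key B
  have h2 := key Finset.univ
  simp only [Finset.mem_univ, Finset.filter_true, Finset.card_univ, Fintype.card_fun,
    Fintype.card_fin] at h2
  rw [h1, h2]
  ring

/-- Some linear code has a small error probability, by averaging over all linear codes. -/
theorem exists_linearMap_noiseProb_le (h0 : 0 < lam) (h1 : lam < 1) (V : Type*) [AddCommGroup V]
    [Module F V] [Finite V] (t W : ℕ) :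
    ∃ φ : V →ₗ[F] (Fin t → F), noiseProb lam (goodNoise φ W)ᶜ ≤
      noiseProb lam {e : Fin t → F | W + 1 ≤ {i | e i ≠ 0}.ncard} +
        Nat.card V * (ballCard F t W / (Fintype.card F : ℝ) ^ t) := by
  classical
  have := Fintype.ofFinite V
  have : Finite (V →ₗ[F] (Fin t → F)) := DFunLike.finite _
  have := Fintype.ofFinite (V →ₗ[F] (Fin t → F))
  have hq := one_lt_card_real F
  -- The decoder fails only if the noise is heavy or some non-zero codeword, added to the noise,
  -- gives weight at most `W`. The second event is averaged over `φ` for each message separately.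
  have hsub : ∀ φ : V →ₗ[F] (Fin t → F), (goodNoise φ W)ᶜ ⊆
      {e : Fin t → F | W + 1 ≤ {i | e i ≠ 0}.ncard} ∪
        ⋃ u ∈ Finset.univ.erase (0 : V), {e | {i | (φ u + e) i ≠ 0}.ncard ≤ W} := by
    intro φ e he
    by_contra h
    simp only [Set.mem_union, Set.mem_ofPred_eq, Set.mem_iUnion, not_or, not_exists, not_le,
      Finset.mem_erase, Finset.mem_univ, and_true] at h
    exact he ⟨by omega, fun u hu => h.2 u hu⟩
  have hbound : ∀ φ : V →ₗ[F] (Fin t → F), noiseProb lam (goodNoise φ W)ᶜ ≤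
      noiseProb lam {e : Fin t → F | W + 1 ≤ {i | e i ≠ 0}.ncard} +
        ∑ u ∈ Finset.univ.erase (0 : V), noiseProb lam {e : Fin t → F | {i | (φ u + e) i ≠ 0}.ncard ≤ W} :=
    fun φ => (noiseProb_mono h0 h1 (hsub φ)).trans ((noiseProb_union_le h0 h1 _ _).trans
      (add_le_add_right (noiseProb_iUnion_le h0 h1 _ _) _))
  have hcount : ∀ u ∈ Finset.univ.erase (0 : V), ∑ φ : V →ₗ[F] (Fin t → F),
      noiseProb lam {e : Fin t → F | {i | (φ u + e) i ≠ 0}.ncard ≤ W} =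
      Fintype.card (V →ₗ[F] (Fin t → F)) * (ballCard F t W / (Fintype.card F : ℝ) ^ t) := by
    intro u hu
    simp only [noiseProb_eq]
    rw [Finset.sum_comm]
    have hterm : ∀ e : Fin t → F, (∑ φ : V →ₗ[F] (Fin t → F),
        if e ∈ {e : Fin t → F | {i | (φ u + e) i ≠ 0}.ncard ≤ W} then vectorProb lam e else 0) =
        vectorProb lam e *
          (Fintype.card (V →ₗ[F] (Fin t → F)) * (ballCard F t W / (Fintype.card F : ℝ) ^ t)) := by
      intro e
      let B : Finset (Fin t → F) := {c | {i | (c + e) i ≠ 0}.ncard ≤ W}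
      have hB : B.card = ballCard F t W := by
        rw [ballCard, ← Set.ncard_coe_finset]
        refine Set.ncard_congr (fun c _ => c + e) (fun c hc => by simpa [B] using hc)
          (fun c c' _ _ h => add_right_cancel h) fun c hc => ⟨c - e, ?_, by simp⟩
        simpa [B] using hc
      have hcard := card_linearMap_apply_mem (F := F) (Finset.ne_of_mem_erase hu) B
      rw [hB] at hcard
      rw [← Finset.sum_filter, Finset.sum_const, nsmul_eq_mul, mul_comm]
      congr 1
      have hcard' : ((Finset.univ.filter fun φ : V →ₗ[F] (Fin t → F) => φ u ∈ B).card : ℝ) *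
          (Fintype.card F : ℝ) ^ t =
          ballCard F t W * Fintype.card (V →ₗ[F] (Fin t → F)) := by exact_mod_cast hcard
      have hpos : (0 : ℝ) < (Fintype.card F : ℝ) ^ t := by positivity
      rw [mul_div_assoc', eq_div_iff hpos.ne', mul_comm (Fintype.card _ : ℝ), ← hcard']
      simp [B]
    refine (Finset.sum_congr rfl fun e _ => (?_ : _ = _)).trans
      ((Finset.sum_congr rfl fun e _ => hterm e).trans ?_)
    · congr!
    · rw [← Finset.sum_mul, sum_vectorProb, one_mul]
  have hnn : (0 : ℝ) ≤ ballCard F t W / (Fintype.card F : ℝ) ^ t := by positivity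
  obtain ⟨φ, -, hφ⟩ := Finset.exists_le_of_sum_le
    (s := (Finset.univ : Finset (V →ₗ[F] (Fin t → F)))) ⟨0, Finset.mem_univ _⟩
    (f := fun φ => ∑ u ∈ Finset.univ.erase (0 : V),
      noiseProb lam {e : Fin t → F | {i | (φ u + e) i ≠ 0}.ncard ≤ W})
    (g := fun _ => Nat.card V * (ballCard F t W / (Fintype.card F : ℝ) ^ t)) (by
      rw [Finset.sum_comm, Finset.sum_congr rfl hcount, Finset.sum_const, Finset.sum_const,
        nsmul_eq_mul, nsmul_eq_mul, Finset.card_univ, Nat.card_eq_fintype_card]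
      have : ((Finset.univ.erase (0 : V)).card : ℝ) ≤ Fintype.card V := by
        exact_mod_cast Finset.card_le_univ _
      calc _ ≤ (Fintype.card V : ℝ) * (Fintype.card (V →ₗ[F] (Fin t → F)) *
            (ballCard F t W / (Fintype.card F : ℝ) ^ t)) := by gcongr
        _ = _ := by ring)
  exact ⟨φ, (hbound φ).trans (by gcongr)⟩

end noise

/-! ### Error exponent of inner codes below capacity. -/

section innerExponent

/-- With `z = exp x` for small `x`, the left side is at most `1 + lam * (x + x²)` and the right side
at least `1 + (lam + γ) * x`. The choice `x ≤ γ / 2` makes the quadratic term harmless. -/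
theorem exists_chernoff_base {lam γ : ℝ} (h0 : 0 < lam) (h1 : lam < 1) (hγ : 0 < γ) :
    ∃ z : ℝ, 1 < z ∧ 1 - lam + lam * z < z ^ (lam + γ) := by
  set x := min 1 (γ / 2) with hx
  have hx0 : 0 < x := lt_min one_pos (by linarith)
  have hx1 : x ≤ 1 := min_le_left _ _
  have hx2 : x ≤ γ / 2 := min_le_right _ _
  refine ⟨Real.exp x, Real.one_lt_exp_iff.mpr hx0, ?_⟩
  have h2 := (abs_le.mp (Real.abs_exp_sub_one_sub_id_le (x := x) (by rw [abs_of_pos hx0]; exact hx1))).2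
  rw [← Real.exp_mul]
  have h3 := Real.add_one_le_exp (x * (lam + γ))
  have h4 : lam * Real.exp x ≤ lam * (1 + x + x ^ 2) :=
    mul_le_mul_of_nonneg_left (by linarith) h0.le
  nlinarith [mul_pos hx0 h0, mul_pos hx0 hγ, mul_pos (mul_pos hx0 hx0) h0,
    mul_le_mul_of_nonneg_left hx2 hx0.le, mul_lt_mul_of_pos_right h1 (mul_pos hx0 hx0)]

/-- In this form the entropy is the exponent given by `ballCard_mul_le` at radius `lam * t`. -/
theorem qEntropy_eq {q : ℕ} (hq : 1 < q) {lam : ℝ} (h0 : 0 < lam) (h1 : lam < 1) :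
    qEntropy q lam = -Real.logb q (1 - lam) -
      lam * Real.logb q (lam / ((q : ℝ) - 1) / (1 - lam)) := by
  have hq' : (1 : ℝ) < q := by exact_mod_cast hq
  rw [Real.logb_div (by have : 0 < (q : ℝ) - 1 := by linarith
                        positivity) (by linarith), Real.logb_div h0.ne' (by linarith), qEntropy]
  ring

theorem qEntropy_nonneg {q : ℕ} (hq : 1 < q) {lam : ℝ} (h0 : 0 < lam) (h1 : lam < 1) :
    0 ≤ qEntropy q lam := by
  have hq' : (1 : ℝ) < q := by exact_mod_cast hq
  have hq2 : (2 : ℝ) ≤ q := by exact_mod_cast hq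
  have e1 := Real.logb_nonpos hq' h0.le h1.le
  have e2 := Real.logb_nonpos hq' (x := 1 - lam) (by linarith) (by linarith)
  have e3 := Real.logb_nonneg hq' (x := (q : ℝ) - 1) (by linarith)
  unfold qEntropy
  nlinarith [mul_nonneg h0.le (neg_nonneg.mpr e1), mul_nonneg (sub_pos.mpr h1).le
    (neg_nonneg.mpr e2), mul_nonneg h0.le e3]

variable {F : Type*} [Field F] [Fintype F] {lam ε : ℝ}

theorem lam_lt_one (hlam : lam ∈ Set.Ioo 0 (1 - 1 / (Fintype.card F : ℝ))) : lam < 1 := by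
  have := one_lt_card_real F
  have h2 : 0 < 1 / (Fintype.card F : ℝ) := by positivity
  linarith [hlam.2]

theorem likelihood_ratio_lt_one (hlam : lam ∈ Set.Ioo 0 (1 - 1 / (Fintype.card F : ℝ))) :
    lam / ((Fintype.card F : ℝ) - 1) / (1 - lam) < 1 := by
  have hq := one_lt_card_real F
  have h1 := lam_lt_one hlam
  have h2 := hlam.2
  have h3 : (Fintype.card F : ℝ) * (1 / (Fintype.card F : ℝ)) = 1 := by field_simp
  rw [div_div, div_lt_one (mul_pos (by linarith) (by linarith))]
  nlinarith

set_option maxHeartbeats 1000000 in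
/-- Linear codes of rate `ε` below capacity with exponentially small error probability. -/
theorem exists_innerCode (hlam : lam ∈ Set.Ioo 0 (1 - 1 / (Fintype.card F : ℝ)))
    (hε : ε ∈ Set.Ioo 0 (1 - qEntropy (Fintype.card F) lam)) :
    ∃ δ : ℝ, 0 < δ ∧ ∃ T : ℕ, ∀ t ≥ T, ∀ (V : Type*) [AddCommGroup V] [Module F V] [Finite V],
      Nat.card V = Fintype.card F ^ ⌊ε * t⌋₊ →
      ∃ (W : ℕ) (φ : V →ₗ[F] (Fin t → F)),
        noiseProb lam (goodNoise φ W)ᶜ ≤ (Fintype.card F : ℝ) ^ (-(δ * t)) := by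
  set q : ℝ := (Fintype.card F : ℝ) with hqdef
  have hq : 1 < q := one_lt_card_real F
  have hq0 : 0 < q := by linarith
  have hl0 := hlam.1
  have hl1 := lam_lt_one hlam
  have hr1 := likelihood_ratio_lt_one hlam
  set r : ℝ := lam / (q - 1) / (1 - lam) with hr
  have hr0 : 0 < r := div_pos (div_pos hl0 (by linarith)) (by linarith)
  have hH : qEntropy (Fintype.card F) lam = -Real.logb q (1 - lam) - lam * Real.logb q r :=
    qEntropy_eq Fintype.one_lt_card hl0 hl1
  rw [hH] at hε
  have hL : 0 < -Real.logb q r := neg_pos.mpr (Real.logb_neg hq hr0 hr1)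
  set g : ℝ := 1 - ε - (-Real.logb q (1 - lam) - lam * Real.logb q r) with hg
  have hg0 : 0 < g := by linarith [hε.2]
  -- Here `g` is the gap to capacity. Enlarging the radius from `lam * t` to `(lam + γ) * t` raises
  -- the exponent of the ball by `γ * -logb q r = g / 2`, half of the gap.
  set γ : ℝ := g / (2 * -Real.logb q r) with hγ
  have hγ0 : 0 < γ := by positivity
  have hγL : γ * Real.logb q r = -(g / 2) := by
    have : Real.logb q r ≠ 0 := by linarith
    rw [hγ]; field_simp
  obtain ⟨z, hz1, hz⟩ := exists_chernoff_base hl0 hl1 hγ0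
  set θ := lam + γ with hθ
  have hz0 : 0 < z := by linarith
  have hnum : 0 < 1 - lam + lam * z := by nlinarith
  set η : ℝ := (1 - lam + lam * z) / z ^ θ with hη
  have hη0 : 0 < η := by positivity
  have hη1 : η < 1 := by rw [hη, div_lt_one (by positivity)]; exact hz
  have hβ : 0 < -Real.logb q η := neg_pos.mpr (Real.logb_neg hq hη0 hη1)
  set δ := min (-Real.logb q η) (g / 2) / 2 with hδ
  have hδ0 : 0 < δ := by
    have := lt_min hβ (half_pos hg0)
    rw [hδ]; linarith
  have hδ1 : 2 * δ ≤ -Real.logb q η := by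
    have := min_le_left (-Real.logb q η) (g / 2)
    rw [hδ]; linarith
  have hδ2 : 2 * δ ≤ g / 2 := by
    have := min_le_right (-Real.logb q η) (g / 2)
    rw [hδ]; linarith
  -- Both failure events get the exponent `2 * δ`. As soon as `δ * t ≥ 1`, the factor 2 from adding
  -- them is at most `q ^ (δ * t)`.
  refine ⟨δ, hδ0, ⌈1 / δ⌉₊, fun t ht V _ _ _ hV => ?_⟩
  have ht' : 1 ≤ δ * t := by
    have : 1 / δ ≤ t := (Nat.le_ceil _).trans (by exact_mod_cast ht)
    rwa [div_le_iff₀ hδ0, mul_comm] at this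
  have hθ0 : 0 ≤ θ * t := by positivity
  refine ⟨⌊θ * t⌋₊, ?_⟩
  obtain ⟨φ, hφ⟩ := exists_linearMap_noiseProb_le (F := F) hl0 hl1 V t ⌊θ * t⌋₊
  refine ⟨φ, hφ.trans ?_⟩
  have htail : noiseProb lam {e : Fin t → F | ⌊θ * t⌋₊ + 1 ≤ {i | e i ≠ 0}.ncard} ≤
      q ^ (-(2 * δ * t)) := by
    refine (noiseProb_weight_le hl0 hl1 hz1.le t _).trans ?_
    have h1 : z ^ (θ * t) ≤ z ^ (⌊θ * t⌋₊ + 1) := by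
      rw [← Real.rpow_natCast z]
      exact Real.rpow_le_rpow_of_exponent_le hz1.le
        (by push_cast; exact (Nat.lt_floor_add_one _).le)
    have h2 : (z ^ (⌊θ * t⌋₊ + 1))⁻¹ * (1 - lam + lam * z) ^ t ≤ η ^ t := by
      have h3 : (z ^ (⌊θ * t⌋₊ + 1))⁻¹ ≤ (z ^ (θ * t))⁻¹ := by gcongr
      refine (mul_le_mul_of_nonneg_right h3 (by positivity)).trans (le_of_eq ?_)
      rw [hη, div_pow, Real.rpow_mul hz0.le, Real.rpow_natCast]
      field_simp
    refine h2.trans ?_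
    rw [← Real.rpow_natCast η, ← Real.rpow_logb hq0 hq.ne' hη0, ← Real.rpow_mul hq0.le]
    refine Real.rpow_le_rpow_of_exponent_le hq.le ?_
    nlinarith [(Nat.cast_nonneg t : (0 : ℝ) ≤ t)]
  have hball : (Nat.card V : ℝ) * (ballCard F t ⌊θ * t⌋₊ / q ^ t) ≤ q ^ (-(2 * δ * t)) := by
    have h1 := ballCard_mul_le hl0 hl1 hr1.le t ⌊θ * t⌋₊
    rw [← hr] at h1
    have h2 : r ^ (θ * t) ≤ r ^ ⌊θ * t⌋₊ := by
      rw [← Real.rpow_natCast r]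
      exact Real.rpow_le_rpow_of_exponent_ge hr0 hr1.le (Nat.floor_le hθ0)
    have hl : 0 < 1 - lam := by linarith
    have h3 : (ballCard F t ⌊θ * t⌋₊ : ℝ) ≤ ((1 - lam) ^ t * r ^ (θ * t))⁻¹ := by
      rw [← one_div, le_div_iff₀ (by positivity)]
      refine le_trans ?_ h1
      gcongr
    have h4 : (Nat.card V : ℝ) ≤ q ^ (ε * t) := by
      rw [hV, Nat.cast_pow, ← hqdef, ← Real.rpow_natCast q]
      exact Real.rpow_le_rpow_of_exponent_le hq.le
        (Nat.floor_le (mul_nonneg hε.1.le (Nat.cast_nonneg t)))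
    have h5 : ((1 - lam) ^ t * r ^ (θ * t))⁻¹ =
        q ^ (-(t * Real.logb q (1 - lam) + θ * t * Real.logb q r)) := by
      rw [Real.rpow_neg hq0.le, Real.rpow_add hq0]
      congr 2
      · rw [mul_comm (t : ℝ), Real.rpow_mul hq0.le, Real.rpow_logb hq0 hq.ne' hl, Real.rpow_natCast]
      · rw [mul_comm (θ * t), Real.rpow_mul hq0.le, Real.rpow_logb hq0 hq.ne' hr0]
    calc (Nat.card V : ℝ) * (ballCard F t ⌊θ * t⌋₊ / q ^ t)
        ≤ q ^ (ε * t) * (q ^ (-(t * Real.logb q (1 - lam) + θ * t * Real.logb q r)) / q ^ t) := by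
          rw [← h5]; gcongr
      _ = q ^ (ε * t + -(t * Real.logb q (1 - lam) + θ * t * Real.logb q r) - t) := by
          rw [Real.rpow_sub hq0, Real.rpow_add hq0, Real.rpow_natCast, mul_div_assoc]
      _ ≤ q ^ (-(2 * δ * t)) := by
          refine Real.rpow_le_rpow_of_exponent_le hq.le ?_
          have h6 : ε * t + -(t * Real.logb q (1 - lam) + θ * t * Real.logb q r) - t =
              -(g / 2) * t := by
            rw [hθ]
            linear_combination (-(t : ℝ)) * hγL - (t : ℝ) * hg
          rw [h6]
          nlinarith [(Nat.cast_nonneg t : (0 : ℝ) ≤ t)]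
  calc _ ≤ q ^ (-(2 * δ * t)) + q ^ (-(2 * δ * t)) := add_le_add htail hball
    _ = 2 * (q ^ (-(δ * t)) * q ^ (-(δ * t))) := by
        rw [← Real.rpow_add hq0, ← two_mul]; congr 2; ring
    _ ≤ q ^ (-(δ * t)) := by
        have h7 : q ^ (-(δ * t)) ≤ q ^ (-1 : ℝ) :=
          Real.rpow_le_rpow_of_exponent_le hq.le (by linarith)
        have h8 : q ^ (-1 : ℝ) ≤ 1 / 2 := by
          rw [Real.rpow_neg_one, ← one_div]
          exact one_div_le_one_div_of_le two_pos (two_le_card_real F)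
        have h9 : 0 < q ^ (-(δ * t)) := Real.rpow_pos_of_pos hq0 _
        nlinarith

end innerExponent

/-! ### Concatenated codes and their decoder -/

section concatenated

open Polynomial

theorem mem_evalCode {E : Type*} [Field E] {n K : ℕ} {a v c : Fin n → E} :
    c ∈ evalCode a v K ↔ ∃ f : E[X], f.degree < K ∧ ∀ i, c i = v i * f.eval (a i) := by
  simp only [evalCode, Submodule.mem_map, mem_degreeLT]
  constructor
  · rintro ⟨f, hf, rfl⟩
    exact ⟨f, hf, fun i => by simp [leval]⟩
  · rintro ⟨f, hf, h⟩
    exact ⟨f, hf, funext fun i => by simp [leval, h]⟩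

/-- The vanishing syndromes of the Reed--Solomon code whose locators are all field elements. -/
theorem sum_mul_pow_eq_zero {E : Type*} [Field E] [Fintype E] {M K : ℕ} (a : Fin M ≃ E)
    {u : Fin M → E} (hu : u ∈ evalCode a (fun _ => 1) K) {j : ℕ} (hj : j + K < M) :
    ∑ i, u i * a i ^ j = 0 := by
  obtain ⟨f, hf, hu⟩ := mem_evalCode.mp hu
  have hM : M = Fintype.card E := by rw [← Fintype.card_congr a, Fintype.card_fin]
  simp only [hu, one_mul]
  rw [Equiv.sum_comp a fun x => f.eval x * x ^ j]
  by_cases hf0 : f = 0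
  · simp [hf0]
  have hdeg := (natDegree_lt_iff_degree_lt hf0).mpr hf
  simp only [eval_eq_sum_range, Finset.sum_mul]
  rw [Finset.sum_comm]
  refine Finset.sum_eq_zero fun l hl => ?_
  have hl' := Finset.mem_range.mp hl
  simp only [mul_assoc, ← pow_add]
  rw [← Finset.mul_sum, FiniteField.sum_pow_lt_card_sub_one E _ (by omega), mul_zero]

variable {F E : Type*} [Field F] [Field E] [Algebra F E] {M t : ℕ}

/-- The blocks of a vector. -/
def block (e : Fin (M * t) → F) (i : Fin M) : Fin t → F := fun j => e (finProdFinEquiv (i, j))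

theorem mem_concatCode {outer : Submodule E (Fin M → E)} {φ : E →ₗ[F] (Fin t → F)}
    {c : Fin (M * t) → F} :
    c ∈ concatCode outer φ ↔ ∃ u ∈ outer, ∀ i, block c i = φ (u i) := by
  simp only [concatCode, Submodule.mem_map, Submodule.restrictScalars_mem]
  constructor
  · rintro ⟨u, hu, rfl⟩
    refine ⟨u, hu, fun i => ?_⟩
    funext j
    simp only [block, LinearMap.pi_apply, LinearMap.comp_apply, LinearMap.proj_apply,
      Equiv.symm_apply_apply]
  · rintro ⟨u, hu, h⟩
    refine ⟨u, hu, funext fun i => ?_⟩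
    have := congrFun (h (finProdFinEquiv.symm i).1) (finProdFinEquiv.symm i).2
    simp only [block, Prod.mk.eta, Equiv.apply_symm_apply] at this
    simp [this]

variable [Fintype E]

open Classical in
/-- The threshold decoder of the inner code. -/
def innerDecode (φ : E →ₗ[F] (Fin t → F)) (W : ℕ) (y : Fin t → F) : E :=
  ∑ u : E, if {j | y j ≠ φ u j}.ncard ≤ W then u else 0

/-- For good noise the sent message is the only one whose codeword lies within distance `W`, so the
defining sum has a single non-zero term. -/
theorem innerDecode_eq {φ : E →ₗ[F] (Fin t → F)} {W : ℕ} {e : Fin t → F}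
    (he : e ∈ goodNoise φ W) (u : E) : innerDecode φ W (φ u + e) = u := by
  classical
  have hset : ∀ u', {j | (φ u + e) j ≠ φ u' j} = {j | (φ (u - u') + e) j ≠ 0} := fun u' => by
    ext j
    simp only [Set.mem_ofPred_eq, Pi.add_apply, map_sub, Pi.sub_apply]
    rw [← sub_ne_zero, add_sub_right_comm]
  rw [innerDecode, Finset.sum_eq_single_of_mem u (Finset.mem_univ u), if_pos]
  · rw [hset, sub_self, map_zero, zero_add]
    exact he.1
  · intro u' _ hu'
    refine if_neg (not_le.mpr ?_)
    rw [hset]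
    exact he.2 (u - u') (sub_ne_zero.mpr hu'.symm)

/-- The syndromes of the word that is found by the inner decoders. -/
def outerSyndrome (φ : E →ₗ[F] (Fin t → F)) (W : ℕ) (a : Fin M → E) (r : ℕ)
    (y : Fin (M * t) → F) : E[X] :=
  ∑ j ∈ Finset.range r, C (∑ i, a i ^ j * innerDecode φ W (block y i)) * X ^ j

theorem outerSyndrome_coeff (φ : E →ₗ[F] (Fin t → F)) (W : ℕ) (a : Fin M → E) {r j : ℕ}
    (hj : j < r) (y : Fin (M * t) → F) : (outerSyndrome φ W a r y).coeff j =
      ∑ i, a i ^ j * innerDecode φ W (block y i) := by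
  simp only [outerSyndrome, finsetSum_coeff, coeff_C_mul, coeff_X_pow]
  simp [hj]

/-- The outer codeword found by the decoder. -/
def outerDecode (φ : E →ₗ[F] (Fin t → F)) (W : ℕ) (a : Fin M → E) (β : ℕ)
    (y : Fin (M * t) → F) (i : Fin M) : E :=
  innerDecode φ W (block y i) -
    sparseDecode Finset.univ a (fun _ => 1) β (outerSyndrome φ W a (2 * β) y) i

/-- The word of inner decisions differs from the outer codeword in at most `β` places. Codewords
have vanishing syndromes, so the syndromes of the decisions are those of the sparse difference. -/
theorem outerDecode_eq {φ : E →ₗ[F] (Fin t → F)} {W β K : ℕ} (a : Fin M ≃ E) (hβ : 1 ≤ β)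
    (hK : 2 * β + K ≤ M) {u : Fin M → E} (hu : u ∈ evalCode a (fun _ => 1) K)
    {c e : Fin (M * t) → F} (hc : ∀ i, block c i = φ (u i))
    (he : {i | block e i ∉ goodNoise φ W}.ncard ≤ β) (i : Fin M) :
    outerDecode φ W a β (c + e) i = u i := by
  have hgood : ∀ i, block e i ∈ goodNoise φ W → innerDecode φ W (block (c + e) i) = u i := by
    intro i hi
    rw [← innerDecode_eq hi (u i), ← hc i]
    rfl
  rw [outerDecode, sparseDecode_eq hβ (e := fun i => innerDecode φ W (block (c + e) i) - u i)
    a.injective (fun _ => one_ne_zero) (fun _ => Finset.mem_univ _)]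
  · ring
  · refine (Set.ncard_le_ncard ?_ (Set.toFinite _)).trans he
    intro i hi hb
    exact hi (by simp only [hgood i hb, sub_self])
  · intro j hj
    rw [outerSyndrome_coeff _ _ _ hj, ← sub_eq_zero, ← Finset.sum_sub_distrib,
      ← sum_mul_pow_eq_zero a hu (j := j) (by omega)]
    refine Finset.sum_congr rfl fun i _ => ?_
    ring

/-! ### Operation count of the concatenated decoder. -/

section cost

variable {pb : PowerBasis F E} {Φ : Set (Val (Fin (M * t) → F) F)}

theorem computes_innerDecode (φ : E →ₗ[F] (Fin t → F)) (W : ℕ) (i : Fin M)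
    (hΦ : ∀ l, (.inl fun y : Fin (M * t) → F => y l) ∈ Φ) :
    CompK pb Φ (Fintype.card E * (3 * t + 3 + 4 * opCost pb) + opCost pb)
      fun y => innerDecode φ W (block y i) := by
  classical
  refine Computes.mono_cost (CompK.sum (c := 3 * t + 3 + 3 * opCost pb) Finset.univ fun u _ => ?_)
    (by rw [Finset.card_univ]; ring_nf; rfl)
  have hsum := CompR.sum (Φ := Φ) (c := 2) Finset.univ
    (f := fun j (y : Fin (M * t) → F) => ind (fun y => block y i j = φ u j) y)
    fun j _ => CompR.eq (.of_mem (hΦ (finProdFinEquiv (i, j)))) (CompF.const (φ u j))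
  rw [Finset.card_univ, Fintype.card_fin] at hsum
  -- Agreements are counted, rather than disagreements: the distance is at most `W` if and only if
  -- there are at least `t - W` agreements.
  have hcond : CompR Φ (3 * t + 3) (ind fun y => {j | block y i j ≠ φ u j}.ncard ≤ W) := by
    refine (((CompR.const ((t : ℝ) - W)).le hsum).mono_cost (by omega)).mono_right (le_of_eq ?_)
    congr 3
    funext y
    have h1 : {j | block y i j = φ u j}.ncard + {j | block y i j ≠ φ u j}.ncard = t := by
      have := Set.ncard_add_ncard_compl {j | block y i j = φ u j}
      rwa [Nat.card_fin] at this
    have h2 : ∑ j, ind (fun y => block y i j = φ u j) y =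
        ({j | block y i j = φ u j}.ncard : ℝ) := by
      simp only [ind]
      rw [Finset.sum_boole, ← Set.ncard_coe_finset]
      simp
    rw [h2]
    apply propext
    rw [sub_le_iff_le_add, ← Nat.cast_add, Nat.cast_le]
    omega
  have hite := CompK.ite (pb := pb) hcond (CompK.const u) (CompK.const 0)
  convert hite.mono_cost (c' := 3 * t + 3 + 3 * opCost pb) (by omega)

theorem computes_outerDecode (φ : E →ₗ[F] (Fin t → F)) (W : ℕ) (a : Fin M → E) {β : ℕ}
    (hβ : 1 ≤ β) (hΦ : ∀ l, (.inl fun y : Fin (M * t) → F => y l) ∈ Φ) :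
    Computes Φ (M * (Fintype.card E * (3 * t + 3 + 4 * opCost pb) + opCost pb) +
      (2 * β * (M * (3 * opCost pb) + opCost pb) +
      (500 * ((β ^ 2 + M * β + M * Fintype.card E) * opCost pb) + M * opCost pb)))
      (⋃ i, coords pb fun y => outerDecode φ W a β y i) := by
  have h1 := Computes.iUnion fun i => computes_innerDecode (pb := pb) φ W i hΦ
  rw [Fintype.card_fin] at h1
  refine h1.bind fun Φ₁ _ hd => ?_
  rw [Set.iUnion_subset_iff] at hd
  have h2 : Computes Φ₁ (2 * β * (M * (3 * opCost pb) + opCost pb))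
      (polyVals pb (2 * β) (outerSyndrome φ W a (2 * β))) := by
    refine computes_polyVals fun j hj => ?_
    simp only [outerSyndrome_coeff _ _ _ hj]
    have := CompK.linear (Φ := Φ₁) Finset.univ (fun i => a i ^ j) fun i _ => hd i
    rwa [Finset.card_univ, Fintype.card_fin] at this
  refine h2.bind fun Φ₂ h₂ hS => ?_
  have h3 := computes_sparseDecode hβ Finset.univ a (fun _ => 1) hS
  rw [Finset.card_univ] at h3
  refine h3.bind fun Φ₃ h₃ he => ?_
  rw [Set.iUnion_subset_iff] at he
  have h4 := Computes.iUnion (ι := Fin M) (Φ := Φ₃) (c := opCost pb)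
    (Ψ := fun i => coords pb fun y => outerDecode φ W a β y i) fun i =>
    ((CompK.of_subset (((hd i).trans h₂).trans h₃)).sub (.of_subset (he i))).mono_cost (by omega)
  rwa [Fintype.card_fin] at h4

end cost

/-- Inner search, syndromes, sparse decoding and re-encoding each use a number of operations of
order `M² t²`, because one operation in `E` costs at most `10 * t ^ 2` and both `β` and the number
of candidates are at most `M`. -/
theorem exists_concatDecoder [Fintype F] [FiniteDimensional F E] (φ : E →ₗ[F] (Fin t → F)) (W : ℕ)
    (a : Fin M ≃ E) {β K : ℕ} (hβ : 1 ≤ β) (hK : 2 * β + K ≤ M) (hd : Module.finrank F E ≤ t)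
    (ht : 1 ≤ t) :
    ∃ D : Program F, D.length ≤ 20000 * (M * t) ^ 2 ∧
      ∀ c ∈ concatCode (evalCode a (fun _ => 1) K) φ, ∀ e,
        {i | block e i ∉ goodNoise φ W}.ncard ≤ β → D.output (c + e) (M * t) = c := by
  let pb := Field.powerBasisOfFiniteOfSeparable F E
  have hdim : pb.dim ≤ t := by rw [← pb.finrank]; exact hd
  have hM : Fintype.card E = M := by rw [← Fintype.card_congr a, Fintype.card_fin]
  have hcomp := computes_outerDecode (pb := pb) φ W a hβ
    (fun l => inputMemory_mem_registerVals (F := F) (m := M * t) l)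
  have hout : Computes (registerVals (inputMemory (F := F) (m := M * t))) _ _ :=
    hcomp.bind (c' := M * t * (pb.dim * 3 + 1))
      (Θ := ⋃ l : Fin (M * t), {.inl fun y => φ (outerDecode φ W a β y
        (finProdFinEquiv.symm l).1) (finProdFinEquiv.symm l).2}) fun Φ' _ h => by
      rw [Set.iUnion_subset_iff] at h
      have := Computes.iUnion (ι := Fin (M * t)) (Φ := Φ') (c := pb.dim * 3 + 1)
        (Ψ := fun l => {.inl fun y => φ (outerDecode φ W a β y
        (finProdFinEquiv.symm l).1) (finProdFinEquiv.symm l).2}) fun l =>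
        (CompF.functional (LinearMap.proj (finProdFinEquiv.symm l).2 ∘ₗ φ)
          (CompK.of_subset (h (finProdFinEquiv.symm l).1))).mono_cost (by omega)
      rwa [Fintype.card_fin] at this
  obtain ⟨D, hD, hD'⟩ := hout.exists_program
    (fun l y => φ (outerDecode φ W a β y (finProdFinEquiv.symm l).1) (finProdFinEquiv.symm l).2)
    (fun l => Set.mem_iUnion.mpr ⟨l, rfl⟩)
  refine ⟨D, hD.trans ?_, fun c hc e he => ?_⟩
  · rw [hM]
    set κ := opCost pb with hκ
    have hκ' : κ ≤ 10 * t ^ 2 := by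
      rw [hκ, opCost]; gcongr
    have hβM : β ≤ M := by omega
    have hM1 : 1 ≤ M := by omega
    have hβ2 : β ^ 2 ≤ M ^ 2 := by gcongr
    calc _ ≤ M * (M * (3 * t ^ 2 + 3 * t ^ 2 + 4 * (10 * t ^ 2)) + M * (10 * t ^ 2)) +
          (2 * M * (M * (3 * (10 * t ^ 2)) + M * (10 * t ^ 2)) +
          (500 * ((M ^ 2 + M * M + M * M) * (10 * t ^ 2)) + M * M * (10 * t ^ 2))) +
          M * M * t * (t * 3 + t) + 2 * (M * M * (t * t)) := by
            have ht2 : t ≤ t ^ 2 := Nat.le_self_pow two_ne_zero t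
            have h3 : 3 ≤ 3 * t ^ 2 := by nlinarith
            have h4 : M ≤ M * M := Nat.le_mul_self M
            have h5 : κ ≤ M * (10 * t ^ 2) := hκ'.trans (Nat.le_mul_of_pos_left _ hM1)
            have h6 : M * t ≤ M * M * (t * t) := by
              rw [mul_mul_mul_comm]; exact Nat.le_mul_self _
            gcongr
      _ ≤ 20000 * (M * t) ^ 2 := by ring_nf; nlinarith [Nat.zero_le (M ^ 2 * t ^ 2)]
  · obtain ⟨u, hu, hcu⟩ := mem_concatCode.mp hc
    rw [hD']
    funext l
    rw [outerDecode_eq a hβ hK hu hcu he, ← hcu]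
    simp only [block, Prod.mk.eta, Equiv.apply_symm_apply]

/-- The probability that many inner decoders fail. -/
theorem noiseProb_bad_blocks_le [Fintype F] {lam : ℝ} (h0 : 0 < lam) (h1 : lam < 1)
    (G : Set (Fin t → F)) {P : ℝ} (hP0 : 0 < P) (hP1 : P ≤ 1) (hG : noiseProb lam Gᶜ ≤ P)
    (M j : ℕ) :
    noiseProb lam {e : Fin (M * t) → F | j ≤ {i | block e i ∉ G}.ncard} ≤ P ^ j * 2 ^ M := by
  classical
  -- With `z = 1 / P` in the exponential Markov inequality, a bad block contributes at most 1 and a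
  -- good one at most 1 to the base, whence the factor `2 ^ M`.
  have hz : 1 ≤ P⁻¹ := (one_le_inv₀ hP0).mpr hP1
  have hmain := sum_prod_bad_le (ι := Fin M) (fun a : Fin t → F => (vectorProb_pos h0 h1 a).le)
    (fun a => a ∉ G) hz j
  let eqv : (Fin (M * t) → F) ≃ (Fin M → Fin t → F) :=
    (Equiv.arrowCongr finProdFinEquiv.symm (Equiv.refl F)).trans (Equiv.curry _ _ _)
  have hblock : ∀ e i, eqv e i = block e i := fun e i => rfl
  have hprod : ∀ e : Fin (M * t) → F, vectorProb lam e = ∏ i, vectorProb lam (block e i) := by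
    intro e
    simp only [vectorProb, block]
    rw [← Equiv.prod_comp finProdFinEquiv, Fintype.prod_prod_type]
  have hsum : noiseProb lam {e : Fin (M * t) → F | j ≤ {i | block e i ∉ G}.ncard} =
      ∑ f : Fin M → Fin t → F, if j ≤ {i | f i ∉ G}.ncard then ∏ i, vectorProb lam (f i) else 0 := by
    rw [noiseProb_eq, ← Equiv.sum_comp eqv]
    refine Finset.sum_congr rfl fun e _ => ?_
    simp only [hblock, hprod e]
    congr 1
  rw [hsum]
  refine hmain.trans ?_
  rw [Fintype.card_fin, inv_pow, inv_inv]
  gcongr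
  · exact Finset.sum_nonneg fun a _ => mul_nonneg (vectorProb_pos h0 h1 a).le
      (by split_ifs <;> positivity)
  · have hsplit : ∑ a : Fin t → F, (vectorProb lam a * if a ∉ G then P⁻¹ else 1) =
        noiseProb lam Gᶜ * P⁻¹ + noiseProb lam G := by
      rw [noiseProb_eq, noiseProb_eq, Finset.sum_mul, ← Finset.sum_add_distrib]
      refine Finset.sum_congr rfl fun a _ => ?_
      by_cases ha : a ∈ G <;> simp [ha]
    refine le_of_eq_of_le (b := noiseProb lam Gᶜ * P⁻¹ + noiseProb lam G) (by convert hsplit) ?_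
    have h2 : noiseProb lam Gᶜ * P⁻¹ ≤ 1 := by
      rw [← div_eq_mul_inv, div_le_one hP0]; exact hG
    have h3 : 0 ≤ noiseProb lam Gᶜ := by
      rw [noiseProb_eq]
      exact Finset.sum_nonneg fun e _ => by
        split_ifs
        · exact (vectorProb_pos h0 h1 e).le
        · exact le_rfl
    have h4 := noiseProb_add_compl (lam := lam) G
    linarith

end concatenated

/-! ### Existence of the family of concatenated codes. -/

section conCode

open Polynomial

/-- Extensions of finite fields of any degree, in the same universe. -/
theorem exists_field_extension.{u} (F : Type u) [Field F] [Finite F] {k : ℕ} (hk : k ≠ 0) :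
    ∃ (E : Type u) (_ : Field E) (_ : Algebra F E), Finite E ∧ Module.finrank F E = k ∧
      Nat.card E = Nat.card F ^ k := by
  obtain ⟨p, _⟩ := CharP.exists F
  have : Fact p.Prime := ⟨CharP.char_is_prime F p⟩
  have : NeZero k := ⟨hk⟩
  refine ⟨ULift.{u} (FiniteField.Extension F p k), inferInstance, inferInstance,
    inferInstance, ?_, ?_⟩
  · rw [LinearEquiv.finrank_eq (ULift.moduleEquiv : ULift _ ≃ₗ[F] FiniteField.Extension F p k),
      FiniteField.finrank_extension]
  · rw [Nat.card_congr Equiv.ulift, FiniteField.natCard_extension]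

theorem finrank_evalCode {E : Type*} [Field E] {n K : ℕ} {a v : Fin n → E}
    (ha : Function.Injective a) (hv : ∀ i, v i ≠ 0) (hK : K ≤ n) :
    Module.finrank E (evalCode a v K) = K := by
  set g : E[X] →ₗ[E] (Fin n → E) := LinearMap.pi fun j => v j • leval (a j) with hg
  have hrange : evalCode a v K = LinearMap.range (g ∘ₗ (degreeLT E K).subtype) := by
    rw [LinearMap.range_comp, Submodule.range_subtype]; rfl
  rw [hrange, LinearMap.finrank_range_of_inj, (degreeLTEquiv E K).finrank_eq,
    Module.finrank_fin_fun]
  rw [← LinearMap.ker_eq_bot, LinearMap.ker_eq_bot']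
  rintro ⟨f, hf⟩ h
  rw [mem_degreeLT] at hf
  ext1
  refine eq_zero_of_degree_lt_of_eval_index_eq_zero (s := Finset.univ) (v := a) ha.injOn
    (hf.trans_le (by simpa using hK)) fun i _ => ?_
  have := congrFun h i
  simpa [hg, leval, hv i] using this

theorem finrank_concatCode {F E : Type*} [Field F] [Field E] [Algebra F E]
    [FiniteDimensional F E] {M t : ℕ} (outer : Submodule E (Fin M → E)) {φ : E →ₗ[F] (Fin t → F)}
    (hφ : Function.Injective φ) :
    Module.finrank F (concatCode outer φ) = Module.finrank F E * Module.finrank E outer := by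
  rw [Module.finrank_mul_finrank F E outer, concatCode]
  refine (LinearEquiv.finrank_eq (Submodule.equivMapOfInjective _ ?_ _)).symm.trans ?_
  · rw [← LinearMap.ker_eq_bot, LinearMap.ker_eq_bot']
    intro u hu
    funext i
    refine hφ (funext fun j => ?_)
    have := congrFun hu (finProdFinEquiv (i, j))
    simpa only [LinearMap.pi_apply, LinearMap.comp_apply, LinearMap.proj_apply,
      Equiv.symm_apply_apply, Pi.zero_apply, map_zero] using this
  · rfl

/-- A non-zero kernel vector would give `W < wt(e) ≤ W` for good noise `e`. -/
theorem injective_of_goodNoise_nonempty {F V : Type*} [Field F] [AddCommGroup V] [Module F V]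
    {t W : ℕ} {φ : V →ₗ[F] (Fin t → F)} (h : (goodNoise φ W).Nonempty) : Function.Injective φ := by
  obtain ⟨e, he⟩ := h
  rw [← LinearMap.ker_eq_bot, LinearMap.ker_eq_bot']
  intro u hu
  by_contra hu0
  have := he.2 u hu0
  rw [hu, zero_add] at this
  exact absurd he.1 (not_le.mpr this)

/-- The concatenated code of an inner code with small error probability. -/
theorem exists_isConCode_of_inner.{u} {F : Type u} [Field F] [Fintype F] {lam ε ρ δ : ℝ}
    (h0 : 0 < lam) (h1 : lam < 1) (hρ : ρ ∈ Set.Ioo (0 : ℝ) 1) (hδ : 0 < δ) {t : ℕ} (ht : 3 ≤ t)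
    (htδ : 4 ≤ δ * (1 - ρ) * t) (hk : 3 ≤ (1 - ρ) * ⌊ε * t⌋₊)
    (hinner : ∀ (V : Type u) [AddCommGroup V] [Module F V] [Finite V],
      Nat.card V = Fintype.card F ^ ⌊ε * t⌋₊ →
      ∃ (W : ℕ) (φ : V →ₗ[F] (Fin t → F)),
        noiseProb lam (goodNoise φ W)ᶜ ≤ (Fintype.card F : ℝ) ^ (-(δ * t))) :
    ∃ C, IsConCode (F := F) lam ε ρ (δ * (1 - ρ) / 4) 20000 t C := by
  set q : ℝ := (Fintype.card F : ℝ) with hqdef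
  have hq : 1 < q := one_lt_card_real F
  have hq2 : 2 ≤ q := two_le_card_real F
  have hq0 : 0 < q := by linarith
  set k := ⌊ε * t⌋₊ with hkdef
  have hk0 : k ≠ 0 := by rintro h; rw [h] at hk; norm_num at hk
  set M := Fintype.card F ^ k with hM
  have hMq : (M : ℝ) = q ^ k := by rw [hM, Nat.cast_pow]
  have hMk : (k : ℝ) ≤ M := by
    exact_mod_cast (Nat.lt_pow_self Fintype.one_lt_card).le
  have hM3 : 3 ≤ (1 - ρ) * M := hk.trans (mul_le_mul_of_nonneg_left hMk (by linarith [hρ.2]))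
  have hM0 : 0 < M := pow_pos Fintype.card_pos _
  set K := ⌈ρ * q ^ k⌉₊ with hK
  have hK1 : (K : ℝ) < ρ * M + 1 := by
    rw [hMq]; exact Nat.ceil_lt_add_one (mul_nonneg hρ.1.le (by positivity))
  have hKM : K + 2 ≤ M := by
    have : (K : ℝ) + 1 < M := by linarith
    exact_mod_cast this
  have hKM' : K ≤ M := by omega
  -- Half the redundancy of the outer code, rounded down. The size of `k` guarantees redundancy at
  -- least 2, hence `β ≥ 1`.
  set β := (M - K) / 2 with hβdef
  have hβ : 1 ≤ β := by omega
  have hβK : 2 * β + K ≤ M := by omega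
  have hβM : (1 - ρ) * M / 2 ≤ ((β + 1 : ℕ) : ℝ) := by
    have h2 : M + 1 ≤ 2 * (β + 1) + K := by omega
    have h3 : (M : ℝ) + 1 ≤ 2 * ((β + 1 : ℕ) : ℝ) + K := by exact_mod_cast h2
    linarith
  have ht0 : (0 : ℝ) < t := by exact_mod_cast (by omega : 0 < t)
  obtain ⟨E, _, _, _, hfr, hcard⟩ := exists_field_extension F hk0
  have := Fintype.ofFinite E
  have hfin : FiniteDimensional F E := Module.finite_of_finrank_pos (by omega)
  have hcardM : Nat.card E = M := by rw [hcard, Nat.card_eq_fintype_card]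
  obtain ⟨W, φ, hφ⟩ := hinner E hcardM
  set P : ℝ := q ^ (-(δ * t)) with hP
  have hP0 : 0 < P := Real.rpow_pos_of_pos hq0 _
  have hP1 : P < 1 := Real.rpow_lt_one_of_one_lt_of_neg hq (by
    have := mul_pos hδ ht0; linarith)
  -- The failure probability is below 1, so some noise is good.
  have hinj : Function.Injective φ := by
    refine injective_of_goodNoise_nonempty (W := W) ?_
    by_contra hne
    rw [Set.not_nonempty_iff_eq_empty] at hne
    have h2 := noiseProb_add_compl (lam := lam) (goodNoise φ W)
    have h3 : noiseProb lam (goodNoise φ W) = 0 := by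
      rw [hne, noiseProb_eq]; simp
    linarith
  have hkt : Module.finrank F E ≤ t := by
    simpa using LinearMap.finrank_le_finrank_of_injective hinj
  let a : Fin M ≃ E := (Fintype.equivFinOfCardEq (by
    rw [← Nat.card_eq_fintype_card, hcardM])).symm
  obtain ⟨D, hD, hDc⟩ := exists_concatDecoder φ W a hβ hβK hkt (by omega)
  have hN : (conLength (Fintype.card F) ε t : ℝ) = M * t := by
    rw [conLength, Nat.cast_mul]
  refine ⟨concatCode (evalCode a (fun _ => 1) K) φ,
    ⟨E, inferInstance, inferInstance, evalCode a (fun _ => 1) K, φ, hcardM, hfr,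
      ⟨hKM', a, fun _ => 1, a.injective, fun _ => one_ne_zero, rfl⟩, hinj, rfl⟩, ?_, D, ?_, ?_⟩
  · have h2 := finrank_concatCode (evalCode a (fun _ => 1) K) hinj
    rw [hfr, finrank_evalCode a.injective (fun _ => one_ne_zero) hKM'] at h2
    exact h2
  · rw [hN]
    have hM1 : (1 : ℝ) ≤ M := by exact_mod_cast hM0
    have ht3 : (3 : ℝ) ≤ t := by exact_mod_cast ht
    -- The decoder uses only `O(N²)` operations. The logarithm is at least 1 and is inserted for
    -- free.
    have hlog : 1 ≤ Real.log (M * t) := by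
      rw [Real.le_log_iff_exp_le (by positivity)]
      have := Real.exp_one_lt_d9
      nlinarith
    have hD' : (D.length : ℝ) ≤ 20000 * ((M : ℝ) * t) ^ 2 := by exact_mod_cast hD
    refine hD'.trans (mul_le_mul_of_nonneg_left ?_ (by norm_num))
    exact le_mul_of_one_le_right (by positivity) hlog
  · intro (c : Fin (M * t) → F) hc
    have hsub : {e : Fin (M * t) → F | β + 1 ≤ {i | block e i ∉ goodNoise φ W}.ncard}ᶜ ⊆
        {e | D.output (c + e) (M * t) = c} := by
      intro e he
      refine hDc c hc e ?_
      simp only [Set.mem_compl_iff, Set.mem_ofPred_eq] at he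
      omega
    refine le_trans ?_ (noiseProb_mono h0 h1 hsub)
    have h2 := noiseProb_add_compl (lam := lam)
      {e : Fin (M * t) → F | β + 1 ≤ {i | block e i ∉ goodNoise φ W}.ncard}
    have h3 := noiseProb_bad_blocks_le h0 h1 (goodNoise φ W) hP0 hP1.le hφ M (β + 1)
    -- At least `(1 - ρ) * M / 2` failures give the exponent `δ * (1 - ρ) * M * t / 2`. Half of it
    -- absorbs `2 ^ M ≤ q ^ M`, since `δ * (1 - ρ) * t ≥ 4`.
    have h4 : P ^ (β + 1) * 2 ^ M ≤ q ^ (-(δ * (1 - ρ) / 4 * (M * t))) := by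
      have h5 : (2 : ℝ) ^ M ≤ q ^ (M : ℝ) := by
        rw [Real.rpow_natCast]; gcongr
      have h6 : P ^ (β + 1) = q ^ (-(δ * t) * ((β + 1 : ℕ) : ℝ)) := by
        rw [hP, Real.rpow_mul hq0.le, Real.rpow_natCast]
      calc P ^ (β + 1) * 2 ^ M ≤ P ^ (β + 1) * q ^ (M : ℝ) := by gcongr
        _ = q ^ (-(δ * t) * ((β + 1 : ℕ) : ℝ) + M) := by rw [h6, Real.rpow_add hq0]
        _ ≤ _ := by
          refine Real.rpow_le_rpow_of_exponent_le hq.le ?_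
          have h7 : δ * t * ((1 - ρ) * M / 2) ≤ δ * t * ((β + 1 : ℕ) : ℝ) :=
            mul_le_mul_of_nonneg_left hβM (by positivity)
          have h8 : 4 * (M : ℝ) ≤ δ * (1 - ρ) * t * M :=
            mul_le_mul_of_nonneg_right htδ (by positivity)
          linarith
    rw [← hN] at h4
    have h5 : 1 - q ^ (-(δ * (1 - ρ) / 4 * (conLength (Fintype.card F) ε t : ℝ))) ≤ noiseProb lam
        {e : Fin (M * t) → F | β + 1 ≤ {i | block e i ∉ goodNoise φ W}.ncard}ᶜ := by linarith
    exact h5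

/-- The family of good concatenated codes. -/
theorem exists_isConCode.{u} {F : Type u} [Field F] [Fintype F] {lam ε ρ : ℝ}
    (hlam : lam ∈ Set.Ioo 0 (1 - 1 / (Fintype.card F : ℝ)))
    (hρ : ρ ∈ Set.Ioo (0 : ℝ) 1)
    (hε : ε ∈ Set.Ioo 0 (1 - qEntropy (Fintype.card F) lam)) :
    ∃ a : ℝ, 0 < a ∧ ∃ T : ℕ, ∀ t ≥ T, ∃ C, IsConCode (F := F) lam ε ρ a 20000 t C := by
  obtain ⟨δ, hδ, T, hT⟩ := exists_innerCode.{u, u} hlam hε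
  have hρ1 : 0 < 1 - ρ := by linarith [hρ.2]
  refine ⟨δ * (1 - ρ) / 4, by positivity,
    max (max T 3) (max ⌈4 / (δ * (1 - ρ))⌉₊ ⌈(3 / (1 - ρ) + 1) / ε⌉₊), fun t ht => ?_⟩
  simp only [ge_iff_le, max_le_iff, Nat.ceil_le] at ht
  obtain ⟨⟨ht1, ht2⟩, ht3, ht4⟩ := ht
  refine exists_isConCode_of_inner hlam.1 (lam_lt_one hlam) hρ hδ ht2 ?_ ?_ (hT t ht1)
  · rw [div_le_iff₀ (by positivity)] at ht3
    linarith
  · rw [div_le_iff₀ hε.1] at ht4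
    have h1 := Nat.lt_floor_add_one (ε * t)
    have h2 : 3 / (1 - ρ) ≤ ⌊ε * t⌋₊ := by linarith
    rw [div_le_iff₀ hρ1] at h2
    linarith

end conCode

/-! ### Parity checks of Reed--Solomon codes -/

section parity

open Polynomial

variable {L : Type*} [Field L] {n : ℕ}

/-- The weights of the dual of a Reed--Solomon code. -/
def dualWeight (a : Fin n → L) (i : Fin n) : L := (∏ j ∈ Finset.univ.erase i, (a i - a j))⁻¹

theorem dualWeight_ne_zero {a : Fin n → L} (ha : Function.Injective a) (i : Fin n) :
    dualWeight a i ≠ 0 :=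
  inv_ne_zero (Finset.prod_ne_zero_iff.mpr fun _ hj =>
    sub_ne_zero.mpr fun h => (Finset.ne_of_mem_erase hj) (ha h).symm)

/-- The sum is the coefficient of `X ^ (n - 1)` in Lagrange's interpolation formula. -/
theorem sum_dualWeight_mul_eval {a : Fin n → L} (ha : Function.Injective a) {f : L[X]}
    (hf : f.degree < n) : ∑ i, dualWeight a i * f.eval (a i) = f.coeff (n - 1) := by
  have := Lagrange.coeff_eq_sum (s := Finset.univ) (v := a) ha.injOn (P := f) (by simpa using hf)
  rw [Finset.card_univ, Fintype.card_fin] at this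
  rw [this]
  exact Finset.sum_congr rfl fun i _ => by rw [dualWeight, div_eq_mul_inv, mul_comm]

/-- The summands are dual weights times values of `f * X ^ j`, whose degree is below `n - 1`, so the
coefficient of `X ^ (n - 1)` vanishes. -/
theorem evalCode_syndrome {a v : Fin n → L} (ha : Function.Injective a) (hv : ∀ i, v i ≠ 0)
    {r : ℕ} {c : Fin n → L} (hc : c ∈ evalCode a v (n - r)) {j : ℕ} (hj : j < r) :
    ∑ i, dualWeight a i / v i * c i * a i ^ j = 0 := by
  obtain ⟨f, hf, hc⟩ := mem_evalCode.mp hc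
  by_cases hf0 : f = 0
  · simp [hc, hf0]
  have hdeg := (natDegree_lt_iff_degree_lt hf0).mpr hf
  have hnd : (f * X ^ j).natDegree = f.natDegree + j := natDegree_mul_X_pow j hf0
  have hne : f * X ^ j ≠ 0 := mul_ne_zero hf0 (pow_ne_zero _ X_ne_zero)
  have := sum_dualWeight_mul_eval ha (f := f * X ^ j)
    ((natDegree_lt_iff_degree_lt hne).mp (by omega))
  rw [coeff_eq_zero_of_natDegree_lt (by omega)] at this
  rw [← this]
  refine Finset.sum_congr rfl fun i _ => ?_
  rw [hc, eval_mul, eval_pow, eval_X]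
  field_simp [hv i]

/-- If the interpolating polynomial had degree at least `n - r`, some `X ^ j` with `j < r` would
raise it to exactly `n - 1`, and the syndrome of index `j` would be its non-zero leading
coefficient. -/
theorem mem_evalCode_of_syndrome {a : Fin n → L} (ha : Function.Injective a) {r : ℕ}
    {c : Fin n → L} (hc : ∀ j < r, ∑ i, a i ^ j * c i = 0) :
    c ∈ evalCode a (dualWeight a) (n - r) := by
  set f := Lagrange.interpolate Finset.univ a fun i => c i / dualWeight a i with hf
  have hdeg : f.degree < n := by
    have h := Lagrange.degree_interpolate_lt (s := Finset.univ) (v := a)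
      (fun i => c i / dualWeight a i) ha.injOn
    rwa [Finset.card_univ, Fintype.card_fin] at h
  have heval : ∀ i, f.eval (a i) = c i / dualWeight a i := fun i =>
    Lagrange.eval_interpolate_at_node (s := Finset.univ) (v := a) _ ha.injOn (Finset.mem_univ i)
  refine mem_evalCode.mpr ⟨f, ?_, fun i => by
    rw [heval, mul_div_cancel₀ _ (dualWeight_ne_zero ha i)]⟩
  by_cases hf0 : f = 0
  · rw [hf0, degree_zero]; exact WithBot.bot_lt_coe _
  rw [← natDegree_lt_iff_degree_lt hf0] at hdeg ⊢
  by_contra! hlt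
  have hnd : (f * X ^ (n - 1 - f.natDegree)).natDegree = n - 1 := by
    rw [natDegree_mul_X_pow _ hf0]; omega
  have hne : f * X ^ (n - 1 - f.natDegree) ≠ 0 := mul_ne_zero hf0 (pow_ne_zero _ X_ne_zero)
  have h1 := sum_dualWeight_mul_eval ha (f := f * X ^ (n - 1 - f.natDegree))
    ((natDegree_lt_iff_degree_lt hne).mp (by omega))
  have h2 : ∑ i, dualWeight a i * (f * X ^ (n - 1 - f.natDegree)).eval (a i) = 0 := by
    rw [← hc (n - 1 - f.natDegree) (by omega)]
    refine Finset.sum_congr rfl fun i _ => ?_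
    rw [eval_mul, heval, eval_pow, eval_X]
    have := dualWeight_ne_zero ha i
    field_simp
  rw [h2] at h1
  nth_rewrite 2 [← hnd] at h1
  rw [coeff_natDegree, eq_comm, leadingCoeff_eq_zero] at h1
  exact hne h1

theorem isRSParityCheck_vandermonde {a : Fin n → L} (ha : Function.Injective a) {r : ℕ}
    (hr : r ≤ n) : IsRSParityCheck (Matrix.of fun (j : Fin r) i => a i ^ (j : ℕ)) := by
  refine ⟨hr, evalCode a (dualWeight a) (n - r),
    ⟨Nat.sub_le _ _, a, dualWeight a, ha, dualWeight_ne_zero ha, rfl⟩, fun c => ⟨fun hc => ?_, ?_⟩⟩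
  · funext j
    have := evalCode_syndrome ha (dualWeight_ne_zero ha) hc j.2
    simp only [div_self (dualWeight_ne_zero ha _), one_mul] at this
    simpa [Matrix.mulVec, dotProduct, mul_comm] using this
  · intro h
    refine mem_evalCode_of_syndrome ha fun j hj => ?_
    simpa [Matrix.mulVec, dotProduct] using congrFun h ⟨j, hj⟩

end parity

/-! ### Field lifting -/

section lifting

variable {F L : Type*} [Field F] [Field L] [Algebra F L]

/-- Each lifted row is a combination of rows over `F`, so a vector orthogonal to all of these is
orthogonal to it. Only this inclusion of kernels is used, for any `α`. -/
theorem fieldLift_mulVec_algebraMap (α : L) {r s n : ℕ} (A : Matrix (Fin (r * s)) (Fin n) F)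
    {x : Fin n → F} (hx : A *ᵥ x = 0) : fieldLift α A *ᵥ (fun i => algebraMap F L (x i)) = 0 := by
  funext k
  simp only [fieldLift, Matrix.mulVec, dotProduct, Matrix.of_apply, Pi.zero_apply]
  simp only [Finset.sum_mul]
  rw [Finset.sum_comm]
  refine Finset.sum_eq_zero fun t _ => ?_
  have h := congrArg (algebraMap F L) (congrFun hx (finProdFinEquiv (k, t)))
  simp only [Matrix.mulVec, dotProduct, map_sum, map_mul, Pi.zero_apply, map_zero] at h
  rw [← zero_mul (α ^ (t : ℕ)), ← h, Finset.sum_mul]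
  exact Finset.sum_congr rfl fun i _ => by ring

/-- The powers of a primitive element span the extension field. -/
theorem exists_eq_sum_pow [Finite F] {α : L} {s : ℕ} (hs : s ≠ 0) (hfin : Module.finrank F L = s)
    (hα : IsPrimitiveRoot α (Nat.card F ^ s - 1)) (h : L) :
    ∃ w : Fin s → F, h = ∑ t : Fin s, algebraMap F L (w t) * α ^ (t : ℕ) := by
  have : FiniteDimensional F L := Module.finite_of_finrank_pos (by omega)
  have : Finite L := Module.finite_of_finite F
  have := Fintype.ofFinite L
  have hcard : Fintype.card L = Nat.card F ^ s := by
    rw [← Nat.card_eq_fintype_card, Module.natCard_eq_pow_finrank (K := F), hfin]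
  have : NeZero (Nat.card F ^ s - 1) := ⟨by
    have h1 : 1 < Nat.card F ^ s := Nat.one_lt_pow hs Finite.one_lt_card
    omega⟩
  have hadj : Algebra.adjoin F {α} = ⊤ := by
    rw [eq_top_iff]
    rintro y -
    by_cases hy : y = 0
    · rw [hy]; exact zero_mem _
    · have h1 := FiniteField.pow_card_sub_one_eq_one y hy
      rw [hcard] at h1
      obtain ⟨i, -, rfl⟩ := hα.eq_pow_of_pow_eq_one h1
      exact pow_mem (Algebra.self_mem_adjoin_singleton F α) i
  have hint : IsIntegral F α := Algebra.IsIntegral.isIntegral α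
  let pb := PowerBasis.ofAdjoinEqTop' hint hadj
  have hdim : pb.dim = s := by rw [← pb.finrank, hfin]
  have hgen : pb.gen = α := PowerBasis.ofAdjoinEqTop'_gen hint hadj
  refine ⟨fun t => pb.basis.repr h (Fin.cast hdim.symm t), ?_⟩
  conv_lhs => rw [← pb.basis.sum_repr h]
  rw [← Equiv.sum_comp (finCongr hdim)]
  refine Finset.sum_congr rfl fun i _ => ?_
  rw [pb.basis_eq_pow, hgen, Algebra.smul_def]
  rfl

theorem exists_fieldLift_eq [Finite F] {α : L} {s : ℕ} (hs : s ≠ 0)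
    (hfin : Module.finrank F L = s) (hα : IsPrimitiveRoot α (Nat.card F ^ s - 1)) {r n : ℕ}
    (H : Matrix (Fin r) (Fin n) L) :
    ∃ A : Matrix (Fin (r * s)) (Fin n) F, fieldLift α A = H := by
  choose w hw using exists_eq_sum_pow hs hfin hα
  refine ⟨Matrix.of fun kt l => w (H (finProdFinEquiv.symm kt).1 l) (finProdFinEquiv.symm kt).2, ?_⟩
  ext k l
  simp only [fieldLift, Matrix.of_apply, Equiv.symm_apply_apply]
  exact (hw _).symm

/-- Matrices some of whose rows are lifted to a parity check matrix of a Reed--Solomon code. -/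
theorem exists_hasRSRows [Finite F] {α : L} {b s n K : ℕ} (hs : s ≠ 0)
    (hfin : Module.finrank F L = s) (hα : IsPrimitiveRoot α (Nat.card F ^ s - 1))
    (hn : n ≤ Nat.card F ^ s) (hb : 2 * b ≤ n) (hK : 2 * b * s ≤ K) :
    ∃ A : Matrix (Fin K) (Fin n) F, HasRSRows α b s A := by
  have : FiniteDimensional F L := Module.finite_of_finrank_pos (by omega)
  have : Finite L := Module.finite_of_finite F
  have := Fintype.ofFinite L
  have hcard : Fintype.card L = Nat.card F ^ s := by
    rw [← Nat.card_eq_fintype_card, Module.natCard_eq_pow_finrank (K := F), hfin]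
  obtain ⟨a⟩ : Nonempty (Fin n ↪ L) :=
    Function.Embedding.nonempty_of_card_le (by rw [Fintype.card_fin, hcard]; exact hn)
  obtain ⟨A, hA⟩ := exists_fieldLift_eq hs hfin hα
    (Matrix.of fun (j : Fin (2 * b)) i => a i ^ (j : ℕ))
  refine ⟨Matrix.of fun i l => if h : (i : ℕ) < 2 * b * s then A ⟨i, h⟩ l else 0,
    (Fin.castLEEmb hK), ?_⟩
  have : (Matrix.of fun (i : Fin K) l => if h : (i : ℕ) < 2 * b * s then A ⟨i, h⟩ l else 0).submatrix
      (Fin.castLEEmb hK) id = A := by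
    ext i l
    simp
  rw [this, hA]
  exact isRSParityCheck_vandermonde a.injective hb

/-! ### Syndromes as linear functions of the measurements, and the recovery program. -/

theorem exists_factor {V W U : Type*} [AddCommGroup V] [Module F V] [AddCommGroup W] [Module F W]
    [AddCommGroup U] [Module F U] (f : V →ₗ[F] W) (g : V →ₗ[F] U)
    (h : ∀ x, f x = 0 → g x = 0) : ∃ k : W →ₗ[F] U, ∀ x, k (f x) = g x := by
  obtain ⟨σ, hσ⟩ := f.rangeRestrict.exists_rightInverse_of_surjective f.range_rangeRestrict
  obtain ⟨k, hk⟩ := LinearMap.exists_extend (g ∘ₗ σ)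
  refine ⟨k, fun x => ?_⟩
  have h1 : k (f x) = g (σ (f.rangeRestrict x)) := LinearMap.congr_fun hk (f.rangeRestrict x)
  have h2 : f (σ (f.rangeRestrict x)) = f x :=
    congrArg Subtype.val (LinearMap.congr_fun hσ (f.rangeRestrict x))
  rw [h1, ← sub_eq_zero, ← map_sub]
  exact h _ (by rw [map_sub, h2, sub_self])

/-- The syndromes of a sparse vector are determined linearly by its measurements. -/
theorem exists_syndrome_map {α : L} {b s m K n : ℕ} {G : Matrix (Fin m) (Fin K) F}
    {A : Matrix (Fin K) (Fin n) F} (hG : Function.Injective G.mulVec) (hA : HasRSRows α b s A) :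
    ∃ (a v : Fin n → L) (ψ : (Fin m → F) →ₗ[F] (Fin (2 * b) → L)), Function.Injective a ∧
      (∀ i, v i ≠ 0) ∧ ∀ x j, ψ ((G * A) *ᵥ x) j =
        ∑ i, v i * algebraMap F L (x i) * a i ^ (j : ℕ) := by
  obtain ⟨r, -, C, ⟨-, a, v, ha, hv, rfl⟩, hC⟩ := hA
  let g : (Fin n → F) →ₗ[F] (Fin (2 * b) → L) := LinearMap.pi fun j =>
    ∑ i, LinearMap.toSpanSingleton F L (dualWeight a i / v i * a i ^ (j : ℕ)) ∘ₗ LinearMap.proj i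
  have hg : ∀ x j, g x j =
      ∑ i, dualWeight a i / v i * algebraMap F L (x i) * a i ^ (j : ℕ) := fun x j => by
    simp only [g, LinearMap.pi_apply, LinearMap.sum_apply, LinearMap.comp_apply,
      LinearMap.proj_apply, LinearMap.toSpanSingleton_apply, Algebra.smul_def]
    exact Finset.sum_congr rfl fun i _ => by ring
  -- The kernel of `G * A` lies in the Reed–Solomon code, where all syndromes vanish. Hence `ψ`
  -- exists as a fixed linear map, and `G` need not be inverted by the program.
  obtain ⟨ψ, hψ⟩ := exists_factor (G * A).mulVecLin g fun x hx => by
    have h1 : A *ᵥ x = 0 := by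
      refine hG ?_
      rw [Matrix.mulVec_mulVec, Matrix.mulVec_zero]
      exact hx
    have h2 : A.submatrix r id *ᵥ x = 0 := by
      funext k
      exact congrFun h1 (r k)
    have h3 := (hC _).mpr (fieldLift_mulVec_algebraMap α _ h2)
    funext j
    rw [hg]
    exact evalCode_syndrome ha hv h3 j.2
  exact ⟨a, fun i => dualWeight a i / v i, ψ, ha,
    fun i => div_ne_zero (dualWeight_ne_zero ha i) (hv i), fun x j => by
      rw [← hg, ← hψ]; rfl⟩

open Polynomial in
/-- The recovery program: decode, compute the syndromes, decode the syndromes. -/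
theorem exists_recoveryProgram [Fintype F] {α : L} {b s m K n : ℕ} (hb : 1 ≤ b) (hs : s ≠ 0)
    (hfin : Module.finrank F L = s) {G : Matrix (Fin m) (Fin K) F}
    {A : Matrix (Fin K) (Fin n) F} (hG : Function.Injective G.mulVec) (hA : HasRSRows α b s A)
    (D : Program F) :
    ∃ P : Program F, P.length ≤ D.length + 2 * b * (s * (m * 3 + 1)) +
        5000 * ((b ^ 2 + n * b + n * Fintype.card F) * s ^ 2) + n * (s * 3 + 1) + 2 * n ∧
      ∀ x : Fin n → F, {i | x i ≠ 0}.ncard ≤ b → ∀ y : Fin m → F,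
        D.output y m = (G * A) *ᵥ x → P.output y n = x := by
  classical
  have : FiniteDimensional F L := Module.finite_of_finrank_pos (by omega)
  obtain ⟨a, v, ψ, ha, hv, hψ⟩ := exists_syndrome_map hG hA
  let pb := Field.powerBasisOfFiniteOfSeparable F L
  have hdim : pb.dim = s := by rw [← pb.finrank, hfin]
  -- A functional that does not vanish at 1, rescaled, is an `F`-linear retraction of `L` onto `F`.
  -- It turns the decoded entries into field registers.
  obtain ⟨π, hπ⟩ := Module.Projective.exists_dual_ne_zero F (one_ne_zero (α := L))
  let π' : L →ₗ[F] F := (π 1)⁻¹ • π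
  have hπ' : ∀ c : F, π' (algebraMap F L c) = c := fun c => by
    rw [Algebra.algebraMap_eq_smul_one, map_smul]
    simp [π', hπ]
  let S : (Fin m → F) → L[X] := fun y =>
    ∑ j : Fin (2 * b), C (ψ (D.output y m) j) * X ^ (j : ℕ)
  have hS : ∀ y (j : Fin (2 * b)), (S y).coeff j = ψ (D.output y m) j := fun y j => by
    simp only [S, finsetSum_coeff, coeff_C_mul, coeff_X_pow]
    simp [Fin.val_inj]
  -- The entries of `x` lie in `F`, so `q` candidates suffice, independently of `s`.
  let V : Finset L := Finset.univ.image (algebraMap F L)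
  have hV : V.card ≤ Fintype.card F := Finset.card_image_le
  have h1 : Computes (registerVals (inputMemory (F := F) (m := m)))
      (D.length + 2 * b * (pb.dim * (m * 3 + 1))) (polyVals pb (2 * b) S) :=
    D.output_computes.bind fun Φ _ h => computes_polyVals fun j hj => by
      have h2 : ∀ y, (S y).coeff j =
          ∑ i, D.output y m i • ψ (Pi.single i 1) ⟨j, hj⟩ := fun y => by
        rw [hS y ⟨j, hj⟩]
        conv_lhs => rw [pi_eq_sum_univ' (D.output y m)]
        simp only [map_sum, map_smul, Finset.sum_apply, Pi.smul_apply]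
      simp only [h2]
      have := CompK.smul_sum (pb := pb) (Φ := Φ) Finset.univ
        (fun i : Fin m => ψ (Pi.single i 1) ⟨j, hj⟩) (f := fun i y => D.output y m i)
        fun i _ => h ⟨i, rfl⟩
      rwa [Finset.card_univ, Fintype.card_fin] at this
  have h2 := h1.bind fun Φ _ h => computes_sparseDecode hb V a v h
  have h3 : Computes (registerVals (inputMemory (F := F) (m := m))) _
      (⋃ i, {.inl fun y => π' (sparseDecode V a v b (S y) i)}) :=
    h2.bind (c' := n * (pb.dim * 3 + 1)) fun Φ _ h => by
      rw [Set.iUnion_subset_iff] at h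
      have := Computes.iUnion (ι := Fin n) (Φ := Φ) (c := pb.dim * 3 + 1)
        (Ψ := fun i => {.inl fun y => π' (sparseDecode V a v b (S y) i)}) fun i =>
        (CompF.functional π' (CompK.of_subset (h i))).mono_cost (by omega)
      rwa [Fintype.card_fin] at this
  obtain ⟨P, hP, hP'⟩ := h3.exists_program (fun i y => π' (sparseDecode V a v b (S y) i))
    fun i => Set.mem_iUnion.mpr ⟨i, rfl⟩
  refine ⟨P, hP.trans ?_, fun x hx y hy => ?_⟩
  · rw [opCost, hdim]
    have : 500 * ((b ^ 2 + n * b + n * V.card) * (10 * s ^ 2)) ≤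
        5000 * ((b ^ 2 + n * b + n * Fintype.card F) * s ^ 2) := by
      rw [show 500 * ((b ^ 2 + n * b + n * V.card) * (10 * s ^ 2)) =
        5000 * ((b ^ 2 + n * b + n * V.card) * s ^ 2) by ring]
      gcongr
    omega
  · rw [hP']
    funext i
    rw [sparseDecode_eq hb (e := fun i => algebraMap F L (x i)) ha hv
      (fun i => Finset.mem_image_of_mem _ (Finset.mem_univ _)), hπ']
    · simpa using hx
    · intro j hj
      rw [hS y ⟨j, hj⟩, hy, hψ]

end lifting

/-! ### The choice of the parameters -/

section parameters

variable {q : ℕ} {ε ρ x y : ℝ}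

/-- The function defining `tstar` is increasing for positive arguments, and a solution for positive
`R` must itself be positive. -/
theorem le_of_mul_rpow_le (hq : 2 ≤ q) (hε : 0 < ε) (hρ : 0 < ρ) (hx : 0 ≤ x) {R : ℝ}
    (hR : 0 < R) (hy : ε * ρ * y * (q : ℝ) ^ (ε * y) = R)
    (hxR : ε * ρ * x * (q : ℝ) ^ (ε * x) ≤ R) : x ≤ y := by
  have hq1 : (1 : ℝ) < q := by exact_mod_cast hq
  have hq0 : (0 : ℝ) < q := by linarith
  by_contra! hlt
  have hp : 0 < ε * ρ := mul_pos hε hρ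
  have h1 := Real.rpow_pos_of_pos hq0 (ε * y)
  have hy0 : 0 < y := by
    by_contra! h
    have : ε * ρ * y * (q : ℝ) ^ (ε * y) ≤ 0 :=
      mul_nonpos_of_nonpos_of_nonneg (mul_nonpos_of_nonneg_of_nonpos hp.le h) h1.le
    linarith
  have h2 : (q : ℝ) ^ (ε * y) ≤ (q : ℝ) ^ (ε * x) :=
    Real.rpow_le_rpow_of_exponent_le hq1.le (mul_le_mul_of_nonneg_left hlt.le hε.le)
  have h3 : ε * ρ * y * (q : ℝ) ^ (ε * y) < ε * ρ * x * (q : ℝ) ^ (ε * y) :=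
    mul_lt_mul_of_pos_right (mul_lt_mul_of_pos_left hlt hp) h1
  have h4 : ε * ρ * x * (q : ℝ) ^ (ε * y) ≤ ε * ρ * x * (q : ℝ) ^ (ε * x) :=
    mul_le_mul_of_nonneg_left h2 (mul_nonneg hp.le hx)
  linarith

/-- Rounding lowers the exponent by at most 1, hence the power by at most a factor `q`. -/
theorem rpow_div_le_pow_floor_ceil (hq : 2 ≤ q) (hε : 0 < ε) :
    (q : ℝ) ^ (ε * x) / q ≤ (q : ℝ) ^ ⌊ε * (⌈x⌉₊ : ℝ)⌋₊ := by
  have hq1 : (1 : ℝ) < q := by exact_mod_cast hq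
  rw [← Real.rpow_sub_one (by linarith), ← Real.rpow_natCast]
  refine Real.rpow_le_rpow_of_exponent_le hq1.le ?_
  have h1 := Nat.lt_floor_add_one (ε * (⌈x⌉₊ : ℝ))
  have h2 := mul_le_mul_of_nonneg_left (Nat.le_ceil x) hε.le
  linarith

theorem pow_floor_ceil_le (hq : 2 ≤ q) (hε : 0 < ε) (hε1 : ε ≤ 1) (hx : 0 ≤ x) :
    (q : ℝ) ^ ⌊ε * (⌈x⌉₊ : ℝ)⌋₊ ≤ q * (q : ℝ) ^ (ε * x) := by
  have hq1 : (1 : ℝ) < q := by exact_mod_cast hq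
  rw [mul_comm (q : ℝ), ← Real.rpow_add_one (by linarith), ← Real.rpow_natCast]
  refine Real.rpow_le_rpow_of_exponent_le hq1.le ?_
  have h1 := Nat.floor_le (a := ε * (⌈x⌉₊ : ℝ)) (by positivity)
  have h2 := mul_le_mul_of_nonneg_left (Nat.ceil_lt_add_one hx).le hε.le
  linarith

theorem le_conLength (hq : 2 ≤ q) (hε : 0 < ε) (hρ : 0 < ρ) (hx : 0 ≤ x) {R : ℝ}
    (hR : ε * ρ * x * (q : ℝ) ^ (ε * x) = 4 * q * R) :
    4 / (ε * ρ) * R ≤ (conLength q ε ⌈x⌉₊ : ℝ) := by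
  have hq0 : (0 : ℝ) < q := by positivity
  have h1 : (q : ℝ) ^ (ε * x) / q * x ≤ (conLength q ε ⌈x⌉₊ : ℝ) := by
    rw [conLength]; push_cast
    exact mul_le_mul (rpow_div_le_pow_floor_ceil hq hε) (Nat.le_ceil x) hx (by positivity)
  refine le_of_eq_of_le ?_ h1
  field_simp
  linarith

theorem conLength_le (hq : 2 ≤ q) (hε : 0 < ε) (hε1 : ε ≤ 1) (hρ : 0 < ρ) (hx : 1 ≤ x) {R : ℝ}
    (hR : ε * ρ * x * (q : ℝ) ^ (ε * x) = 4 * q * R) :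
    (conLength q ε ⌈x⌉₊ : ℝ) ≤ 8 * q ^ 2 / (ε * ρ) * R := by
  have hq0 : (0 : ℝ) < q := by positivity
  have h1 : (conLength q ε ⌈x⌉₊ : ℝ) ≤ q * (q : ℝ) ^ (ε * x) * (2 * x) := by
    rw [conLength]; push_cast
    have h2 := (Nat.ceil_lt_add_one (by linarith : 0 ≤ x)).le
    exact mul_le_mul (pow_floor_ceil_le hq hε hε1 (by linarith)) (by linarith)
      (by positivity) (by positivity)
  refine h1.trans_eq ?_
  field_simp
  linarith

/-- This explains the factor `4 * q` in the equation for `tstar`: rounding loses at most `q` in the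
power and at most 2 in the factor `⌊ε * t⌋₊`, and `2 * r` must remain. -/
theorem le_conDim (hq : 2 ≤ q) (hε : 0 < ε) (hρ : 0 < ρ) (hx : 2 ≤ ε * x) {r : ℕ}
    (hr : ε * ρ * x * (q : ℝ) ^ (ε * x) = 4 * q * r) : 2 * r ≤ conDim q ε ρ ⌈x⌉₊ := by
  have hq0 : (0 : ℝ) < q := by positivity
  have h1 : ε * x / 2 ≤ (⌊ε * (⌈x⌉₊ : ℝ)⌋₊ : ℝ) := by
    have h2 := Nat.lt_floor_add_one (ε * (⌈x⌉₊ : ℝ))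
    have h3 := mul_le_mul_of_nonneg_left (Nat.le_ceil x) hε.le
    linarith
  have h2 : ρ * ((q : ℝ) ^ (ε * x) / q) ≤ (⌈ρ * (q : ℝ) ^ ⌊ε * (⌈x⌉₊ : ℝ)⌋₊⌉₊ : ℝ) :=
    (mul_le_mul_of_nonneg_left (rpow_div_le_pow_floor_ceil hq hε) hρ.le).trans (Nat.le_ceil _)
  have h3 : (2 * r : ℝ) ≤ (conDim q ε ρ ⌈x⌉₊ : ℝ) := by
    rw [conDim]; push_cast
    refine le_of_eq_of_le ?_ (mul_le_mul h1 h2 (by positivity) (by positivity))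
    field_simp
    linarith
  exact_mod_cast h3

theorem le_pow_of_ceil_logb_le (hq : 2 ≤ q) {n s : ℕ} (hn : n ≠ 0)
    (hs : ⌈Real.logb q n⌉₊ ≤ s) : n ≤ q ^ s := by
  have h1 : Real.logb q n ≤ s := Nat.ceil_le.mp hs
  rw [Real.logb_le_iff_le_rpow (by exact_mod_cast hq) (by positivity), Real.rpow_natCast] at h1
  exact_mod_cast h1

theorem ceil_logb_le_two_mul (hq : 2 ≤ q) {n : ℕ} (hn : q ≤ n) :
    (⌈Real.logb q n⌉₊ : ℝ) ≤ 2 * Real.logb q n := by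
  have hq1 : (1 : ℝ) < q := by exact_mod_cast hq
  have hqn : (q : ℝ) ≤ n := by exact_mod_cast hn
  have h1 : 1 ≤ Real.logb q n := by
    rwa [Real.le_logb_iff_rpow_le hq1 (by linarith), Real.rpow_one]
  have := (Nat.ceil_lt_add_one (by linarith : 0 ≤ Real.logb q n)).le
  linarith

end parameters

/-! ### Final estimates in terms of `n`, `b` and `s`. -/

/-- For `z ≥ 3` the logarithm of `z` is at least 1, so the additive term `log κ` is absorbed into a
multiple of `log z`. -/
theorem sq_mul_log_le {κ m z : ℝ} (hm : 1 ≤ m) (hz : 3 ≤ z) (hmz : m ≤ κ * z) (hκ : 0 < κ) :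
    m ^ 2 * Real.log m ≤ κ ^ 2 * (|Real.log κ| + 1) * (z ^ 2 * Real.log z) := by
  have h1 : 1 ≤ Real.log z := by
    rw [Real.le_log_iff_exp_le (by linarith)]
    exact Real.exp_one_lt_three.le.trans hz
  have h2 : Real.log m ≤ (|Real.log κ| + 1) * Real.log z := by
    refine (Real.log_le_log (by linarith) hmz).trans ?_
    rw [Real.log_mul hκ.ne' (by linarith), add_mul, one_mul]
    have := le_abs_self (Real.log κ)
    have := mul_le_mul_of_nonneg_left h1 (abs_nonneg (Real.log κ))
    linarith
  have h3 : m ^ 2 ≤ (κ * z) ^ 2 := pow_le_pow_left₀ (by linarith) hmz 2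
  calc m ^ 2 * Real.log m ≤ (κ * z) ^ 2 * ((|Real.log κ| + 1) * Real.log z) :=
        mul_le_mul h3 h2 (Real.log_nonneg hm) (by positivity)
    _ = _ := by ring

/-- The operation count of the recovery program in terms of `n`, `b` and `s`. -/
theorem recovery_cost_le {A κ : ℝ} {d m n b s q p : ℕ} (hA : 0 ≤ A) (hκ : 0 < κ) (hm : 1 ≤ m)
    (hb : 3 ≤ b) (hs : 1 ≤ s) (hbn : b ≤ n) (hd : (d : ℝ) ≤ A * ((m : ℝ) ^ 2 * Real.log m))
    (hmκ : (m : ℝ) ≤ κ * (b * s))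
    (hp : p ≤ d + 2 * b * (s * (m * 3 + 1)) + 5000 * ((b ^ 2 + n * b + n * q) * s ^ 2) +
      n * (s * 3 + 1) + 2 * n) :
    (p : ℝ) ≤ (A * (κ ^ 2 * (|Real.log κ| + 1)) + 6 * κ + 5000 * (2 + q) + 8) *
      ((n + b * Real.log (b * s)) * b * s ^ 2) := by
  have hb' : (3 : ℝ) ≤ b := by exact_mod_cast hb
  have hs' : (1 : ℝ) ≤ s := by exact_mod_cast hs
  have hbn' : (b : ℝ) ≤ n := by exact_mod_cast hbn
  have hm' : (1 : ℝ) ≤ m := by exact_mod_cast hm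
  have hz : (3 : ℝ) ≤ b * s := by nlinarith
  have hlog : 0 ≤ Real.log (b * s) := Real.log_nonneg (by linarith)
  set ℓ := Real.log (b * s) with hℓ
  set c := A * (κ ^ 2 * (|Real.log κ| + 1)) with hc
  have hc0 : 0 ≤ c := by positivity
  have h1 : (d : ℝ) ≤ c * ((b * s) ^ 2 * ℓ) := by
    refine hd.trans ((mul_le_mul_of_nonneg_left (sq_mul_log_le hm' hz hmκ hκ) hA).trans_eq ?_)
    rw [hc]; ring
  have hp' : (p : ℝ) ≤ d + 2 * b * (s * (m * 3 + 1)) +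
      5000 * ((b ^ 2 + n * b + n * q) * s ^ 2) + n * (s * 3 + 1) + 2 * n := by
    exact_mod_cast hp
  set W : ℝ := n * b * s ^ 2 with hW
  have hW0 : 0 ≤ W := by positivity
  have hss : (s : ℝ) ≤ s ^ 2 := by nlinarith
  have h1s : (1 : ℝ) ≤ s ^ 2 := by nlinarith
  have hnb : (n : ℝ) ≤ n * b := by nlinarith
  have hns : (n : ℝ) * s ≤ W := mul_le_mul hnb hss (by positivity) (by positivity)
  have hn : (n : ℝ) ≤ W := by
    simpa using mul_le_mul hnb h1s zero_le_one (by positivity)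
  have hbs : (b : ℝ) * s ≤ W := (mul_le_mul_of_nonneg_right hbn' (by positivity)).trans hns
  have hbb : (b : ℝ) ^ 2 * s ^ 2 ≤ W := by
    refine mul_le_mul_of_nonneg_right ?_ (by positivity)
    nlinarith
  have hbsm : (b : ℝ) * s * m ≤ κ * W := by
    calc (b : ℝ) * s * m ≤ b * s * (κ * (b * s)) := mul_le_mul_of_nonneg_left hmκ (by positivity)
      _ = κ * (b ^ 2 * s ^ 2) := by ring
      _ ≤ κ * W := mul_le_mul_of_nonneg_left hbb hκ.le
  have hnq : (n : ℝ) * q * s ^ 2 ≤ q * W := by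
    calc (n : ℝ) * q * s ^ 2 = q * (n * s ^ 2) := by ring
      _ ≤ (q : ℝ) * (n * b * s ^ 2) := mul_le_mul_of_nonneg_left
          (mul_le_mul_of_nonneg_right hnb (by positivity)) (by positivity)
  set V : ℝ := (b * s) ^ 2 * ℓ with hV
  have hV0 : 0 ≤ V := by positivity
  have hsplit : ((n : ℝ) + b * ℓ) * b * s ^ 2 = W + V := by rw [hW, hV]; ring
  rw [hsplit]
  have e1 : 0 ≤ c * W := mul_nonneg hc0 hW0
  have e2 : 0 ≤ κ * V := mul_nonneg hκ.le hV0
  have e3 : 0 ≤ (q : ℝ) * V := by positivity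
  have hsum : (p : ℝ) ≤ d + 6 * (b * s * m) + 2 * (b * s) +
      5000 * (b ^ 2 * s ^ 2 + W + n * q * s ^ 2) + 3 * (n * s) + 3 * n := by
    refine hp'.trans_eq ?_
    rw [hW]; ring
  clear_value W V c ℓ
  have hexp : (c + 6 * κ + 5000 * (2 + q) + 8) * (W + V) = c * W + c * V + 6 * (κ * W) +
      6 * (κ * V) + 10000 * W + 10000 * V + 5000 * (q * W) + 5000 * (q * V) + 8 * W + 8 * V := by
    ring
  rw [hexp]
  linarith

theorem ncard_ne_zero_le_of_mem_fieldSignals {F : Type*} [Field F] {𝒜 : Finset ℝ}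
    {h0 : (0 : ℝ) ∈ 𝒜} {φ : 𝒜 ≃ F} (hφ : φ ⟨0, h0⟩ = 0) {n b : ℕ} {x : Fin n → F}
    (hx : x ∈ fieldSignals φ n b) : {i | x i ≠ 0}.ncard ≤ b := by
  obtain ⟨z, hz, rfl⟩ := hx
  have : {i | φ (z i) ≠ 0} = {i | (z i : ℝ) ≠ 0} := by
    ext i
    rw [Set.mem_ofPred_eq, Set.mem_ofPred_eq, ← hφ, φ.injective.ne_iff, ne_eq, Subtype.ext_iff]
  change {i | φ (z i) ≠ 0}.ncard ≤ b
  rw [this]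
  exact hz

end SparseRecovery

end
-- The main theorem.
theorem corollary2 {F : Type*} [Field F] [Fintype F] (lam ρ ε : ℝ)
    (hlam : lam ∈ Set.Ioo 0 (1 - 1 / (Fintype.card F : ℝ)))
    (hρ : ρ ∈ Set.Ioo (0 : ℝ) 1)
    (hε : ε ∈ Set.Ioo 0 (1 - SparseRecovery.qEntropy (Fintype.card F) lam)) :
    ∃ (Ccon : ∀ t : ℕ,
        Submodule F (Fin (SparseRecovery.conLength (Fintype.card F) ε t) → F))
      (a A c C c₁ c₂ : ℝ) (T B : ℕ),
      0 < a ∧ 0 < A ∧ 0 < c ∧ 0 < C ∧ 0 < c₁ ∧ 0 < c₂ ∧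
      (∀ t ≥ T, SparseRecovery.IsConCode lam ε ρ a A t (Ccon t)) ∧
      ∀ (b n s : ℕ), B ≤ b → B ≤ n → 2 * b < n →
        ⌈Real.logb (Fintype.card F) n⌉₊ ≤ s →
        ∀ (tstar : ℝ),
          ε * ρ * tstar * (Fintype.card F : ℝ) ^ (ε * tstar) =
            4 * (Fintype.card F : ℝ) * b * s →
          -- the code is one of the good ones, and the number of measurements
          T ≤ ⌈tstar⌉₊ ∧
          c₁ * (b * s) ≤ (SparseRecovery.conLength (Fintype.card F) ε ⌈tstar⌉₊ : ℝ) ∧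
          (SparseRecovery.conLength (Fintype.card F) ε ⌈tstar⌉₊ : ℝ) ≤ c₂ * (b * s) ∧
          (s = ⌈Real.logb (Fintype.card F) n⌉₊ →
            c₁ * (b * Real.logb (Fintype.card F) n) ≤
              (SparseRecovery.conLength (Fintype.card F) ε ⌈tstar⌉₊ : ℝ) ∧
            (SparseRecovery.conLength (Fintype.card F) ε ⌈tstar⌉₊ : ℝ) ≤
              c₂ * (b * Real.logb (Fintype.card F) n)) ∧
          -- field lifting to the extension of degree `s`, with a primitive element `α`
          ∀ (L : Type*) [Field L] [Algebra F L] (α : L),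
            Module.finrank F L = s → IsPrimitiveRoot α (Fintype.card F ^ s - 1) →
            (∃ A' : Matrix (Fin (SparseRecovery.conDim (Fintype.card F) ε ρ ⌈tstar⌉₊))
              (Fin n) F, SparseRecovery.HasRSRows α b s A') ∧
            ∀ (G : Matrix (Fin (SparseRecovery.conLength (Fintype.card F) ε ⌈tstar⌉₊))
                (Fin (SparseRecovery.conDim (Fintype.card F) ε ρ ⌈tstar⌉₊)) F)
              (A' : Matrix (Fin (SparseRecovery.conDim (Fintype.card F) ε ρ ⌈tstar⌉₊))
                (Fin n) F),
              SparseRecovery.IsGeneratorMatrix G (Ccon ⌈tstar⌉₊) →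
              SparseRecovery.HasRSRows α b s A' →
              ∃ P : SparseRecovery.Program F,
                (P.length : ℝ) ≤ C * ((n + b * Real.log (b * s)) * b * s ^ 2) ∧
                ∀ (𝒜 : Finset ℝ) (h0 : (0 : ℝ) ∈ 𝒜) (φ : 𝒜 ≃ F), φ ⟨0, h0⟩ = 0 →
                  ∀ x ∈ SparseRecovery.fieldSignals φ n b,
                    1 - (Fintype.card F : ℝ) ^ (-(c * b * s)) ≤
                      SparseRecovery.noiseProb lam
                        {e | P.output ((G * A') *ᵥ x + e) n = x} := by
  open SparseRecovery in
  classical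
  have hlam1 := lam_lt_one hlam
  have hq : 2 ≤ Fintype.card F := Fintype.one_lt_card
  have hε0 := hε.1
  have hρ0 := hρ.1
  have hε1 : ε ≤ 1 := by
    have := qEntropy_nonneg hq hlam.1 hlam1
    have := hε.2
    linarith
  obtain ⟨a, ha, T, hT⟩ := exists_isConCode (F := F) hlam hρ hε
  set q := Fintype.card F with hqdef
  choose! Ccon hCcon using hT
  have hq0 : (0 : ℝ) < q := by positivity
  have hq1 : (1 : ℝ) < q := by exact_mod_cast hq
  -- thresholds for `tstar` and for `b`, `n`
  set X : ℝ := T + 1 + 2 / ε with hX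
  have hX0 : 0 ≤ X := by positivity
  set κ : ℝ := 8 * q ^ 2 / (ε * ρ) with hκ
  have hκ0 : 0 < κ := by positivity
  -- The bound on `b` and `n` forces `tstar ≥ X` by monotonicity. Its summand `q` gives `logb q n ≥
  -- 1`, so that rounding up costs at most the factor 2 in `c₂`, and its summand 3 gives `b * s ≥
  -- 3`. The exponent `c` is `a` times the lower bound for `N / (b * s)`.
  refine ⟨Ccon, a, 20000, a * (4 / (ε * ρ)),
    20000 * (κ ^ 2 * (|Real.log κ| + 1)) + 6 * κ + 5000 * (2 + q) + 8, 4 / (ε * ρ) / 2,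
    κ * 2, T, ⌈ε * ρ * X * (q : ℝ) ^ (ε * X)⌉₊ + q + 3, ha, by norm_num, by positivity,
    by positivity, by positivity, by positivity, hCcon,
    fun b n s hbB hnB hbn hs tstar htstar => ?_⟩
  have hb3 : 3 ≤ b := by omega
  have hn0 : n ≠ 0 := by omega
  have hnq : n ≤ q ^ s := le_pow_of_ceil_logb_le hq hn0 hs
  have hs1 : 1 ≤ s := by
    by_contra! h
    obtain rfl : s = 0 := by omega
    simp at hnq
    omega
  have hbs0 : (0 : ℝ) < b * s := by
    have : 0 < b * s := Nat.mul_pos (by omega) hs1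
    exact_mod_cast this
  have hR : ε * ρ * tstar * (q : ℝ) ^ (ε * tstar) = 4 * q * (b * s) := by
    rw [htstar]; ring
  have hXt : X ≤ tstar := by
    refine le_of_mul_rpow_le hq hε0 hρ0 hX0 (by positivity) hR ?_
    have h1 : ε * ρ * X * (q : ℝ) ^ (ε * X) ≤ b :=
      (Nat.le_ceil _).trans (by exact_mod_cast (by omega))
    have h2 : (b : ℝ) ≤ b * s := le_mul_of_one_le_right (by positivity) (by exact_mod_cast hs1)
    nlinarith
  have hT0 : (0 : ℝ) ≤ T := by positivity
  have h2ε : 0 < 2 / ε := by positivity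
  have ht1 : 1 ≤ tstar := by linarith
  have htε : 2 ≤ ε * tstar := by
    have h1 : 2 / ε ≤ tstar := by linarith
    rw [div_le_iff₀ hε0] at h1
    linarith
  have htT : T ≤ ⌈tstar⌉₊ := by
    have h1 : (T : ℝ) ≤ ⌈tstar⌉₊ := by linarith [Nat.le_ceil tstar]
    exact_mod_cast h1
  have hmlow := le_conLength hq hε0 hρ0 (by linarith) hR
  have hmupp := conLength_le hq hε0 hε1 hρ0 ht1 hR
  rw [← hκ] at hmupp
  have hK : 2 * b * s ≤ conDim q ε ρ ⌈tstar⌉₊ := by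
    have := le_conDim (r := b * s) hq hε0 hρ0 htε (by rw [hR]; push_cast; ring)
    rwa [← mul_assoc] at this
  have hc1 : 0 < 4 / (ε * ρ) := by positivity
  refine ⟨htT, ?_, ?_, fun hseq => ⟨?_, ?_⟩, fun L _ _ α hfin hα => ⟨?_, fun G A' hG hA => ?_⟩⟩
  · refine le_trans ?_ hmlow
    exact mul_le_mul_of_nonneg_right (by linarith) hbs0.le
  · refine hmupp.trans ?_
    exact mul_le_mul_of_nonneg_right (by linarith) hbs0.le
  · refine le_trans ?_ hmlow
    refine mul_le_mul (by linarith) ?_ ?_ hc1.le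
    · exact mul_le_mul_of_nonneg_left (by rw [hseq]; exact Nat.le_ceil _) (by positivity)
    · exact mul_nonneg (by positivity) (Real.logb_nonneg hq1 (by exact_mod_cast (by omega)))
  · refine hmupp.trans ?_
    have h1 : (s : ℝ) ≤ 2 * Real.logb q n := by
      rw [hseq]; exact ceil_logb_le_two_mul hq (by omega)
    rw [mul_assoc κ]
    refine mul_le_mul_of_nonneg_left ?_ hκ0.le
    have := mul_le_mul_of_nonneg_left h1 (Nat.cast_nonneg (α := ℝ) b)
    linarith
  · rw [hqdef] at hnq
    rw [← Nat.card_eq_fintype_card] at hα hnq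
    exact exists_hasRSRows (by omega) hfin hα hnq (by omega) hK
  · obtain ⟨-, -, D, hD, hDec⟩ := hCcon _ htT
    obtain ⟨P, hP, hPout⟩ := exists_recoveryProgram (by omega) (by omega) hfin hG.1 hA D
    have hm1 : 1 ≤ conLength q ε ⌈tstar⌉₊ := by
      have h1 : (0 : ℝ) < conLength q ε ⌈tstar⌉₊ := lt_of_lt_of_le (by positivity) hmlow
      exact_mod_cast h1
    refine ⟨P, ?_, fun 𝒜 h0 φ hφ x hx => ?_⟩
    · exact recovery_cost_le (by norm_num) hκ0 hm1 hb3 hs1 (by omega) hD hmupp hP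
    -- The noiseless measurement is a codeword, and `P` succeeds whenever `D` does, so the error
    -- bound of the code carries over.
    · have hc : (G * A') *ᵥ x ∈ Ccon ⌈tstar⌉₊ :=
        (hG.2 _).mpr ⟨A' *ᵥ x, by rw [Matrix.mulVec_mulVec]⟩
      refine le_trans ?_ ((hDec _ hc).trans (noiseProb_mono hlam.1 hlam1 fun e he =>
        hPout x (ncard_ne_zero_le_of_mem_fieldSignals hφ hx) _ he))
      refine sub_le_sub_left (Real.rpow_le_rpow_of_exponent_le hq1.le (neg_le_neg ?_)) 1
      calc a * (4 / (ε * ρ)) * b * s = a * (4 / (ε * ρ) * (b * s)) := by ring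
        _ ≤ _ := mul_le_mul_of_nonneg_left hmlow ha.le
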